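/- We work over $\mathbb C$. Let $X=\{F=0\}\subset \mathbf P(2,1,1,1,1,1)$ be a smooth hypersurface of weighted degree $4$ (smooth in the sense of the Jacobian criterion: the affine cone $\{F=0\}\subset\mathbb C^6$ is non-singular away from the origin). Let $E$ be a vector bundle of rank two on $X$, let $Y\subset\mathfrak{sl}_2$ be the nilpotent cone, i.e. the closure of the orbit of non-zero nilpotent matrices, with its reduced structure, and let $s$ be a general global section of $\mathfrak{sl}(E)\otimes\mathcal O_X(1)$, where $\mathfrak{sl}(E)$ is the bundle of traceless endomorphisms of $E$ ("general": belonging to a suitable non-empty Zariski open subset of $H^0(X,\mathfrak{sl}(E)\otimes\mathcal O_X(1))$). Let $D_Y(s)\subset X$ be the closed subscheme which, over any open subset on which $E$ and $\mathcal O_X(1)$ are trivialized, is the scheme-theoretic preimage of $Y$ under the morphism to $\mathfrak{sl}_2$ given by $s$; its points are those $x\in X$ at which $s(x)$ is nilpotent. Then: 1. if $E=\mathcal O_X\oplus\mathcal O_X$, then there are a quadric $W\subset\mathbf P^4$, a quartic hypersurface $Z\subset\mathbf P^4$ and a double cover $D_Y(s)\to W$ over $\mathbb C$ ramified along $W\cap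 Z$. That is, $W\cap Z$ is an effective Cartier divisor on $W$ and, locally on $W$, the cover is $\operatorname{Spec}\mathcal O_W[t]/(t^2-f)$ with $f$ a local equation of $W\cap Z$; 2. if $E=\mathcal O_X\oplus\mathcal O_X(1)$, then $D_Y(s)$ is isomorphic over $\mathbb C$ to a quartic hypersurface in $\mathbf P^4$. Here a quadric (quartic) in $\mathbf P^4$ is the closed subscheme defined by a non-zero homogeneous polynomial of degree $2$ (degree $4$) in five variables; it need not be irreducible or smooth. -/

import Mathlib

open AlgebraicGeometry CategoryTheory MvPolynomial

noncomputable section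

namespace NilpotentLocus

/-- The base scheme `Spec ℂ`. -/
abbrev specC : Scheme.{0} := Spec (.of ℂ)

/-- Functions on an open subset of a complex scheme form a `ℂ`-algebra. -/
instance algebraSections (X : Scheme.{0}) [X.Over specC] (U : X.Opens) : Algebra ℂ Γ(X, U) :=
  ((Scheme.ΓSpecIso (.of ℂ)).inv ≫ (X ↘ specC).appTop ≫
    X.presheaf.map (homOfLE le_top).op).hom.toAlgebra

/-- Restriction of functions to a smaller open subset, as a homomorphism of `ℂ`-algebras. -/
def restrict {X : Scheme.{0}} [X.Over specC] {U V : X.Opens} (h : V ≤ U) :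
    Γ(X, U) →ₐ[ℂ] Γ(X, V) where
  toRingHom := (X.presheaf.map (homOfLE h).op).hom
  commutes' c := by
    change (((Scheme.ΓSpecIso (.of ℂ)).inv ≫ (X ↘ specC).appTop ≫
      X.presheaf.map (homOfLE le_top).op) ≫ X.presheaf.map (homOfLE h).op).hom c = _
    rw [Category.assoc, Category.assoc, ← X.presheaf.map_comp]
    rfl

/-! ### Weighted projective spaces and their hypersurfaces -/

section WeightedProj

variable {σ : Type}

attribute [local instance] MvPolynomial.weightedGradedAlgebra

/-- The polynomial ring over `ℂ`, graded by giving the variable `i` the weight `w i`. -/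
abbrev grading (w : σ → ℕ) : ℕ → Submodule ℂ (MvPolynomial σ ℂ) :=
  weightedHomogeneousSubmodule ℂ w

/-- The weighted projective space `ℙ(w)` over `ℂ`. If all weights are `1`, this is the usual
projective space. -/
def weightedProj (w : σ → ℕ) : Scheme.{0} := Proj (grading w)

instance (w : σ → ℕ) : (weightedProj w).Over specC where
  hom := Proj.toSpecZero (grading w) ≫
    Spec.map (CommRingCat.ofHom (algebraMap ℂ (grading w 0)))

/-- For a homogeneous `g`, the ideal of the degree zero part of `ℂ[x][1/g]` consisting of the
elements of degree zero of the ideal generated by `F` in `ℂ[x][1/g]`. -/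
def awayIdeal (w : σ → ℕ) (F g : MvPolynomial σ ℂ) :
    Ideal (HomogeneousLocalization.Away (grading w) g) :=
  ((Ideal.span {F}).map
      (algebraMap (MvPolynomial σ ℂ) (Localization (Submonoid.powers g)))).comap
    (algebraMap (HomogeneousLocalization.Away (grading w) g)
      (Localization (Submonoid.powers g)))

/-- The ideal sheaf on `ℙ(w)` associated with the ideal `(F)`, for `F` weighted homogeneous: the
largest ideal sheaf whose restriction to every chart `D₊(g) = Spec ℂ[x][1/g]₀`, with `g`
homogeneous of positive degree, is contained in `awayIdeal w F g`. Since these ideals are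
compatible with each other, its restriction to `D₊(g)` is `awayIdeal w F g`. -/
def hypersurfaceIdeal (w : σ → ℕ) (F : MvPolynomial σ ℂ) : (weightedProj w).IdealSheafData :=
  ⨅ (m : ℕ) (hm : 0 < m) (g : MvPolynomial σ ℂ) (hg : g ∈ grading w m),
    ((Spec.map (CommRingCat.ofHom (Ideal.Quotient.mk (awayIdeal w F g)))).ker).map
      (Proj.awayι (grading w) g hg hm)

/-- The hypersurface `{F = 0}` in `ℙ(w)`, as a closed subscheme. -/
def hypersurface (w : σ → ℕ) (F : MvPolynomial σ ℂ) : Scheme.{0} :=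
  (hypersurfaceIdeal w F).subscheme

/-- The inclusion of the hypersurface `{F = 0}` in `ℙ(w)`. -/
def hypersurfaceι (w : σ → ℕ) (F : MvPolynomial σ ℂ) : hypersurface w F ⟶ weightedProj w :=
  (hypersurfaceIdeal w F).subschemeι

instance (w : σ → ℕ) (F : MvPolynomial σ ℂ) : (hypersurface w F).Over specC where
  hom := hypersurfaceι w F ≫ (weightedProj w ↘ specC)

/-- Smoothness of the hypersurface `{F = 0}`, by the Jacobian criterion: the affine cone
`{F = 0}` has no singular point except, possibly, the origin. For a quartic `{F = 0}` in
`ℙ(2,1,1,1,1,1)` this is equivalent to the smoothness of the scheme `{F = 0}`; in particular such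
a quartic does not contain the point `(1:0:0:0:0:0)`, where all partial derivatives of a quartic
through it vanish. -/
def IsSmoothEquation (F : MvPolynomial σ ℂ) : Prop :=
  ∀ x : σ → ℂ, x ≠ 0 → eval x F = 0 → ∃ i, eval x (pderiv i F) ≠ 0

/-! ### The line bundles `𝒪(d)` on a hypersurface, over the charts of weight one -/

/-- The open subset `x_i ≠ 0` of the hypersurface `{F = 0}` in `ℙ(w)`. -/
def chart (w : σ → ℕ) (F : MvPolynomial σ ℂ) (i : σ) : (hypersurface w F).Opens :=
  hypersurfaceι w F ⁻¹ᵁ Proj.basicOpen (grading w) (X i)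

/-- The function `x_i / x_j` on the open subset `x_j ≠ 0` of the hypersurface `{F = 0}`, where
the variables `x_i` and `x_j` both have weight one. -/
def ratio (w : σ → ℕ) (F : MvPolynomial σ ℂ) {i j : σ} (hi : w i = 1) (hj : w j = 1) :
    Γ(hypersurface w F, chart w F j) :=
  ((hypersurfaceι w F).app (Proj.basicOpen (grading w) (X j))).hom
    ((Proj.awayToSection (grading w) (X j)).hom
      (HomogeneousLocalization.Away.mk (grading w) (d := 1)
        (show (X j).IsWeightedHomogeneous w 1 from hj ▸ isWeightedHomogeneous_X ℂ w j) 1 (X i)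
        (show (X i).IsWeightedHomogeneous w 1 from hi ▸ isWeightedHomogeneous_X ℂ w i)))

end WeightedProj

/-! ### Twisted nilpotent degeneracy loci for bundles of rank two

Let `E` be a vector bundle of rank two and `L` a line bundle on a complex scheme `X`, both
trivialized over the open subsets `U i` of a covering, with transition functions
`v_j = g i j * v_i` for `E` and `f_j = ℓ i j * f_i` for `L` on `U i ⊓ U j`. -/

section Degeneracy

variable {X : Scheme.{0}} [X.Over specC] {ι : Type} (U : ι → X.Opens)

/-- The vector space `H⁰(X, 𝔰𝔩(E) ⊗ L)`: a section is a family of traceless matrices `s i` over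
`U i` such that `s j = ℓ i j • (g i j * s i * (g i j)⁻¹)` on `U i ⊓ U j`. -/
def slSections (ℓ : ∀ i j, Γ(X, U i ⊓ U j))
    (g : ∀ i j, Matrix (Fin 2) (Fin 2) Γ(X, U i ⊓ U j)) :
    Submodule ℂ (∀ i, Matrix (Fin 2) (Fin 2) Γ(X, U i)) where
  carrier := {s | (∀ i, (s i).trace = 0) ∧
    ∀ i j, (restrict inf_le_right).mapMatrix (s j) * g i j =
      ℓ i j • (g i j * (restrict inf_le_left).mapMatrix (s i))}
  zero_mem' := ⟨fun i => by simp, fun i j => by simp⟩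
  add_mem' {s t} hs ht := ⟨fun i => by simp [hs.1 i, ht.1 i], fun i j => by
    simp only [Pi.add_apply, map_add, add_mul, mul_add, smul_add, hs.2 i j, ht.2 i j]⟩
  smul_mem' c s hs := ⟨fun i => by simp [hs.1 i], fun i j => by
    simp only [Pi.smul_apply, map_smul, smul_mul_assoc, mul_smul_comm, hs.2 i j]
    rw [smul_comm]⟩

/-- The ideal, in the coordinate ring of the space of `2 × 2` matrices, of the nilpotent cone of
`𝔰𝔩₂`, that is, of the set of nilpotent matrices with its reduced structure. -/
def nilpotentConeIdeal : Ideal (MvPolynomial (Fin 2 × Fin 2) ℂ) :=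
  vanishingIdeal ℂ 
    {m : Fin 2 × Fin 2 → ℂ | IsNilpotent (Matrix.of fun k l : Fin 2 => m (k, l))}

/-- The morphism from `U` to the affine space of `2 × 2` matrices given by a matrix of functions
on `U`. -/
def toMatrixSpace (V : X.Opens) (M : Matrix (Fin 2) (Fin 2) Γ(X, V)) :
    V.toScheme ⟶ Spec (.of (MvPolynomial (Fin 2 × Fin 2) ℂ)) :=
  V.toSpecΓ ≫ Spec.map (CommRingCat.ofHom
    (aeval (R := ℂ) fun p : Fin 2 × Fin 2 => M p.1 p.2).toRingHom)

/-- The ideal sheaf of the locus `D_Y(s)`, where `Y` is the nilpotent cone: over `U i` it is the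
ideal sheaf of the scheme theoretic preimage of `Y` under `s i`. As these agree on the overlaps,
`D_Y(s)` is the union of the closures of these preimages. -/
def degeneracyIdeal (s : ∀ i, Matrix (Fin 2) (Fin 2) Γ(X, U i)) : X.IdealSheafData :=
  ⨅ i, ((Spec.map (CommRingCat.ofHom (Ideal.Quotient.mk nilpotentConeIdeal))).ker.comap
    (toMatrixSpace (U i) (s i))).map (U i).ι

/-- The degeneracy locus `D_Y(s)`, as a closed subscheme of `X`. -/
def degeneracyLocus (s : ∀ i, Matrix (Fin 2) (Fin 2) Γ(X, U i)) : Scheme.{0} :=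
  (degeneracyIdeal U s).subscheme

instance (s : ∀ i, Matrix (Fin 2) (Fin 2) Γ(X, U i)) : (degeneracyLocus U s).Over specC where
  hom := (degeneracyIdeal U s).subschemeι ≫ (X ↘ specC)

end Degeneracy

/-! ### The quartics in `ℙ(2,1,1,1,1,1)` -/

/-- The weights `(2,1,1,1,1,1)`. -/
def weights : Fin 6 → ℕ := ![2, 1, 1, 1, 1, 1]

/-- The weights `(1,1,1,1,1)`; the corresponding weighted projective space is `ℙ⁴`. -/
def unitWeights : Fin 5 → ℕ := fun _ => 1

lemma weights_succ (i : Fin 5) : weights i.succ = 1 := by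
  fin_cases i <;> rfl

/-- The open sets `x_i ≠ 0`, `i = 1, …, 5`, of the quartic `{F = 0}` in `ℙ(2,1,1,1,1,1)`. They
cover it if it does not contain the singular point `(1:0:0:0:0:0)` of `ℙ(2,1,1,1,1,1)`. -/
def quarticChart (F : MvPolynomial (Fin 6) ℂ) (i : Fin 5) : (hypersurface weights F).Opens :=
  chart weights F i.succ

/-- The transition functions `x_i / x_j` of the line bundle `𝒪(1)` on the quartic: a section of
`𝒪(d)` is a family `f i` with `f j = (x_i / x_j) ^ d * f i`, corresponding to `f i * x_i ^ d`. -/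
def transition (F : MvPolynomial (Fin 6) ℂ) (i j : Fin 5) :
    Γ(hypersurface weights F, quarticChart F i ⊓ quarticChart F j) :=
  restrict inf_le_right
    (ratio weights F (weights_succ i) (weights_succ j))

/-- The vector space `H⁰(X, 𝔰𝔩(E) ⊗ 𝒪(1))` for the bundle `E = 𝒪(a 0) ⊕ 𝒪(a 1)` on the quartic
`X = {F = 0}` in `ℙ(2,1,1,1,1,1)`. -/
def quarticSections (F : MvPolynomial (Fin 6) ℂ) (a : Fin 2 → ℕ) :
    Submodule ℂ (∀ i, Matrix (Fin 2) (Fin 2) Γ(hypersurface weights F, quarticChart F i)) :=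
  slSections (quarticChart F) (transition F)
    fun i j => Matrix.diagonal fun k => transition F i j ^ a k

/-! ### General elements and double covers -/

/-- A property of the elements of a complex vector space holds for a general element if it holds
on a non-empty Zariski open subset, that is, wherever some polynomial function, not identically
zero, does not vanish. -/
def ForGeneral {V : Type*} [AddCommGroup V] [Module ℂ V] (P : V → Prop) : Prop :=
  ∃ f ∈ Algebra.adjoin ℂ {f : V → ℂ | ∃ φ : V →ₗ[ℂ] ℂ, f = φ},
    f ≠ 0 ∧ ∀ v, f v ≠ 0 → P v

/-- `π : D ⟶ W` is a double cover ramified along the closed subscheme of `W` with ideal sheaf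
`B`, which has to be an effective Cartier divisor: `π` is affine and, locally on `W`, the
`𝒪_W`-algebra `π_* 𝒪_D` is `𝒪_W[t] / (t ^ 2 - f)`, where `f` is a local equation of `B`. -/
def IsDoubleCoverRamifiedAlong {D W : Scheme.{0}} (π : D ⟶ W) (B : W.IdealSheafData) : Prop :=
  IsAffineHom π ∧ ∀ x : W, ∃ U : W.affineOpens, x ∈ U.1 ∧
    ∃ f ∈ nonZeroDivisors Γ(W, U.1), ∃ t : Γ(D, π ⁻¹ᵁ U.1),
      B.ideal U = Ideal.span {f} ∧
      t ^ 2 = (π.app U.1).hom f ∧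
      ∀ z : Γ(D, π ⁻¹ᵁ U.1), ∃! p : Γ(W, U.1) × Γ(W, U.1),
        z = (π.app U.1).hom p.1 + (π.app U.1).hom p.2 * t

end NilpotentLocus

end

/-! A traceless 2×2 matrix is nilpotent exactly when its determinant vanishes, and this holds at the
level of ideals: on traceless matrices over any `ℂ`-algebra the ideal of the reduced nilpotent cone
generates the same ideal as the determinant (`map_nilpotentConeIdeal`). Hence `D_Y(s)` is cut out on
`X` by one equation `Δ = det s` of weight 2.

Let `y` be the variable of weight two and write `F = c y² + q y + r` with `q`, `r` forms of degrees
2 and 4 in the other variables. Smoothness forces `c ≠ 0` (`leading_coeff_ne_zero`) and `q² - 4 c r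
≠ 0` (`discriminant_ne_zero`). Since `c ≠ 0`, `X` misses the point `(1:0:0:0:0:0)`, so projection
from that point is a morphism to `ℙ⁴`. Over the chart `x_i ≠ 0`, with coordinate ring `B`, the
functions on the locus are `B[y]/(F, Δ)` (`exists_degeneracy_projection`). Also, `ℂ[x,y]/F` is free
over `ℂ[x]` with basis `1, y`; from this, sections of `𝒪(d)` on `X` are polynomials of weight `d`
(`transition_mul_eq_iff`), so a section of `𝔰𝔩(E)(1)` is a matrix of polynomials
(`exists_equiv_quarticSections`).

For `E = 𝒪 ⊕ 𝒪` the entries are linear forms not involving `y`, so `Δ = Q` is a quadratic form in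
the `x_i`. The locus lies over the quadric `Q = 0`, where it is given by `c y² + q y + r = 0`;
putting `t = 2 c y + q` turns this into `t² = R`, with `R = q² - 4 c r` (`exists_sqrt_discriminant`,
`exists_doubleCover`). For general `s` the form `Q` has no common factor with `R`, which makes `R` a
non-zero-divisor on the quadric (`exists_finset_isRelPrime`).

For `E = 𝒪 ⊕ 𝒪(1)` the entries off the diagonal have weights 0 and 2. In general `y` occurs in the
one of weight 2 and the one of weight 0 is a non-zero constant, so `Δ = μ (y - N)` with `μ ≠ 0`.
Eliminating `y` identifies the locus with the quartic `c N² + q N + r = 0` (`surjective_comp_C`,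
`degeneracyLocus_iso_quartic`). -/

noncomputable section

namespace NilpotentLocus

/-! ### Pullback of ideal sheaves and glueing of kernels. -/

section IdealSheaves

open Scheme

/-- The ideal of global sections of the pullback of an ideal sheaf along a morphism between affine
schemes. -/
lemma ideal_comap_top {X Y : Scheme.{0}} (hX : IsAffine X) (hY : IsAffine Y) (f : X ⟶ Y)
    (I : Y.IdealSheafData) :
    (I.comap f).ideal ⟨⊤, isAffineOpen_top X⟩ =
      (I.ideal ⟨⊤, isAffineOpen_top Y⟩).map f.appTop.hom := by
  have hid (J : Ideal Γ(X, ⊤)) :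
      (IdealSheafData.ofIdealTop J).ideal ⟨⊤, isAffineOpen_top X⟩ = J :=
    IdealSheafData.equivOfIsAffine.right_inv J
  apply le_antisymm
  -- Pullback is left adjoint to pushforward on ideal sheaves, so the bound need only be tested on
  -- `Y`.
  · have h : I.comap f ≤
        IdealSheafData.ofIdealTop ((I.ideal ⟨⊤, isAffineOpen_top Y⟩).map f.appTop.hom) := by
      rw [← IdealSheafData.le_map_iff_comap_le]
      apply IdealSheafData.le_of_isAffine
      rw [IdealSheafData.ideal_map _ f ⟨⊤, isAffineOpen_top Y⟩ (isAffineOpen_top X),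
        ← Ideal.map_le_iff_le_comap]
      exact (hid _).ge
    exact (h _).trans (hid _).le
  · rw [Ideal.map_le_iff_le_comap]
    have := (IdealSheafData.le_map_comap I f) ⟨⊤, isAffineOpen_top Y⟩
    rwa [IdealSheafData.ideal_map _ f ⟨⊤, isAffineOpen_top Y⟩ (isAffineOpen_top X)] at this

lemma ideal_comap_ι_top {X : Scheme.{0}} (I : X.IdealSheafData) (V : X.affineOpens)
    (h : IsAffine V.1) :
    (I.comap V.1.ι).ideal ⟨⊤, isAffineOpen_top V.1⟩ = (I.ideal V).map V.1.topIso.inv.hom := by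
  refine (IdealSheafData.ideal_comap_of_isOpenImmersion _ _ _).trans ?_
  have e : V.1.ι ''ᵁ ⊤ = V.1 := by simp
  have hV : IsAffineOpen (V.1.ι ''ᵁ ⊤) := by rw [e]; exact V.2
  have := I.map_ideal' (U := ⟨_, hV⟩) (V := V) (eqToHom e).op
  rw [show I.ideal ⟨V.1.ι ''ᵁ ⊤, _⟩ = _ from this.symm]
  simp only [Opens.ι_appIso]
  exact Ideal.comap_id _

/-- The ideal of the pullback of an ideal sheaf to an affine open subset which is mapped to an
affine open subset. -/
lemma ideal_comap_appLE {X Y : Scheme.{0}} (f : X ⟶ Y) (I : Y.IdealSheafData)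
    (U : Y.affineOpens) (V : X.affineOpens) (h : V.1 ≤ f ⁻¹ᵁ U.1) :
    (I.comap f).ideal V = (I.ideal U).map (f.appLE U.1 V.1 h).hom := by
  have e : (I.comap f).comap V.1.ι = (I.comap U.1.ι).comap (f.resLE U.1 V.1 h) := by
    rw [← IdealSheafData.comap_comp, ← IdealSheafData.comap_comp, Hom.resLE_comp_ι]
  have hU : IsAffine U.1 := U.2
  have hV : IsAffine V.1 := V.2
  have key := congr(($e).ideal ⟨⊤, isAffineOpen_top V.1⟩)
  rw [ideal_comap_top hV hU, ideal_comap_ι_top _ _ hV, ideal_comap_ι_top _ _ hU, Ideal.map_map,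
    ← CommRingCat.hom_comp, Hom.appTop, Hom.resLE_app_top, Iso.inv_hom_id_assoc,
    CommRingCat.hom_comp, ← Ideal.map_map] at key
  have := congr(Ideal.map V.1.topIso.hom.hom $key)
  simpa only [Ideal.map_map, ← CommRingCat.hom_comp, Category.assoc, Iso.inv_hom_id,
    Category.comp_id, CommRingCat.hom_id, Ideal.map_id] using this

/-- If the preimages under `f` of two affine open subsets `V ≤ U` agree, then the kernel of `f`
over `U` consists of the functions whose restriction to `V` belongs to the kernel over `V`. -/
lemma ker_ideal_eq_comap {Z Y : Scheme.{0}} (f : Z ⟶ Y) [QuasiCompact f] {U V : Y.affineOpens}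
    (h : V ≤ U) (hf : f ⁻¹ᵁ U.1 ≤ f ⁻¹ᵁ V.1) :
    f.ker.ideal U = (f.ker.ideal V).comap (Y.presheaf.map (homOfLE h).op).hom := by
  refine le_antisymm (f.ker.ideal_le_comap_ideal h) fun x hx => ?_
  rw [Ideal.mem_comap, Hom.ker_apply, RingHom.mem_ker] at hx
  rw [Hom.ker_apply, RingHom.mem_ker]
  have hle : f ⁻¹ᵁ V.1 ≤ f ⁻¹ᵁ U.1 := fun x hx => h hx
  have e : f ⁻¹ᵁ U.1 = f ⁻¹ᵁ V.1 := le_antisymm hf hle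
  have h1 : Z.presheaf.map (homOfLE hle).op ≫ Z.presheaf.map (homOfLE hf).op = 𝟙 _ := by
    rw [← Functor.map_comp, ← op_comp]
    exact Z.presheaf.map_id _
  have h2 := congr(($(f.naturality (homOfLE h).op)).hom x)
  simp only [CommRingCat.hom_comp, RingHom.comp_apply] at h2
  rw [hx] at h2
  have h3 := congr(($h1).hom ((f.app U.1).hom x))
  simp only [CommRingCat.hom_comp, RingHom.comp_apply] at h3
  refine h3.symm.trans ?_
  exact (congr((Z.presheaf.map (homOfLE hf).op).hom $h2.symm)).trans (map_zero _)

/-- Glueing of the kernels of morphisms to a scheme which agree on the overlaps. -/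
lemma ideal_iInf_ker {Y : Scheme.{0}} {ι : Type} [Finite ι] {Z : ι → Scheme.{0}}
    (f : ∀ i, Z i ⟶ Y) [∀ i, QuasiCompact (f i)] (V : ι → Y.affineOpens)
    (hV : ∀ i j, IsAffineOpen ((V i).1 ⊓ (V j).1)) (hf : ∀ i, f i ⁻¹ᵁ (V i).1 = ⊤)
    (h : ∀ i j, (f i).ker.ideal ⟨_, hV i j⟩ = (f j).ker.ideal ⟨_, hV i j⟩) (j : ι) :
    (⨅ i, (f i).ker).ideal (V j) = (f j).ker.ideal (V j) := by
  rw [IdealSheafData.ideal_iInf, iInf_apply]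
  refine le_antisymm (iInf_le _ j) (le_iInf fun i => ?_)
  have hle : (⟨_, hV i j⟩ : Y.affineOpens) ≤ V j := inf_le_right (a := (V i).1) (b := (V j).1)
  -- As `f i` factors through `V i`, its kernel over `V j` is determined on the intersection, where
  -- it agrees with the kernel of `f j`.
  rw [ker_ideal_eq_comap (f i) hle, h i j]
  · exact (f j).ker.ideal_le_comap_ideal hle
  · intro x hx
    exact ⟨by have : x ∈ f i ⁻¹ᵁ (V i).1 := by rw [hf i]; trivial
              exact this, hx⟩

end IdealSheaves

/-! ### Closed subschemes of the standard charts of `Proj`. -/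

section ProjCharts

open Scheme HomogeneousLocalization

lemma comp_appLE_top {X Y Z : Scheme.{0}} (f : X ⟶ Y) (g : Y ⟶ Z) (U : Z.Opens)
    (h : ⊤ ≤ g ⁻¹ᵁ U) (h' : ⊤ ≤ (f ≫ g) ⁻¹ᵁ U) :
    (f ≫ g).appLE U ⊤ h' = g.appLE U ⊤ h ≫ f.appTop := by
  have := Hom.appLE_comp_appLE f g U ⊤ ⊤ h le_top
  rw [← this]
  congr 1
  exact Hom.appLE_eq_app f

lemma bijective_presheaf_map {X : Scheme.{0}} {U V : X.Opens} (h : V ≤ U) (h' : U ≤ V) :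
    Function.Bijective (X.presheaf.map (homOfLE h).op).hom := by
  have : IsIso (homOfLE h) := ⟨homOfLE h', rfl, rfl⟩
  exact ConcreteCategory.bijective_of_isIso (X.presheaf.map (homOfLE h).op)

variable {A τ : Type} [CommRing A] [SetLike τ A] [AddSubgroupClass τ A] (𝒜 : ℕ → τ) [GradedRing 𝒜]

lemma top_le_awayι_preimage {f : A} {m : ℕ} (hf : f ∈ 𝒜 m) (hm : 0 < m) :
    ⊤ ≤ Proj.awayι 𝒜 f hf hm ⁻¹ᵁ Proj.basicOpen 𝒜 f := by
  rw [← Proj.opensRange_awayι 𝒜 f hf hm]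
  simp

lemma awayToSection_awayι_appLE {f : A} {m : ℕ} (hf : f ∈ 𝒜 m) (hm : 0 < m) :
    Proj.awayToSection 𝒜 f ≫ (Proj.awayι 𝒜 f hf hm).appLE (Proj.basicOpen 𝒜 f) ⊤
      (top_le_awayι_preimage 𝒜 hf hm) = (Scheme.ΓSpecIso _).inv := by
  have h1 : Proj.awayToSection 𝒜 f ≫ (Proj.basicOpen 𝒜 f).topIso.inv =
      (Scheme.ΓSpecIso _).inv ≫ (Proj.basicOpenIsoSpec 𝒜 f hf hm).hom.appTop := by
    rw [Iso.eq_inv_comp]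
    exact (Proj.basicOpenToSpec_app_top 𝒜 f).symm
  have h2 : (Proj.awayι 𝒜 f hf hm).appLE (Proj.basicOpen 𝒜 f) ⊤ (top_le_awayι_preimage 𝒜 hf hm) =
      (Proj.basicOpen 𝒜 f).topIso.inv ≫ (Proj.basicOpenIsoSpec 𝒜 f hf hm).inv.appTop := by
    refine (comp_appLE_top _ (Proj.basicOpen 𝒜 f).ι _ (by simp) _).trans ?_
    congr 1
  rw [h2, reassoc_of% h1, ← Hom.comp_appTop, Iso.inv_hom_id, Hom.id_appTop]
  exact Category.comp_id _

/-- The closed immersion of the spectrum of a quotient of the coordinate ring of a chart, followed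
by the inclusion of the chart. -/
def quotientChart {f : A} {m : ℕ} (hf : f ∈ 𝒜 m) (hm : 0 < m) (J : Ideal (Away 𝒜 f)) :
    Spec (.of (Away 𝒜 f ⧸ J)) ⟶ Proj 𝒜 :=
  Spec.map (CommRingCat.ofHom (Ideal.Quotient.mk J)) ≫ Proj.awayι 𝒜 f hf hm

instance {f : A} {m : ℕ} (hf : f ∈ 𝒜 m) (hm : 0 < m) (J : Ideal (Away 𝒜 f)) :
    IsAffineHom (quotientChart 𝒜 hf hm J) :=
  IsAffineHom.of_comp _ (Limits.terminal.from (Proj 𝒜))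

lemma quotientChart_preimage {f : A} {m : ℕ} (hf : f ∈ 𝒜 m) (hm : 0 < m) (J : Ideal (Away 𝒜 f)) :
    quotientChart 𝒜 hf hm J ⁻¹ᵁ Proj.basicOpen 𝒜 f = ⊤ := by
  rw [quotientChart, Hom.comp_preimage, top_le_iff.1 (top_le_awayι_preimage 𝒜 hf hm)]
  rfl

lemma awayToSection_quotientChart_appLE {f : A} {m : ℕ} (hf : f ∈ 𝒜 m) (hm : 0 < m)
    (J : Ideal (Away 𝒜 f)) :
    Proj.awayToSection 𝒜 f ≫ (quotientChart 𝒜 hf hm J).appLE (Proj.basicOpen 𝒜 f) ⊤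
        (quotientChart_preimage 𝒜 hf hm J).ge =
      CommRingCat.ofHom (Ideal.Quotient.mk J) ≫ (Scheme.ΓSpecIso _).inv := by
  rw [show (quotientChart 𝒜 hf hm J).appLE (Proj.basicOpen 𝒜 f) ⊤
      (quotientChart_preimage 𝒜 hf hm J).ge = _ from
      comp_appLE_top _ _ _ (top_le_awayι_preimage 𝒜 hf hm) _,
    reassoc_of% awayToSection_awayι_appLE 𝒜 hf hm]
  exact (Scheme.ΓSpecIso_inv_naturality _).symm

lemma awayToSection_bijective {f : A} {m : ℕ} (hf : f ∈ 𝒜 m) (hm : 0 < m) :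
    Function.Bijective (Proj.awayToSection 𝒜 f).hom :=
  (Proj.basicOpenIsoAway 𝒜 f hf hm).commRingCatIsoToRingEquiv.bijective

lemma quotientChart_ker {f : A} {m : ℕ} (hf : f ∈ 𝒜 m) (hm : 0 < m) (J : Ideal (Away 𝒜 f)) :
    (quotientChart 𝒜 hf hm J).ker.ideal ⟨_, Proj.isAffineOpen_basicOpen 𝒜 f hf hm⟩ =
      J.map (Proj.awayToSection 𝒜 f).hom := by
  have hbij := awayToSection_bijective 𝒜 hf hm
  have hinj := (bijective_presheaf_map (quotientChart_preimage 𝒜 hf hm J).ge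
    (quotientChart_preimage 𝒜 hf hm J).le).1
  rw [Hom.ker_apply]
  ext z
  obtain ⟨a, rfl⟩ := hbij.2 z
  have : (Proj.awayToSection 𝒜 f).hom a ∈ J.map (Proj.awayToSection 𝒜 f).hom ↔ a ∈ J := by
    refine ⟨fun h => ?_, Ideal.mem_map_of_mem _⟩
    obtain ⟨b, hb, hab⟩ := (Ideal.mem_map_iff_of_surjective _ hbij.2).1 h
    rwa [← hbij.1 hab]
  rw [this, RingHom.mem_ker, ← map_eq_zero_iff _ hinj]
  have h2 := congr(($(awayToSection_quotientChart_appLE 𝒜 hf hm J)).hom a)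
  rw [Hom.appLE] at h2
  simp only [CommRingCat.hom_comp, RingHom.comp_apply] at h2
  refine Iff.trans (Eq.congr_left h2) ?_
  rw [map_eq_zero_iff _ (ConcreteCategory.bijective_of_isIso (Scheme.ΓSpecIso _).inv).1]
  exact Ideal.Quotient.eq_zero_iff_mem

/-- Kernels coming from different charts can be compared only on a common smaller chart; this
computes them there. -/
lemma quotientChart_ker_mul {f g x : A} {m n : ℕ} (hf : f ∈ 𝒜 m) (hm : 0 < m) (hg : g ∈ 𝒜 n)
    (hx : x = f * g) (hx' : IsAffineOpen (Proj.basicOpen 𝒜 x)) (J : Ideal (Away 𝒜 f)) :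
    (quotientChart 𝒜 hf hm J).ker.ideal ⟨_, hx'⟩ =
      (J.map (awayMap 𝒜 hg hx)).map (Proj.awayToSection 𝒜 x).hom := by
  have hle : Proj.basicOpen 𝒜 x ≤ Proj.basicOpen 𝒜 f := Proj.basicOpen_mono _ _ _ ⟨_, hx⟩
  rw [← IdealSheafData.map_ideal _ (V := ⟨_, Proj.isAffineOpen_basicOpen 𝒜 f hf hm⟩)
    (U := ⟨_, hx'⟩) hle, quotientChart_ker, Ideal.map_map, Ideal.map_map, ← CommRingCat.hom_comp]
  congr 1
  exact congr(($(Proj.awayMap_awayToSection 𝒜 hg hx)).hom).symm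

end ProjCharts

/-! ### The ideals of a hypersurface on the standard charts. -/

section AwayIdeal

open HomogeneousLocalization

attribute [local instance] MvPolynomial.weightedGradedAlgebra

variable {σ : Type} {w : σ → ℕ}

lemma mem_awayIdeal {F g : MvPolynomial σ ℂ} {a : Away (grading w) g} :
    a ∈ awayIdeal w F g ↔ algebraMap (MvPolynomial σ ℂ) (Localization (.powers g)) F ∣ a.val := by
  rw [awayIdeal, Ideal.mem_comap, Ideal.map_span, Set.image_singleton,
    Ideal.mem_span_singleton]
  rfl

/-- Clearing denominators turns membership in the chart ideals into divisibility of polynomials, the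
form used in all later computations. -/
lemma algebraMap_dvd_iff {R : Type} [CommRing R] {F g a : R} {s : Submonoid.powers g} :
    algebraMap R (Localization (.powers g)) F ∣ Localization.mk a s ↔ ∃ N, F ∣ g ^ N * a := by
  rw [Localization.mk_eq_mk']
  obtain ⟨_, n, rfl⟩ := s
  constructor
  · rintro ⟨b, hb⟩
    obtain ⟨⟨b, _, k, rfl⟩, rfl⟩ := IsLocalization.mk'_surjective (Submonoid.powers g) b
    rw [← IsLocalization.mk'_one (M := Submonoid.powers g), ← IsLocalization.mk'_mul,
      IsLocalization.mk'_eq_iff_eq, IsLocalization.eq_iff_exists (Submonoid.powers g)] at hb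
    obtain ⟨⟨_, l, rfl⟩, hl⟩ := hb
    simp only [one_mul] at hl
    exact ⟨l + k, g ^ l * g ^ n * b, by rw [pow_add]; linear_combination hl⟩
  · rintro ⟨N, b, hb⟩
    refine ⟨IsLocalization.mk' _ b (⟨g ^ (N + n), N + n, rfl⟩ : Submonoid.powers g), ?_⟩
    rw [← IsLocalization.mk'_one (M := Submonoid.powers g), ← IsLocalization.mk'_mul,
      IsLocalization.mk'_eq_iff_eq]
    congr 1
    simp only [one_mul, pow_add]
    linear_combination g ^ n * hb

lemma mk_mem_awayIdeal {F g : MvPolynomial σ ℂ} {d : ℕ} (hg : g ∈ grading w d) {n : ℕ}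
    {a : MvPolynomial σ ℂ} (ha : a ∈ grading w (n • d)) :
    Away.mk (grading w) hg n a ha ∈ awayIdeal w F g ↔ ∃ N, F ∣ g ^ N * a := by
  rw [mem_awayIdeal, Away.val_mk, algebraMap_dvd_iff]

/-- The fractions over `fg` are the localization of those over `f` at `g^m / f^n`, and the ideals
are compatible with it. This is what makes the chart ideals glue to an ideal sheaf. -/
lemma awayIdeal_mul {F f g x : MvPolynomial σ ℂ} {m n : ℕ} (hf : f ∈ grading w m)
    (hm : m ≠ 0) (hg : g ∈ grading w n) (hx : x = f * g) :
    awayIdeal w F x = (awayIdeal w F f).map (awayMap (grading w) hg hx) := by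
  apply le_antisymm
  · intro z hz
    let _ := (awayMap (grading w) hg hx).toAlgebra
    have := Away.isLocalization_mul hf hg hx hm
    obtain ⟨⟨b, _, N, rfl⟩, hb⟩ :=
      IsLocalization.surj (Submonoid.powers (Away.isLocalizationElem hf hg)) z
    have hu := IsLocalization.map_units (Away (grading w) x)
      (⟨_, N, rfl⟩ : Submonoid.powers (Away.isLocalizationElem hf hg))
    rw [← Ideal.mul_unit_mem_iff_mem _ hu, hb]
    have hmem : algebraMap _ (Away (grading w) x) b ∈ awayIdeal w F x := by
      rw [← hb]
      exact Ideal.mul_mem_right _ _ hz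
    obtain ⟨k, a, ha, rfl⟩ := Away.mk_surjective (grading w) hf b
    change awayMap (grading w) hg hx _ ∈ _ at hmem
    change awayMap (grading w) hg hx _ ∈ _
    rw [awayMap_mk, mk_mem_awayIdeal] at hmem
    obtain ⟨M, hM⟩ := hmem
    -- The exponent `M + k` supplies the `M` factors `g` from `x ^ M` and the `k` from the numerator
    -- of the image of `b`; the surplus is the factor `g ^ ((m - 1) * (M + k))` below.
    have hN : Away.isLocalizationElem hf hg ^ (M + k) * Away.mk (grading w) hf k a ha ∈
        awayIdeal w F f := by
      rw [mem_awayIdeal, val_mul, val_pow, Away.val_mk, Away.val_mk, Localization.mk_pow,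
        Localization.mk_mul, algebraMap_dvd_iff]
      refine ⟨M, hM.trans ⟨g ^ ((m - 1) * (M + k)), ?_⟩⟩
      obtain ⟨m, rfl⟩ := Nat.exists_eq_succ_of_ne_zero hm
      simp only [hx, Nat.succ_eq_add_one, Nat.add_sub_cancel, mul_pow]
      ring
    have := Ideal.mem_map_of_mem (awayMap (grading w) hg hx) hN
    rw [map_mul] at this
    have hu' : IsUnit (awayMap (grading w) hg hx (Away.isLocalizationElem hf hg ^ (M + k))) :=
      IsLocalization.map_units (Away (grading w) x)
        (⟨_, M + k, rfl⟩ : Submonoid.powers (Away.isLocalizationElem hf hg))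
    rwa [Ideal.unit_mul_mem_iff_mem _ hu'] at this
  · rw [Ideal.map_le_iff_le_comap]
    intro a ha
    obtain ⟨k, a, ha', rfl⟩ := Away.mk_surjective (grading w) hf a
    rw [mk_mem_awayIdeal] at ha
    obtain ⟨N, hN⟩ := ha
    rw [Ideal.mem_comap, awayMap_mk, mk_mem_awayIdeal]
    refine ⟨N, ?_⟩
    rw [hx, mul_pow]
    exact (hN.mul_left (g ^ N * g ^ k)).trans (dvd_of_eq (by ring))

lemma X_mem_grading (i : σ) : X i ∈ grading w (w i) := isWeightedHomogeneous_X ℂ w i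

/-- Where a variable of weight one is inverted, `F` can be divided by a power of it to have degree
zero, so the ideal is principal; on a general chart it need not be. -/
lemma awayIdeal_X [DecidableEq σ] {F : MvPolynomial σ ℂ} {d : ℕ} (hF : F ∈ grading w d) {i : σ}
    (hi : X i ∈ grading w 1) (hd : F ∈ grading w (d • 1)) :
    awayIdeal w F (X i) = Ideal.span {Away.mk (grading w) hi d F hd} := by
  apply le_antisymm
  · intro z hz
    obtain ⟨n, a, ha, rfl⟩ := Away.mk_surjective (grading w) hi z
    obtain ⟨N, u, hu⟩ := (mk_mem_awayIdeal hi ha).1 hz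
    -- The extra factor `X i ^ d` puts the degree above that of `F`. The cofactor may then be
    -- replaced by its homogeneous component of degree `N + n`.
    have ha' : X i ^ (N + d) * a ∈ grading w (N + n + d) := by
      have := SetLike.mul_mem_graded (SetLike.pow_mem_graded (N + d) hi) ha
      convert this using 2
      simp only [smul_eq_mul, mul_one]; ring
    have h1 : X i ^ (N + d) * a =
        F * (DirectSum.decompose (grading w) (X i ^ d * u) (N + n)).1 := by
      have := DirectSum.coe_decompose_mul_of_left_mem_of_le (𝒜 := grading w) (b := X i ^ d * u)
        (n := N + n + d) hF (by lia)
      rw [Nat.add_sub_cancel] at this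
      rw [← this, ← DirectSum.decompose_of_mem_same (grading w) ha']
      congr 3
      rw [pow_add]; linear_combination X i ^ d * hu
    rw [Ideal.mem_span_singleton]
    refine ⟨Away.mk (grading w) hi (N + n)
      (DirectSum.decompose (grading w) (X i ^ d * u) (N + n)) (by simp), ?_⟩
    ext
    rw [val_mul, Away.val_mk, Away.val_mk, Away.val_mk, Localization.mk_mul,
      Localization.mk_eq_mk_iff, Localization.r_iff_exists]
    refine ⟨1, ?_⟩
    simp only [Submonoid.coe_mul, OneMemClass.coe_one, one_mul]
    rw [← h1]; ring
  · rw [Ideal.span_singleton_le_iff_mem, mk_mem_awayIdeal]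
    exact ⟨0, by simp⟩

end AwayIdeal

/-! ### The ideal sheaf of a hypersurface is determined by the coordinate charts. -/

section Hypersurface

open HomogeneousLocalization Scheme

attribute [local instance] MvPolynomial.weightedGradedAlgebra

variable {σ : Type} {w : σ → ℕ}

lemma irrelevant_le_span_X :
    (HomogeneousIdeal.irrelevant (grading w)).toIdeal ≤ Ideal.span (Set.range X) := by
  rw [HomogeneousIdeal.toIdeal_irrelevant_le]
  intro n hn p hp
  rw [← Set.image_univ]
  refine mem_ideal_span_X_image.2 ?_
  intro m hm
  by_contra! h
  have : m = 0 := by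
    ext i
    simpa using h i (Set.mem_univ _)
  subst this
  have := hp (mem_support_iff.1 hm)
  simp at this
  omega

lemma iSup_basicOpen_X : ⨆ i : σ, Proj.basicOpen (grading w) (X i) = ⊤ :=
  Proj.iSup_basicOpen_eq_top _ _ irrelevant_le_span_X

lemma isAffineOpen_X {i : σ} (hi : 0 < w i) : IsAffineOpen (Proj.basicOpen (grading w) (X i)) :=
  Proj.isAffineOpen_basicOpen _ _ (X_mem_grading i) hi

lemma isAffineOpen_X_mul {g : MvPolynomial σ ℂ} {m : ℕ} (hg : g ∈ grading w m) {i : σ}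
    (hi : 0 < w i) : IsAffineOpen (Proj.basicOpen (grading w) (X i * g)) :=
  Proj.isAffineOpen_basicOpen _ _ (SetLike.mul_mem_graded (X_mem_grading i) hg) (by lia)

/-- The ideal of a hypersurface over a chart, transported to the homogeneous localization. -/
def chartIdeal (w : σ → ℕ) (F g : MvPolynomial σ ℂ) :
    Ideal Γ(Proj (grading w), Proj.basicOpen (grading w) g) :=
  (awayIdeal w F g).map (Proj.awayToSection (grading w) g).hom

lemma chartIdeal_mul {i : σ} (hi : 0 < w i) (F : MvPolynomial σ ℂ) {g : MvPolynomial σ ℂ} {m : ℕ}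
    (hg : g ∈ grading w m) : chartIdeal w F (X i * g) = (chartIdeal w F (X i)).map
      ((Proj (grading w)).presheaf.map
        (homOfLE (Proj.basicOpen_mono (grading w) _ _ ⟨g, rfl⟩)).op).hom := by
  rw [chartIdeal, chartIdeal, awayIdeal_mul (X_mem_grading i) hi.ne' hg rfl, Ideal.map_map,
    Ideal.map_map, ← CommRingCat.hom_comp]
  congr 1
  exact congr(($(Proj.awayMap_awayToSection (grading w) hg rfl)).hom)

lemma quotientChart_ker_awayIdeal {F f g x : MvPolynomial σ ℂ} {m n : ℕ} (hf : f ∈ grading w m)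
    (hm : 0 < m) (hg : g ∈ grading w n) (hx : x = f * g)
    (hx' : IsAffineOpen (Proj.basicOpen (grading w) x)) :
    (quotientChart (grading w) hf hm (awayIdeal w F f)).ker.ideal ⟨_, hx'⟩ = chartIdeal w F x := by
  rw [quotientChart_ker_mul _ hf hm hg hx, ← awayIdeal_mul hf hm.ne' hg hx]
  rfl

/-- The ideal sheaf of a hypersurface, described by the charts `x_i ≠ 0`. -/
def coordinateIdeal (hw : ∀ i, 0 < w i) (F : MvPolynomial σ ℂ) :
    (Proj (grading w)).IdealSheafData :=
  ⨅ i, (quotientChart (grading w) (X_mem_grading i) (hw i) (awayIdeal w F (X i))).ker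

lemma coordinateIdeal_X [Finite σ] (hw : ∀ i, 0 < w i) (F : MvPolynomial σ ℂ) (i : σ) :
    (coordinateIdeal hw F).ideal ⟨_, isAffineOpen_X (hw i)⟩ = chartIdeal w F (X i) := by
  have hV (i j : σ) : Proj.basicOpen (grading w) (X i) ⊓ Proj.basicOpen (grading w) (X j) =
      Proj.basicOpen (grading w) (X i * X j) := (Proj.basicOpen_mul _ _ _).symm
  have haff (i j : σ) : IsAffineOpen (Proj.basicOpen (grading w) (X i) ⊓
      Proj.basicOpen (grading w) (X j)) := by
    rw [hV]; exact isAffineOpen_X_mul (X_mem_grading j) (hw i)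
  refine (ideal_iInf_ker (fun i => quotientChart (grading w) (X_mem_grading i) (hw i)
    (awayIdeal w F (X i))) (fun i => ⟨_, isAffineOpen_X (hw i)⟩) haff
    (fun i => quotientChart_preimage _ _ _ _) (fun i j => ?_) i).trans
    (quotientChart_ker _ _ _ _)
  have e : (⟨_, haff i j⟩ : (Proj (grading w)).affineOpens) =
    ⟨_, isAffineOpen_X_mul (X_mem_grading j) (hw i)⟩ := Subtype.ext (hV i j)
  change Scheme.IdealSheafData.ideal _ ⟨_, haff i j⟩ = Scheme.IdealSheafData.ideal _ ⟨_, haff i j⟩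
  rw [e, quotientChart_ker_awayIdeal _ _ (X_mem_grading j) rfl,
    quotientChart_ker_awayIdeal _ _ (X_mem_grading i) (mul_comm _ _)]

lemma hypersurfaceIdeal_eq_iInf (F : MvPolynomial σ ℂ) : hypersurfaceIdeal w F =
    ⨅ (m : ℕ) (hm : 0 < m) (g : MvPolynomial σ ℂ) (hg : g ∈ grading w m),
      (quotientChart (grading w) hg hm (awayIdeal w F g)).ker :=
  iInf_congr fun _ => iInf_congr fun hm => iInf_congr fun g => iInf_congr fun hg =>
    IdealSheafData.map_ker (Spec.map (CommRingCat.ofHom (Ideal.Quotient.mk (awayIdeal w F g))))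
      (Proj.awayι (grading w) g hg hm)

/-- The charts `D₊(g)` of other elements `g` impose no new condition: over `D₊(X i)` theirs is
tested on `D₊(X i * g)`, where the ideal is the restriction of the one on `D₊(X i)`. -/
lemma hypersurfaceIdeal_eq [Finite σ] (hw : ∀ i, 0 < w i) (F : MvPolynomial σ ℂ) :
    hypersurfaceIdeal w F = coordinateIdeal hw F := by
  rw [hypersurfaceIdeal_eq_iInf]
  apply le_antisymm
  · exact le_iInf fun i => iInf_le_of_le (w i) <| iInf_le_of_le (hw i) <| iInf_le_of_le (X i) <|
      iInf_le_of_le (X_mem_grading i) le_rfl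
  · refine le_iInf fun m => le_iInf fun hm => le_iInf fun g => le_iInf fun hg => ?_
    refine IdealSheafData.le_of_iSup_eq_top (fun i => ⟨_, isAffineOpen_X (hw i)⟩)
      iSup_basicOpen_X fun i => ?_
    have hle : Proj.basicOpen (grading w) (X i * g) ≤ Proj.basicOpen (grading w) (X i) :=
      Proj.basicOpen_mono _ _ _ ⟨_, rfl⟩
    have hle' : (⟨_, isAffineOpen_X_mul hg (hw i)⟩ : (Proj (grading w)).affineOpens) ≤
      ⟨_, isAffineOpen_X (hw i)⟩ := hle
    have hpre : quotientChart (grading w) hg hm (awayIdeal w F g) ⁻¹ᵁ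
          Proj.basicOpen (grading w) (X i) ≤
        quotientChart (grading w) hg hm (awayIdeal w F g) ⁻¹ᵁ
          Proj.basicOpen (grading w) (X i * g) := by
      rw [Proj.basicOpen_mul, Hom.preimage_inf, quotientChart_preimage]
      simp
    rw [ker_ideal_eq_comap _ hle' hpre,
      quotientChart_ker_awayIdeal hg hm (X_mem_grading i) (mul_comm _ _), coordinateIdeal_X,
      ← Ideal.map_le_iff_le_comap]
    exact (chartIdeal_mul (hw i) F hg).ge

lemma hypersurfaceIdeal_X [Finite σ] (hw : ∀ i, 0 < w i) (F : MvPolynomial σ ℂ) (i : σ) :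
    (hypersurfaceIdeal w F).ideal ⟨_, isAffineOpen_X (hw i)⟩ = chartIdeal w F (X i) := by
  rw [hypersurfaceIdeal_eq hw]
  exact coordinateIdeal_X hw F i

lemma hypersurfaceIdeal_X_mul [Finite σ] (hw : ∀ i, 0 < w i) (F : MvPolynomial σ ℂ) (i : σ)
    {g : MvPolynomial σ ℂ} {m : ℕ} (hg : g ∈ grading w m) :
    (hypersurfaceIdeal w F).ideal ⟨_, isAffineOpen_X_mul hg (hw i)⟩ =
      chartIdeal w F (X i * g) := by
  rw [chartIdeal_mul (hw i) F hg, ← hypersurfaceIdeal_X hw]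
  exact (IdealSheafData.map_ideal (hypersurfaceIdeal w F) (V := ⟨_, isAffineOpen_X (hw i)⟩)
    (U := ⟨_, isAffineOpen_X_mul hg (hw i)⟩)
    (Proj.basicOpen_mono (grading w) _ _ ⟨g, rfl⟩)).symm

end Hypersurface

/-! ### Homogeneous fractions and constants as functions on a scheme over `ℙ(w)`. -/

section PullbackOfFractions

open HomogeneousLocalization Scheme

attribute [local instance] MvPolynomial.weightedGradedAlgebra

variable {σ : Type} {w : σ → ℕ}

lemma appTop_presheaf_map {Y : Scheme.{0}} {R : CommRingCat.{0}} (s : Y ⟶ Spec R) {U : Y.Opens}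
    (φ : R ⟶ Γ(Y, U)) (h : U.ι ≫ s = U.toSpecΓ ≫ Spec.map φ) :
    (Scheme.ΓSpecIso R).inv ≫ s.appTop ≫ Y.presheaf.map (homOfLE (le_top : U ≤ ⊤)).op = φ := by
  have := congr(Hom.appTop $h)
  rw [Hom.comp_appTop, Hom.comp_appTop, Opens.toSpecΓ_appTop, Opens.ι_appTop,
    Scheme.ΓSpecIso_naturality_assoc] at this
  rw [Iso.inv_comp_eq, ← cancel_mono U.topIso.inv, Category.assoc, Category.assoc, ← this]
  congr 1
  exact (Y.presheaf.map_comp _ _).symm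

/-- The pullback of homogeneous fractions of degree zero with denominator a power of `g` along a
morphism to the weighted projective space. -/
def pullHom {D : Scheme.{0}} (p : D ⟶ Proj (grading w)) (g : MvPolynomial σ ℂ) :
    Away (grading w) g →+* Γ(D, p ⁻¹ᵁ Proj.basicOpen (grading w) g) :=
  (Proj.awayToSection (grading w) g ≫ p.app (Proj.basicOpen (grading w) g)).hom

lemma restrict_pullHom {D : Scheme.{0}} [D.Over specC] (p : D ⟶ Proj (grading w))
    {f g x : MvPolynomial σ ℂ} {n : ℕ}
    (hg : g ∈ grading w n) (hx : x = f * g) (a : Away (grading w) f)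
    (h : p ⁻¹ᵁ Proj.basicOpen (grading w) x ≤ p ⁻¹ᵁ Proj.basicOpen (grading w) f) :
    restrict h (pullHom p f a) = pullHom p x (awayMap (grading w) hg hx a) := by
  have h1 := congr(($(Proj.awayMap_awayToSection (grading w) hg hx)).hom a)
  have h2 := congr(($(p.naturality
    (homOfLE (Proj.basicOpen_mono (grading w) _ _ ⟨_, hx⟩)).op)).hom
      ((Proj.awayToSection (grading w) f).hom a))
  exact h2.symm.trans (congrArg (p.app _).hom h1).symm

/-- Constants, as homogeneous fractions of degree zero. -/
def constHom (w : σ → ℕ) (g : MvPolynomial σ ℂ) : ℂ →+* Away (grading w) g :=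
  (fromZeroRingHom (grading w) (.powers g)).comp (algebraMap ℂ (grading w 0))

lemma val_constHom (g : MvPolynomial σ ℂ) (c : ℂ) : (constHom w g c).val =
    algebraMap (MvPolynomial σ ℂ) _ (C c) := by
  rw [← Localization.mk_one_eq_algebraMap]
  rfl

lemma ι_comp_over {g : MvPolynomial σ ℂ} {m : ℕ} (hg : g ∈ grading w m) (hm : 0 < m) :
    (Proj.basicOpen (grading w) g).ι ≫
      Proj.toSpecZero (grading w) ≫ Spec.map (CommRingCat.ofHom (algebraMap ℂ (grading w 0))) =
    Proj.basicOpenToSpec (grading w) g ≫ Spec.map (CommRingCat.ofHom (constHom w g)) := by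
  have h : (Proj.basicOpen (grading w) g).ι =
      Proj.basicOpenToSpec (grading w) g ≫ Proj.awayι (grading w) g hg hm := by
    rw [Proj.awayι, ← Proj.basicOpenIsoSpec_hom _ _ hg hm, Iso.hom_inv_id_assoc]
  rw [h, Category.assoc, Proj.awayι_toSpecZero_assoc, constHom, CommRingCat.ofHom_comp,
    Spec.map_comp]

lemma algebraMap_pullHom {D : Scheme.{0}} [D.Over specC] (p : D ⟶ Proj (grading w))
    (hp : p ≫ Proj.toSpecZero (grading w) ≫
      Spec.map (CommRingCat.ofHom (algebraMap ℂ (grading w 0))) = D ↘ specC)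
    {g : MvPolynomial σ ℂ} {m : ℕ} (hg : g ∈ grading w m) (hm : 0 < m) (c : ℂ) :
    algebraMap ℂ Γ(D, p ⁻¹ᵁ Proj.basicOpen (grading w) g) c = pullHom p g (constHom w g c) := by
  have h1 := appTop_presheaf_map _ (CommRingCat.ofHom (constHom w g) ≫
    Proj.awayToSection (grading w) g) ((ι_comp_over hg hm).trans (by
      rw [Proj.basicOpenToSpec, Category.assoc, ← Spec.map_comp]))
  have h2 : (Scheme.ΓSpecIso (.of ℂ)).inv ≫ (D ↘ specC).appTop ≫
      D.presheaf.map (homOfLE (le_top : p ⁻¹ᵁ Proj.basicOpen (grading w) g ≤ ⊤)).op =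
      CommRingCat.ofHom (constHom w g) ≫ Proj.awayToSection (grading w) g ≫
        p.app (Proj.basicOpen (grading w) g) := by
    rw [← hp, Hom.comp_appTop, Category.assoc]
    have := p.naturality (homOfLE (le_top : Proj.basicOpen (grading w) g ≤ ⊤)).op
    have h3 : p.appTop ≫ D.presheaf.map
        (homOfLE (le_top : p ⁻¹ᵁ Proj.basicOpen (grading w) g ≤ ⊤)).op = _ := this.symm
    rw [h3, reassoc_of% h1]
  exact congr(($h2).hom c)

end PullbackOfFractions

/-! ### Coordinate rings of the charts of a hypersurface. -/

section ChartRings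

open HomogeneousLocalization Scheme

attribute [local instance] MvPolynomial.weightedGradedAlgebra

variable {σ : Type} {w : σ → ℕ}

/-- A homogeneous fraction of degree zero with denominator a power of `g`, regarded as a function
on the part of the hypersurface `{F = 0}` where `g ≠ 0`. -/
def sectionHom (w : σ → ℕ) (F g : MvPolynomial σ ℂ) : Away (grading w) g →+*
    Γ(hypersurface w F, hypersurfaceι w F ⁻¹ᵁ Proj.basicOpen (grading w) g) :=
  pullHom (w := w) (hypersurfaceι w F) g

lemma sectionHom_surjective (F : MvPolynomial σ ℂ) {g : MvPolynomial σ ℂ} {m : ℕ}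
    (hg : g ∈ grading w m) (hm : 0 < m) : Function.Surjective (sectionHom w F g) :=
  ((hypersurfaceIdeal w F).subschemeι_app_surjective
    ⟨_, Proj.isAffineOpen_basicOpen _ g hg hm⟩).comp (awayToSection_bijective _ hg hm).2

lemma ker_sectionHom {F g : MvPolynomial σ ℂ} {m : ℕ} (hg : g ∈ grading w m) (hm : 0 < m)
    (h : (hypersurfaceIdeal w F).ideal ⟨_, Proj.isAffineOpen_basicOpen _ g hg hm⟩ =
      chartIdeal w F g) : RingHom.ker (sectionHom w F g) = awayIdeal w F g := by
  have := (hypersurfaceIdeal w F).ker_subschemeι_app ⟨_, Proj.isAffineOpen_basicOpen _ g hg hm⟩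
  rw [h] at this
  refine (RingHom.comap_ker _ _).symm.trans
    ((congrArg (Ideal.comap (Proj.awayToSection (grading w) g).hom) this).trans ?_)
  rw [chartIdeal, Ideal.comap_map_of_surjective _ (awayToSection_bijective _ hg hm).2,
    sup_eq_left, ← RingHom.ker_eq_comap_bot,
    (RingHom.injective_iff_ker_eq_bot _).1 (awayToSection_bijective _ hg hm).1]
  exact bot_le

lemma ker_sectionHom_X [Finite σ] (hw : ∀ i, 0 < w i) (F : MvPolynomial σ ℂ) (i : σ) :
    RingHom.ker (sectionHom w F (X i)) = awayIdeal w F (X i) :=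
  ker_sectionHom (X_mem_grading i) (hw i) (hypersurfaceIdeal_X hw F i)

lemma ker_sectionHom_X_mul [Finite σ] (hw : ∀ i, 0 < w i) (F : MvPolynomial σ ℂ) (i : σ)
    {g : MvPolynomial σ ℂ} {m : ℕ} (hg : g ∈ grading w m) :
    RingHom.ker (sectionHom w F (X i * g)) = awayIdeal w F (X i * g) :=
  ker_sectionHom (SetLike.mul_mem_graded (X_mem_grading i) hg) (by have := hw i; lia)
    (hypersurfaceIdeal_X_mul hw F i hg)

lemma restrict_sectionHom (F : MvPolynomial σ ℂ) {f g x : MvPolynomial σ ℂ} {n : ℕ}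
    (hg : g ∈ grading w n) (hx : x = f * g) (a : Away (grading w) f)
    (h : hypersurfaceι w F ⁻¹ᵁ Proj.basicOpen (grading w) x ≤
      hypersurfaceι w F ⁻¹ᵁ Proj.basicOpen (grading w) f) :
    restrict h (sectionHom w F f a) = sectionHom w F x (awayMap (grading w) hg hx a) :=
  restrict_pullHom (w := w) (hypersurfaceι w F) hg hx a h

lemma algebraMap_sectionHom (F : MvPolynomial σ ℂ) {g : MvPolynomial σ ℂ} {m : ℕ}
    (hg : g ∈ grading w m) (hm : 0 < m) (c : ℂ) :
    algebraMap ℂ Γ(hypersurface w F, hypersurfaceι w F ⁻¹ᵁ Proj.basicOpen (grading w) g) c =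
      sectionHom w F g (constHom w g c) :=
  algebraMap_pullHom (w := w) (hypersurfaceι w F) rfl hg hm c

end ChartRings

/-! ### The ideal of the nilpotent cone of `𝔰𝔩₂`. -/

section NilpotentCone

lemma isNilpotent_fin_two {a b c : ℂ} (h : a ^ 2 + b * c = 0) :
    IsNilpotent !![a, b; c, -a] := by
  refine ⟨2, ?_⟩
  rw [pow_two, Matrix.mul_fin_two]
  ext i j
  fin_cases i <;> fin_cases j <;> simp <;> first | linear_combination h | ring

/-- A polynomial in two variables `y, z` and in `x` of degree at most one in `x` which vanishes on
`x ^ 2 + y * z = 0` is zero. -/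
lemma eq_zero_of_vanishing_on_cone {r : Polynomial (MvPolynomial (Fin 2) ℂ)}
    (hr : r.natDegree < 2) (h : ∀ x y z : ℂ, x ^ 2 + y * z = 0 →
      r.eval₂ (aeval ![y, z] : MvPolynomial (Fin 2) ℂ →ₐ[ℂ] ℂ) x = 0) : r = 0 := by
  have hr' : r = Polynomial.C (r.coeff 1) * Polynomial.X + Polynomial.C (r.coeff 0) :=
    Polynomial.eq_X_add_C_of_natDegree_le_one (by lia)
  -- The cone is symmetric under `x ↦ -x`, which separates the two coefficients.
  have key (y z x : ℂ) (hx : x ^ 2 + y * z = 0) : aeval ![y, z] (r.coeff 0) = 0 ∧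
      aeval ![y, z] (r.coeff 1) * x = 0 := by
    have h1 := h x y z hx
    have h2 := h (-x) y z (by linear_combination hx)
    rw [hr'] at h1 h2
    simp only [Polynomial.eval₂_add, Polynomial.eval₂_mul, Polynomial.eval₂_C,
      Polynomial.eval₂_X, RingHom.coe_coe] at h1 h2
    constructor
    · linear_combination (h1 + h2) / 2
    · linear_combination (h1 - h2) / 2
  have hsqrt (y z : ℂ) : ∃ x : ℂ, x ^ 2 + y * z = 0 := by
    obtain ⟨x, hx⟩ := IsAlgClosed.exists_pow_nat_eq (-(y * z)) two_pos
    exact ⟨x, by rw [hx]; ring⟩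
  have hvec (v : Fin 2 → ℂ) : ![v 0, v 1] = v := by
    ext i; fin_cases i <;> rfl
  have h0 : r.coeff 0 = 0 := by
    refine MvPolynomial.funext fun v => ?_
    obtain ⟨x, hx⟩ := hsqrt (v 0) (v 1)
    have := (key _ _ x hx).1
    rw [hvec] at this
    simpa [aeval_eq_eval] using this
  -- Multiplying `r₁ x = 0` by `x` and using `x² = -yz` removes the square root.
  have h1 : r.coeff 1 * (X 0 * X 1) = 0 := by
    refine MvPolynomial.funext fun v => ?_
    obtain ⟨x, hx⟩ := hsqrt (v 0) (v 1)
    have := (key _ _ x hx).2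
    rw [hvec] at this
    simp only [aeval_eq_eval] at this
    simp only [map_mul, eval_X, map_zero]
    linear_combination eval v (r.coeff 1) * hx - x * this
  rw [hr', h0, (mul_eq_zero.1 h1).resolve_right (mul_ne_zero (X_ne_zero 0) (X_ne_zero 1))]
  simp

/-- A polynomial in the entries of a matrix which vanishes on all nilpotent matrices vanishes on
the traceless matrices of determinant zero over every `ℂ`-algebra. -/
lemma aeval_eq_zero_of_mem_nilpotentConeIdeal {A : Type} [CommRing A] [Algebra ℂ A]
    {M : Fin 2 × Fin 2 → A} (hM : M (0, 0) + M (1, 1) = 0)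
    (hdet : M (0, 0) * M (1, 1) - M (0, 1) * M (1, 0) = 0)
    {p : MvPolynomial (Fin 2 × Fin 2) ℂ} (hp : p ∈ nilpotentConeIdeal) : aeval M p = 0 := by
  -- `N` is the generic traceless matrix and `D` is minus its determinant. As `D` is monic in `x`,
  -- division by it leaves a remainder of degree at most one in `x`.
  let N : Fin 2 × Fin 2 → Polynomial (MvPolynomial (Fin 2) ℂ) := fun k =>
    !![Polynomial.X, Polynomial.C (X 0); Polynomial.C (X 1), -Polynomial.X] k.1 k.2
  let D : Polynomial (MvPolynomial (Fin 2) ℂ) := Polynomial.X ^ 2 + Polynomial.C (X 0 * X 1)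
  have hD : D.Monic := Polynomial.monic_X_pow_add_C _ two_ne_zero
  have hdeg : D.natDegree = 2 := Polynomial.natDegree_X_pow_add_C
  -- This is applied twice: over `ℂ` it shows that the remainder vanishes on the cone, hence is
  -- zero; over `A` it then gives the claim.
  have hev {B : Type} [CommRing B] [Algebra ℂ B] (M : Fin 2 × Fin 2 → B)
      (hM : M (0, 0) + M (1, 1) = 0) (hdet : M (0, 0) * M (1, 1) - M (0, 1) * M (1, 0) = 0) :
      aeval M p = (aeval N p %ₘ D).eval₂
        (aeval ![M (0, 1), M (1, 0)] : MvPolynomial (Fin 2) ℂ →ₐ[ℂ] B) (M (0, 0)) := by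
    let E : Polynomial (MvPolynomial (Fin 2) ℂ) →ₐ[ℂ] B :=
      { Polynomial.eval₂RingHom (aeval ![M (0, 1), M (1, 0)] :
            MvPolynomial (Fin 2) ℂ →ₐ[ℂ] B).toRingHom (M (0, 0)) with
        commutes' := fun c => by
          simp [Polynomial.algebraMap_apply] }
    have hX : E Polynomial.X = M (0, 0) := Polynomial.eval₂_X _ _
    have hC (q) : E (Polynomial.C q) = aeval ![M (0, 1), M (1, 0)] q := Polynomial.eval₂_C _ _
    have h1 : E (aeval N p) = aeval M p := by
      rw [comp_aeval_apply]
      congr 2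
      ext k
      fin_cases k
      · simp [N, hX]
      · simp [N, hC]
      · simp [N, hC]
      · simp [N, hX]
        linear_combination -hM
    have h2 : E D = 0 := by
      simp [D, hX, hC]
      linear_combination M (0, 0) * hM - hdet
    rw [← h1]
    conv_lhs => rw [← Polynomial.modByMonic_add_div (aeval N p) D]
    rw [map_add, map_mul, h2, zero_mul, add_zero]
    rfl
  have hr : aeval N p %ₘ D = 0 := by
    apply eq_zero_of_vanishing_on_cone
    · exact (Polynomial.natDegree_modByMonic_lt _ hD (fun h => by simp [h] at hdeg)).trans_eq hdeg
    · intro x y z h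
      have := hev (fun k => !![x, y; z, -x] k.1 k.2) (by simp) (by simp; linear_combination -h)
      rw [mem_vanishingIdeal_iff.1 hp _ (isNilpotent_fin_two h)] at this
      exact this.symm
  rw [hev M hM hdet, hr, Polynomial.eval₂_zero]

/-- Over `A / (det M)` the matrix is traceless with determinant zero, so every equation of the cone
vanishes there. Conversely the determinant itself is an equation of the cone. -/
lemma map_nilpotentConeIdeal {A : Type} [CommRing A] [Algebra ℂ A]
    {M : Matrix (Fin 2) (Fin 2) A} (hM : M.trace = 0) :
    nilpotentConeIdeal.map (aeval (R := ℂ) fun k : Fin 2 × Fin 2 => M k.1 k.2).toRingHom =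
      Ideal.span {M.det} := by
  apply le_antisymm
  · rw [Ideal.map_le_iff_le_comap]
    intro p hp
    let φ : A →ₐ[ℂ] A ⧸ Ideal.span {M.det} := Ideal.Quotient.mkₐ ℂ _
    rw [Matrix.trace_fin_two] at hM
    have h := aeval_eq_zero_of_mem_nilpotentConeIdeal (M := fun k => φ (M k.1 k.2))
      (by rw [← map_add, hM, map_zero])
      (by
        rw [← map_mul, ← map_mul, ← map_sub, ← Matrix.det_fin_two]
        exact Ideal.Quotient.eq_zero_iff_mem.2 (Ideal.mem_span_singleton_self _)) hp
    rw [Ideal.mem_comap, ← Ideal.Quotient.eq_zero_iff_mem, ← h]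
    exact comp_aeval_apply _ φ p
  · rw [Ideal.span_singleton_le_iff_mem]
    have : X (0, 0) * X (1, 1) - X (0, 1) * X (1, 0) ∈ nilpotentConeIdeal := by
      rw [nilpotentConeIdeal, mem_vanishingIdeal_iff]
      intro m hm
      obtain ⟨n, hn⟩ := hm
      have h0 : (Matrix.of fun k l : Fin 2 => m (k, l)).det = 0 := by
        refine (pow_eq_zero_iff n.succ_ne_zero).1 ?_
        rw [← Matrix.det_pow, pow_succ, hn, zero_mul, Matrix.det_zero]
      rw [Matrix.det_fin_two] at h0
      simpa using h0
    have h := Ideal.mem_map_of_mem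
      (aeval (R := ℂ) fun k : Fin 2 × Fin 2 => M k.1 k.2).toRingHom this
    rw [Matrix.det_fin_two]
    simpa using h

end NilpotentCone

/-! ### Local equations of the degeneracy locus. -/

section DegeneracyCharts

open Scheme

lemma ker_specMap_quotient_top {R : Type} [CommRing R] (J : Ideal R) :
    (Spec.map (CommRingCat.ofHom (Ideal.Quotient.mk J))).ker.ideal
        ⟨⊤, isAffineOpen_top (Spec (.of R))⟩ =
      J.map (Scheme.ΓSpecIso (.of R)).inv.hom := by
  have hbij := ConcreteCategory.bijective_of_isIso (Scheme.ΓSpecIso (.of R)).inv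
  rw [Hom.ker_apply]
  ext z
  obtain ⟨a, rfl⟩ := hbij.2 z
  rw [RingHom.mem_ker, Ideal.mem_map_iff_of_surjective _ hbij.2]
  have h := congr(($(Scheme.ΓSpecIso_inv_naturality
    (CommRingCat.ofHom (Ideal.Quotient.mk J)))).hom a)
  refine (Eq.congr_left h.symm).trans ?_
  have hinj := (ConcreteCategory.bijective_of_isIso (Scheme.ΓSpecIso (.of (R ⧸ J))).inv).1
  refine (map_eq_zero_iff (Scheme.ΓSpecIso (.of (R ⧸ J))).inv.hom hinj).trans ?_
  refine Ideal.Quotient.eq_zero_iff_mem.trans ⟨fun h => ⟨a, h, rfl⟩, ?_⟩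
  rintro ⟨b, hb, hab⟩
  rwa [← hbij.1 hab]

variable {X : Scheme.{0}} [X.Over specC]

lemma toMatrixSpace_appTop {V : X.Opens} (M : Matrix (Fin 2) (Fin 2) Γ(X, V)) :
    (toMatrixSpace V M).appTop = (Scheme.ΓSpecIso _).hom ≫ CommRingCat.ofHom
      (aeval (R := ℂ) fun p : Fin 2 × Fin 2 => M p.1 p.2).toRingHom ≫ V.topIso.inv := by
  rw [toMatrixSpace, Hom.comp_appTop, Opens.toSpecΓ_appTop, Scheme.ΓSpecIso_naturality_assoc]

lemma ideal_comap_toMatrixSpace {V : X.Opens} (hV : IsAffine V)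
    {M : Matrix (Fin 2) (Fin 2) Γ(X, V)} (hM : M.trace = 0) :
    ((Spec.map (CommRingCat.ofHom (Ideal.Quotient.mk nilpotentConeIdeal))).ker.comap
      (toMatrixSpace V M)).ideal ⟨⊤, isAffineOpen_top _⟩ =
      (Ideal.span {M.det}).map V.topIso.inv.hom := by
  rw [ideal_comap_top hV inferInstance, ker_specMap_quotient_top, toMatrixSpace_appTop,
    Ideal.map_map, ← CommRingCat.hom_comp, Iso.inv_hom_id_assoc, CommRingCat.hom_comp,
    ← Ideal.map_map, CommRingCat.hom_ofHom, map_nilpotentConeIdeal hM]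

lemma ideal_map_ι {X : Scheme.{0}} {V : X.Opens} (hV : IsAffineOpen V) (h : IsAffine V)
    [QuasiCompact V.ι]
    (I : V.toScheme.IdealSheafData) (J : Ideal Γ(X, V))
    (hI : I.ideal ⟨⊤, isAffineOpen_top _⟩ = J.map V.topIso.inv.hom) :
    (I.map V.ι).ideal ⟨V, hV⟩ = J := by
  have e : V.ι ⁻¹ᵁ V = ⊤ := by simp
  have haff : IsAffineOpen (V.ι ⁻¹ᵁ V) := by rw [e]; exact isAffineOpen_top _
  have h1 : I.ideal ⟨_, haff⟩ = (J.map V.topIso.inv.hom).map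
      (V.toScheme.presheaf.map (homOfLE (le_top : V.ι ⁻¹ᵁ V ≤ ⊤)).op).hom := by
    rw [← hI]
    exact (I.map_ideal (U := ⟨_, haff⟩) (V := ⟨⊤, isAffineOpen_top _⟩)
      (le_top : V.ι ⁻¹ᵁ V ≤ ⊤)).symm
  have h2 : V.topIso.inv ≫ V.toScheme.presheaf.map (homOfLE (le_top : V.ι ⁻¹ᵁ V ≤ ⊤)).op =
      V.ι.app V := (X.presheaf.map_comp _ _).symm
  have hbij : Function.Bijective (V.ι.app V).hom := by
    rw [← h2]
    exact (bijective_presheaf_map (X := V.toScheme) (le_top : V.ι ⁻¹ᵁ V ≤ ⊤) e.ge).comp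
      (ConcreteCategory.bijective_of_isIso V.topIso.inv)
  rw [IdealSheafData.ideal_map I V.ι ⟨V, hV⟩ haff, h1, Ideal.map_map, ← CommRingCat.hom_comp, h2]
  change Ideal.comap (V.ι.app V).hom _ = _
  rw [Ideal.comap_map_of_surjective _ hbij.2, sup_eq_left, ← RingHom.ker_eq_comap_bot,
    (RingHom.injective_iff_ker_eq_bot _).1 hbij.1]
  exact bot_le

/-- The ideal of the degeneracy locus over one of the given open subsets, if these are affine and
the equations agree on the overlaps. -/
lemma degeneracyIdeal_ideal {ι : Type} [Finite ι] {U : ι → X.Opens}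
    (hU : ∀ i, IsAffineOpen (U i)) (hUU : ∀ i j, IsAffineOpen (U i ⊓ U j))
    (hqc : ∀ i, QuasiCompact (U i).ι) {s : ∀ i, Matrix (Fin 2) (Fin 2) Γ(X, U i)}
    (htr : ∀ i, (s i).trace = 0)
    (hdet : ∀ i j, Ideal.span {restrict (inf_le_left : U i ⊓ U j ≤ U i) (s i).det} =
      Ideal.span {restrict (inf_le_right : U i ⊓ U j ≤ U j) (s j).det}) (i : ι) :
    (degeneracyIdeal U s).ideal ⟨_, hU i⟩ = Ideal.span {(s i).det} := by
  let I (i : ι) := (Spec.map (CommRingCat.ofHom (Ideal.Quotient.mk nilpotentConeIdeal))).ker.comap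
    (toMatrixSpace (U i) (s i))
  let f (i : ι) : (I i).subscheme ⟶ X := (I i).subschemeι ≫ (U i).ι
  have hf (i : ι) : (f i).ker.ideal ⟨_, hU i⟩ = Ideal.span {(s i).det} :=
    ideal_map_ι (hU i) (hU i) _ _ (ideal_comap_toMatrixSpace (hU i) (htr i))
  refine (ideal_iInf_ker f (fun i => ⟨_, hU i⟩) hUU (fun i => ?_) (fun i j => ?_) i).trans (hf i)
  · simp [f]
  · rw [← IdealSheafData.map_ideal _ (U := ⟨_, hUU i j⟩) (V := ⟨_, hU i⟩)
      (inf_le_left : U i ⊓ U j ≤ U i), ← IdealSheafData.map_ideal _ (U := ⟨_, hUU i j⟩)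
      (V := ⟨_, hU j⟩) (inf_le_right : U i ⊓ U j ≤ U j), hf, hf, Ideal.map_span, Ideal.map_span,
      Set.image_singleton, Set.image_singleton]
    exact hdet i j

end DegeneracyCharts

/-! ### Linear projections induced by homomorphisms of graded rings. -/

section Projection

open Scheme HomogeneousLocalization

lemma exists_glued_hom {X Y : Scheme.{0}} {ι : Type} (U : ι → X.Opens) (hU : ⨆ i, U i = ⊤)
    (f : ∀ i, (U i).toScheme ⟶ Y)
    (hf : ∀ i j, X.homOfLE (inf_le_left : U i ⊓ U j ≤ U i) ≫ f i =
      X.homOfLE (inf_le_right : U i ⊓ U j ≤ U j) ≫ f j) :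
    ∃ g : X ⟶ Y, ∀ i, (U i).ι ≫ g = f i := by
  let 𝒰 := X.openCoverOfIsOpenCover U hU
  refine ⟨𝒰.glueMorphisms f fun i j => ?_, fun i => 𝒰.ι_glueMorphisms f _ i⟩
  refine (cancel_epi (isPullback_opens_inf (U i) (U j)).isoPullback.hom).1 ?_
  have h1 := (isPullback_opens_inf (U i) (U j)).isoPullback_hom_fst
  have h2 := (isPullback_opens_inf (U i) (U j)).isoPullback_hom_snd
  exact ((Category.assoc _ _ _).symm.trans (congr($h1 ≫ f i))).trans
    ((hf i j).trans ((congr($h2 ≫ f j)).symm.trans (Category.assoc _ _ _)))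

lemma ι_eq_basicOpenToSpec_awayι {A τ : Type} [CommRing A] [SetLike τ A] [AddSubgroupClass τ A]
    (𝒜 : ℕ → τ) [GradedRing 𝒜] {f : A} {m : ℕ} (hf : f ∈ 𝒜 m) (hm : 0 < m) :
    (Proj.basicOpen 𝒜 f).ι = Proj.basicOpenToSpec 𝒜 f ≫ Proj.awayι 𝒜 f hf hm := by
  rw [Proj.awayι, ← Proj.basicOpenIsoSpec_hom _ _ hf hm, Iso.hom_inv_id_assoc]

variable {A B τ υ : Type} [CommRing A] [SetLike τ A] [AddSubgroupClass τ A] {𝒜 : ℕ → τ}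
  [GradedRing 𝒜] [CommRing B] [SetLike υ B] [AddSubgroupClass υ B] {ℬ : ℕ → υ} [GradedRing ℬ]
  (φ : 𝒜 →+*ᵍ ℬ) {D : Scheme.{0}} (p : D ⟶ Proj ℬ)

lemma toSpecΓ_SpecMap_injective {X : Scheme.{0}} {U : X.Opens} {R : CommRingCat.{0}}
    {α β : R ⟶ Γ(X, U)} (h : U.toSpecΓ ≫ Spec.map α = U.toSpecΓ ≫ Spec.map β) : α = β := by
  have := congr((Scheme.ΓSpecIso _).inv ≫ Hom.appTop $h ≫ U.topIso.hom)
  simpa only [Hom.comp_appTop, Opens.toSpecΓ_appTop, Scheme.ΓSpecIso_naturality_assoc,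
    Category.assoc, Iso.inv_hom_id_assoc, Iso.inv_hom_id, Category.comp_id] using this

/-- The morphism from an open subset of `D` lying over `D₊(φ f)` to `D₊(f)` induced by `φ`. -/
def toChart {f : A} {m : ℕ} (hf : f ∈ 𝒜 m) (hm : 0 < m) {W : D.Opens}
    (h : W ≤ p ⁻¹ᵁ Proj.basicOpen ℬ (φ f)) : W.toScheme ⟶ Proj 𝒜 :=
  p.resLE _ W h ≫ Proj.basicOpenToSpec ℬ (φ f) ≫ Spec.map (CommRingCat.ofHom (Away.map φ f)) ≫
    Proj.awayι 𝒜 f hf hm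

lemma homOfLE_toChart {f : A} {m : ℕ} (hf : f ∈ 𝒜 m) (hm : 0 < m) {W W' : D.Opens}
    (h : W ≤ p ⁻¹ᵁ Proj.basicOpen ℬ (φ f)) (hW : W' ≤ W) :
    D.homOfLE hW ≫ toChart φ p hf hm h = toChart φ p hf hm (hW.trans h) := by
  rw [toChart, toChart, Hom.map_resLE_assoc]

lemma awayMap_comp_map {f g x : A} {m n : ℕ} (hf : f ∈ 𝒜 m) (hg : g ∈ 𝒜 n) (hx : x = f * g)
    (hx' : φ x = φ f * φ g) :
    (Away.map φ x).comp (awayMap 𝒜 hg hx) =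
      (awayMap ℬ (φ.2 hg) hx').comp (Away.map φ f) := by
  ext a
  obtain ⟨k, a, ha, rfl⟩ := Away.mk_surjective 𝒜 hf a
  simp only [RingHom.comp_apply]
  rw [awayMap_mk, Away.map_mk, Away.map_mk]
  erw [awayMap_mk]
  simp only [map_mul, map_pow]
  rfl

/-- Both chart maps on an overlap are compared with the one for the product `f * g`; this is the
glueing condition for the projection. -/
lemma toChart_mul {f g x : A} {m n : ℕ} (hf : f ∈ 𝒜 m) (hm : 0 < m) (hg : g ∈ 𝒜 n)
    (hx : x = f * g) {k : ℕ} (hxk : x ∈ 𝒜 k) (hk : k = m + n) {W : D.Opens}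
    (h : W ≤ p ⁻¹ᵁ Proj.basicOpen ℬ (φ x)) (h' : W ≤ p ⁻¹ᵁ Proj.basicOpen ℬ (φ f)) :
    toChart φ p hf hm h' = toChart φ p hxk (by lia) h := by
  subst hk
  have hx' : φ x = φ f * φ g := by rw [hx, map_mul]
  rw [toChart, toChart, ← Proj.SpecMap_awayMap_awayι 𝒜 hf hm hg hx, ← Spec.map_comp_assoc,
    ← CommRingCat.ofHom_comp, awayMap_comp_map φ hf hg hx hx', CommRingCat.ofHom_comp,
    Spec.map_comp_assoc, Proj.basicOpenToSpec_SpecMap_awayMap_assoc ℬ (φ.2 hg) hx',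
    Hom.resLE_map_assoc]

lemma toChart_preimage {f g : A} {m n : ℕ} (hf : f ∈ 𝒜 m) (hm : 0 < m) {W : D.Opens}
    (h : W ≤ p ⁻¹ᵁ Proj.basicOpen ℬ (φ f)) (hg : g ∈ 𝒜 n) (hn : 0 < n) :
    toChart φ p hf hm h ⁻¹ᵁ Proj.basicOpen 𝒜 g = W.ι ⁻¹ᵁ p ⁻¹ᵁ Proj.basicOpen ℬ (φ g) := by
  have hf' : φ f ∈ ℬ m := φ.2 hf
  have hg' : φ g ∈ ℬ n := φ.2 hg
  have h1 : Spec.map (CommRingCat.ofHom (Away.map φ f)) ⁻¹ᵁ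
      Proj.awayι 𝒜 f hf hm ⁻¹ᵁ Proj.basicOpen 𝒜 g =
      Proj.awayι ℬ (φ f) hf' hm ⁻¹ᵁ Proj.basicOpen ℬ (φ g) := by
    refine (congrArg (Spec.map (CommRingCat.ofHom (Away.map φ f)) ⁻¹ᵁ ·)
      (Proj.awayι_preimage_basicOpen 𝒜 hf hm hg hn)).trans (Eq.trans ?_
      (Proj.awayι_preimage_basicOpen ℬ hf' hm hg' hn).symm)
    refine (PrimeSpectrum.comap_basicOpen _ _).trans ?_
    congr 1
    refine (Away.map_mk _ _ _ _ _ _).trans ?_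
    simp only [map_pow]
  rw [toChart, Hom.comp_preimage, Hom.comp_preimage, Hom.comp_preimage, h1,
    ← Hom.comp_preimage _ (Proj.awayι ℬ _ _ _), ← ι_eq_basicOpenToSpec_awayι, ← Hom.comp_preimage,
    Hom.resLE_comp_ι, Hom.comp_preimage]

variable {ι : Type} {f : ι → A} {m : ι → ℕ} (hf : ∀ i, f i ∈ 𝒜 (m i)) (hm : ∀ i, 0 < m i)

/-- `φ` induces only a rational map from `Proj ℬ` to `Proj 𝒜`. The hypothesis `hcov` says that the
image of `D` avoids its base locus. -/
lemma exists_projection (hcov : ⨆ i, p ⁻¹ᵁ Proj.basicOpen ℬ (φ (f i)) = ⊤) :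
    ∃ π : D ⟶ Proj 𝒜, ∀ i, (p ⁻¹ᵁ Proj.basicOpen ℬ (φ (f i))).ι ≫ π =
      toChart φ p (hf i) (hm i) le_rfl := by
  refine exists_glued_hom _ hcov _ fun i j => ?_
  rw [homOfLE_toChart, homOfLE_toChart]
  have h : p ⁻¹ᵁ Proj.basicOpen ℬ (φ (f i)) ⊓ p ⁻¹ᵁ Proj.basicOpen ℬ (φ (f j)) ≤
      p ⁻¹ᵁ Proj.basicOpen ℬ (φ (f i * f j)) := by
    rw [map_mul, Proj.basicOpen_mul]
    exact le_rfl
  rw [toChart_mul φ p (hf i) (hm i) (hf j) rfl (SetLike.mul_mem_graded (hf i) (hf j)) rfl h,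
    toChart_mul φ p (hf j) (hm j) (hf i) (mul_comm _ _) (SetLike.mul_mem_graded (hf i) (hf j))
      (add_comm _ _) h]

variable {p} {π : D ⟶ Proj 𝒜} (hπ : ∀ i, (p ⁻¹ᵁ Proj.basicOpen ℬ (φ (f i))).ι ≫ π =
      toChart φ p (hf i) (hm i) le_rfl)

include hπ in
lemma projection_preimage (hcov : ⨆ i, p ⁻¹ᵁ Proj.basicOpen ℬ (φ (f i)) = ⊤) (i : ι) :
    π ⁻¹ᵁ Proj.basicOpen 𝒜 (f i) = p ⁻¹ᵁ Proj.basicOpen ℬ (φ (f i)) := by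
  have h (j : ι) := congrArg (· ⁻¹ᵁ Proj.basicOpen 𝒜 (f i)) (hπ j)
  simp only [toChart_preimage φ p _ _ _ (hf i) (hm i), Hom.comp_preimage] at h
  ext x
  have hx : x ∈ ⨆ i, p ⁻¹ᵁ Proj.basicOpen ℬ (φ (f i)) := by rw [hcov]; trivial
  obtain ⟨j, hj⟩ := TopologicalSpace.Opens.mem_iSup.1 hx
  exact congr((⟨x, hj⟩ : (p ⁻¹ᵁ Proj.basicOpen ℬ (φ (f j)) : D.Opens)) ∈ $(h j)).to_iff

include hπ in
lemma projection_appLE (i : ι) (h : p ⁻¹ᵁ Proj.basicOpen ℬ (φ (f i)) ≤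
      π ⁻¹ᵁ Proj.basicOpen 𝒜 (f i)) :
    Proj.awayToSection 𝒜 (f i) ≫ π.appLE (Proj.basicOpen 𝒜 (f i)) _ h =
      CommRingCat.ofHom (Away.map φ (f i)) ≫ Proj.awayToSection ℬ (φ (f i)) ≫
        p.app (Proj.basicOpen ℬ (φ (f i))) := by
  refine toSpecΓ_SpecMap_injective ?_
  rw [← cancel_mono (Proj.awayι 𝒜 (f i) (hf i) (hm i))]
  have h1 := hπ i
  rw [toChart, Proj.basicOpenToSpec] at h1
  rw [Spec.map_comp, Spec.map_comp, Spec.map_comp, Opens.toSpecΓ_SpecMap_appLE_assoc,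
    ← Hom.appLE_eq_app]
  simp only [Category.assoc, Opens.toSpecΓ_SpecMap_appLE_assoc]
  have h2 := ι_eq_basicOpenToSpec_awayι 𝒜 (hf i) (hm i)
  rw [Proj.basicOpenToSpec, Category.assoc] at h2
  rw [← h2, Hom.resLE_comp_ι, h1, Category.assoc]

end Projection

/-! ### Projections are morphisms over `ℂ`. -/

section ProjectionOver

open Scheme HomogeneousLocalization

attribute [local instance] MvPolynomial.weightedGradedAlgebra

variable {σ τ : Type} {w : σ → ℕ} {v : τ → ℕ} (φ : grading w →+*ᵍ grading v) {D : Scheme.{0}}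
  {p : D ⟶ Proj (grading v)}

lemma C_mem_grading_zero_smul (c : ℂ) (m : ℕ) : C c ∈ grading w (0 • m) := by
  rw [zero_smul]
  exact isWeightedHomogeneous_C w c

lemma constHom_eq_mk {g : MvPolynomial σ ℂ} {m : ℕ} (hg : g ∈ grading w m) (c : ℂ) :
    constHom w g c = Away.mk (grading w) hg 0 (C c) (C_mem_grading_zero_smul c m) := by
  ext
  rw [val_constHom, Away.val_mk, ← Localization.mk_one_eq_algebraMap]
  congr 1

/-- A projection induced by a homomorphism of graded `ℂ`-algebras is a morphism over `ℂ`. -/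
lemma projection_over (hφ : ∀ c, φ (C c) = C c) {ι : Type} {f : ι → MvPolynomial σ ℂ} {m : ι → ℕ}
    (hf : ∀ i, f i ∈ grading w (m i)) (hm : ∀ i, 0 < m i) {π : D ⟶ Proj (grading w)}
    (hπ : ∀ i, (p ⁻¹ᵁ Proj.basicOpen (grading v) (φ (f i))).ι ≫ π =
      toChart φ p (hf i) (hm i) le_rfl)
    (hcov : ⨆ i, p ⁻¹ᵁ Proj.basicOpen (grading v) (φ (f i)) = ⊤) :
    π ≫ Proj.toSpecZero (grading w) ≫
        Spec.map (CommRingCat.ofHom (algebraMap ℂ (grading w 0))) =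
      p ≫ Proj.toSpecZero (grading v) ≫
        Spec.map (CommRingCat.ofHom (algebraMap ℂ (grading v 0))) := by
  refine (D.openCoverOfIsOpenCover _ hcov).hom_ext _ _ fun i => ?_
  change (p ⁻¹ᵁ Proj.basicOpen (grading v) (φ (f i))).ι ≫ _ =
    (p ⁻¹ᵁ Proj.basicOpen (grading v) (φ (f i))).ι ≫ _
  have hf' : φ (f i) ∈ grading v (m i) := φ.2 (hf i)
  have h1 : (CommRingCat.ofHom (constHom w (f i))) ≫ CommRingCat.ofHom (Away.map φ (f i)) =
      CommRingCat.ofHom (constHom v (φ (f i))) := by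
    ext c
    refine congrArg val ?_
    refine (congrArg (Away.map φ (f i)) (constHom_eq_mk (hf i) c)).trans ?_
    refine (Away.map_mk _ _ _ _ _ _).trans ?_
    refine Eq.trans ?_ (constHom_eq_mk hf' c).symm
    simp only [hφ]
  rw [← Hom.resLE_comp_ι_assoc _ le_rfl, ι_comp_over hf' (hm i), reassoc_of% hπ i, toChart,
    Category.assoc, Category.assoc, Category.assoc, Proj.awayι_toSpecZero_assoc, ← Spec.map_comp,
    ← CommRingCat.ofHom_comp, ← h1]
  rw [Spec.map_comp]
  rfl

end ProjectionOver

/-! ### Dehomogenization at a variable of weight one. -/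

section Dehomogenization

open HomogeneousLocalization

attribute [local instance] MvPolynomial.weightedGradedAlgebra

variable {σ : Type} {w : σ → ℕ}

lemma eval₂_mul_pow_weight {L : Type*} [CommRing L] (f : ℂ →+* L) (u : σ → L) (t : L)
    {p : MvPolynomial σ ℂ} {n : ℕ} (hp : IsWeightedHomogeneous w p n) :
    eval₂ f (fun j => u j * t ^ w j) p = eval₂ f u p * t ^ n := by
  rw [eval₂_eq, eval₂_eq, Finset.sum_mul]
  refine Finset.sum_congr rfl fun d hd => ?_
  have h := hp (mem_support_iff.1 hd)
  rw [mul_assoc]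
  congr 1
  simp only [mul_pow, Finset.prod_mul_distrib, ← pow_mul, Finset.prod_pow_eq_pow_sum]
  rw [← h, Finsupp.weight_apply, Finsupp.sum]
  congr 2
  refine Finset.sum_congr rfl fun j _ => ?_
  simp [mul_comm]

lemma X_mem_grading_one {i : σ} (hi : w i = 1) : X i ∈ grading w 1 := hi ▸ X_mem_grading i

/-- The fraction `x_j / x_i ^ w_j`, where `x_i` has weight one. -/
def affineCoord {i : σ} (hi : w i = 1) (j : σ) : Away (grading w) (X i) :=
  Away.mk (grading w) (X_mem_grading_one hi) (w j) (X j) (by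
    rw [smul_eq_mul, mul_one]
    exact X_mem_grading j)

/-- With `t = 1 / x_i`, the affine coordinates are `x_j t ^ w_j`, so by weighted homogeneity the
value of `p` at them is `p t ^ n`. -/
lemma mk_eq_eval₂ {i : σ} (hi : w i = 1) {n : ℕ} {p : MvPolynomial σ ℂ}
    (hp : p ∈ grading w (n • 1)) :
    Away.mk (grading w) (X_mem_grading_one hi) n p hp =
      eval₂ (constHom w (X i)) (affineCoord hi) p := by
  ext
  let L := Localization (Submonoid.powers (X i : MvPolynomial σ ℂ))
  let k : Away (grading w) (X i) →+* L := algebraMap _ _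
  let t : L := Localization.mk 1 ⟨X i, 1, pow_one _⟩
  change _ = k _
  rw [hom_eval₂]
  have h1 : k.comp (constHom w (X i)) = (algebraMap (MvPolynomial σ ℂ) L).comp C := by
    ext c
    exact val_constHom _ c
  have ht (n : ℕ) (a : MvPolynomial σ ℂ) (ha) : Localization.mk a ⟨X i ^ n, ha⟩ =
      algebraMap _ L a * t ^ n := by
    rw [Localization.mk_pow, ← Localization.mk_one_eq_algebraMap, Localization.mk_mul, one_pow,
      mul_one, one_mul]
    congr 1
  have h2 : (fun j => k (affineCoord hi j)) =
      fun j => algebraMap (MvPolynomial σ ℂ) L (X j) * t ^ w j := by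
    ext j
    refine (Away.val_mk _ _ (X_mem_grading_one hi) _ _).trans ?_
    exact ht ..
  rw [h1, h2, eval₂_mul_pow_weight _ _ _ (w := w) (n := n) (by simpa using hp), Away.val_mk, ht]
  congr 1
  refine Eq.trans ?_ (hom_eval₂ p C (algebraMap (MvPolynomial σ ℂ) L) X)
  rw [eval₂_eta]

lemma affineCoord_self {i : σ} (hi : w i = 1) : affineCoord hi i = 1 := by
  ext
  rw [affineCoord, Away.val_mk, val_one]
  refine Eq.trans ?_ Localization.mk_one
  rw [Localization.mk_eq_mk_iff, Localization.r_iff_exists]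
  exact ⟨1, by simp [hi]⟩

/-- The homomorphism from the ring of fractions with denominators powers of `x_i` given by
values of the variables such that the value of `x_i` is one. -/
lemma exists_eval₂_hom {i : σ} (hi : w i = 1) {L : Type*} [CommRing L] (f : ℂ →+* L) (u : σ → L)
    (hu : u i = 1) : ∃ δ : Away (grading w) (X i) →+* L, (∀ c, δ (constHom w (X i) c) = f c) ∧
      ∀ j, δ (affineCoord hi j) = u j := by
  have hunit : IsUnit (eval₂Hom f u (X i)) := by simp [hu]
  let δ₀ : Localization (Submonoid.powers (X i : MvPolynomial σ ℂ)) →+* L :=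
    IsLocalization.Away.lift (X i) hunit
  have h (a : MvPolynomial σ ℂ) : δ₀ (algebraMap _ _ a) = eval₂ f u a :=
    IsLocalization.Away.lift_eq _ _ _
  refine ⟨δ₀.comp (algebraMap _ _), fun c => ?_, fun j => ?_⟩
  · refine (congrArg δ₀ (val_constHom _ c)).trans ?_
    rw [h, eval₂_C]
  · have h1 : (affineCoord hi j).val * algebraMap (MvPolynomial σ ℂ) _ (X i ^ w j) =
        algebraMap (MvPolynomial σ ℂ) _ (X j) := by
      rw [affineCoord, Away.val_mk, ← Localization.mk_one_eq_algebraMap,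
        ← Localization.mk_one_eq_algebraMap, Localization.mk_mul, Localization.mk_eq_mk_iff,
        Localization.r_iff_exists]
      exact ⟨1, by simp [mul_comm]⟩
    have h2 := congrArg δ₀ h1
    rw [map_mul, h, h, eval₂_pow, eval₂_X, eval₂_X, hu, one_pow, mul_one] at h2
    exact h2

end Dehomogenization

/-! ### Induced maps of homogeneous localizations. -/

section AwayMap

open HomogeneousLocalization

variable {A B τ υ : Type} [CommRing A] [SetLike τ A] [AddSubgroupClass τ A] {𝒜 : ℕ → τ}
  [GradedRing 𝒜] [CommRing B] [SetLike υ B] [AddSubgroupClass υ B] {ℬ : ℕ → υ} [GradedRing ℬ]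

/-- The homomorphism `Away 𝒜 f →+* Away ℬ g` induced by a homomorphism of graded rings which sends
`f` to `g`. -/
def awayMapOfEq (φ : 𝒜 →+*ᵍ ℬ) {f : A} {g : B} (h : g = φ f) : Away 𝒜 f →+* Away ℬ g :=
  HomogeneousLocalization.map φ <| by
    rintro _ ⟨n, rfl⟩
    exact ⟨n, by simp [h]⟩

lemma awayMapOfEq_mk (φ : 𝒜 →+*ᵍ ℬ) {f : A} {g : B} (h : g = φ f) {d : ℕ} (hf : f ∈ 𝒜 d)
    (hg : g ∈ ℬ d) (n : ℕ) (a : A) (ha : a ∈ 𝒜 (n • d)) (ha' : φ a ∈ ℬ (n • d)) :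
    awayMapOfEq φ h (Away.mk 𝒜 hf n a ha) = Away.mk ℬ hg n (φ a) ha' := by
  subst h
  exact Away.map_mk ..

end AwayMap

/-! ### The charts of `ℙ(2,1,1,1,1,1)` as affine lines over those of `ℙ⁴`. -/

section WeightedCharts

open HomogeneousLocalization

attribute [local instance] MvPolynomial.weightedGradedAlgebra

lemma unitWeights_eq (i : Fin 5) : unitWeights i = 1 := rfl

lemma rename_mem_grading {p : MvPolynomial (Fin 5) ℂ} {n : ℕ} (hp : p ∈ grading unitWeights n) :
    rename Fin.succ p ∈ grading weights n := by
  intro d hd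
  obtain ⟨e, rfl, he⟩ := coeff_rename_ne_zero _ _ _ hd
  rw [← hp he, Finsupp.weight_apply, Finsupp.weight_apply,
    Finsupp.sum_mapDomain_index (by simp) (by intros; simp [add_mul])]
  refine Finsupp.sum_congr fun j _ => ?_
  rw [weights_succ]
  rfl

/-- The inclusion of the coordinate ring of `ℙ⁴` in that of `ℙ(2,1,1,1,1,1)`. -/
def gradedRename : grading unitWeights →+*ᵍ grading weights where
  toRingHom := (rename Fin.succ : MvPolynomial (Fin 5) ℂ →ₐ[ℂ] _).toRingHom
  map_mem := rename_mem_grading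

lemma gradedRename_apply (p : MvPolynomial (Fin 5) ℂ) : gradedRename p = rename Fin.succ p := rfl

lemma X_succ_eq (i : Fin 5) : X i.succ = gradedRename (X i) := by
  rw [gradedRename_apply, rename_X]

/-- The inclusion of the coordinate ring of the chart `x_i ≠ 0` of `ℙ⁴` in that of the
corresponding chart of `ℙ(2,1,1,1,1,1)`. -/
def chartInclusion (i : Fin 5) :
    Away (grading unitWeights) (X i) →+* Away (grading weights) (X i.succ) :=
  awayMapOfEq gradedRename (X_succ_eq i)

lemma chartInclusion_affineCoord (i j : Fin 5) :
    chartInclusion i (affineCoord (unitWeights_eq i) j) =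
      affineCoord (weights_succ i) j.succ := by
  refine (awayMapOfEq_mk gradedRename (X_succ_eq i) _
    (X_mem_grading_one (weights_succ i)) _ _ _ ?_).trans ?_
  · rw [← X_succ_eq]
    simpa [unitWeights_eq] using X_mem_grading_one (weights_succ j)
  · ext
    rw [affineCoord, Away.val_mk, Away.val_mk, ← X_succ_eq]
    simp only [weights_succ]
    rfl

lemma chartInclusion_constHom (i : Fin 5) (c : ℂ) :
    chartInclusion i (constHom unitWeights (X i) c) = constHom weights (X i.succ) c := by
  rw [constHom_eq_mk (X_mem_grading_one (unitWeights_eq i)),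
    constHom_eq_mk (X_mem_grading_one (weights_succ i))]
  refine (awayMapOfEq_mk gradedRename (X_succ_eq i) _
    (X_mem_grading_one (weights_succ i)) _ _ _ ?_).trans ?_
  · rw [gradedRename_apply, rename_C]
    exact C_mem_grading_zero_smul c 1
  · ext
    rw [Away.val_mk, Away.val_mk, gradedRename_apply, rename_C]

/-- The coordinate ring of the chart `x_i ≠ 0` of `ℙ(2,1,1,1,1,1)` as a polynomial ring over that
of the corresponding chart of `ℙ⁴`. -/
def chartPolynomial (i : Fin 5) :
    Polynomial (Away (grading unitWeights) (X i)) →+* Away (grading weights) (X i.succ) :=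
  Polynomial.eval₂RingHom (chartInclusion i) (affineCoord (weights_succ i) 0)

lemma chartPolynomial_C (i : Fin 5) (b) :
    chartPolynomial i (Polynomial.C b) = chartInclusion i b :=
  Polynomial.eval₂_C _ _

lemma chartPolynomial_X (i : Fin 5) :
    chartPolynomial i Polynomial.X = affineCoord (weights_succ i) 0 :=
  Polynomial.eval₂_X _ _

/-- Setting the variable `x_i` equal to one in a polynomial in five variables. -/
def dehom (i : Fin 5) : MvPolynomial (Fin 5) ℂ →+* Away (grading unitWeights) (X i) :=
  eval₂Hom (constHom unitWeights (X i)) (affineCoord (unitWeights_eq i))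

lemma mk_eq_dehom (i : Fin 5) {n : ℕ} {p : MvPolynomial (Fin 5) ℂ}
    (hp : p ∈ grading unitWeights (n • 1)) :
    Away.mk (grading unitWeights) (X_mem_grading_one (unitWeights_eq i)) n p hp = dehom i p :=
  mk_eq_eval₂ (unitWeights_eq i) hp

/-- Setting the variable `x_i` of weight one equal to one in a polynomial in six variables. -/
def dehomPolynomial (i : Fin 5) :
    MvPolynomial (Fin 6) ℂ →+* Polynomial (Away (grading unitWeights) (X i)) :=
  eval₂Hom (Polynomial.C.comp (constHom unitWeights (X i)))
    (Fin.cons Polynomial.X fun j => Polynomial.C (affineCoord (unitWeights_eq i) j))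

lemma dehomPolynomial_X_zero (i : Fin 5) : dehomPolynomial i (X 0) = Polynomial.X :=
  eval₂_X _ _ _

lemma dehomPolynomial_C (i : Fin 5) (c : ℂ) :
    dehomPolynomial i (C c) = Polynomial.C (constHom unitWeights (X i) c) :=
  eval₂_C _ _ _

lemma dehomPolynomial_rename (i : Fin 5) (p : MvPolynomial (Fin 5) ℂ) :
    dehomPolynomial i (rename Fin.succ p) = Polynomial.C (dehom i p) := by
  refine (eval₂_rename ..).trans ?_
  exact (hom_eval₂ p (constHom unitWeights (X i)) Polynomial.C _).symm

lemma chartPolynomial_dehomPolynomial (i : Fin 5) {n : ℕ} {p : MvPolynomial (Fin 6) ℂ}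
    (hp : p ∈ grading weights (n • 1)) :
    chartPolynomial i (dehomPolynomial i p) =
      Away.mk (grading weights) (X_mem_grading_one (weights_succ i)) n p hp := by
  rw [mk_eq_eval₂ (weights_succ i)]
  refine (hom_eval₂ ..).trans ?_
  congr 1
  · ext c
    simp only [RingHom.comp_apply, chartPolynomial_C, chartInclusion_constHom]
  · ext1 j
    refine Fin.cases ?_ (fun j => ?_) j
    · rw [Fin.cons_zero, chartPolynomial_X]
    · rw [Fin.cons_succ, chartPolynomial_C, chartInclusion_affineCoord]

/-- Setting `x_i = 1` gives a left inverse `δ`; surjectivity is the dehomogenization of numerators.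
-/
lemma chartPolynomial_bijective (i : Fin 5) : Function.Bijective (chartPolynomial i) := by
  constructor
  · obtain ⟨δ, hδ, hδ'⟩ := exists_eval₂_hom (weights_succ i)
      (Polynomial.C.comp (constHom unitWeights (X i)))
      (Fin.cons Polynomial.X fun j => Polynomial.C (affineCoord (unitWeights_eq i) j) :
        Fin 6 → Polynomial (Away (grading unitWeights) (X i)))
      (by rw [Fin.cons_succ, affineCoord_self, Polynomial.C_1])
    suffices δ.comp (chartPolynomial i) = RingHom.id _ from
      Function.LeftInverse.injective (g := δ) fun a => congr($this a)
    refine Polynomial.ringHom_ext (fun b => ?_) ?_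
    · obtain ⟨n, p, hp, rfl⟩ := Away.mk_surjective (grading unitWeights)
        (X_mem_grading_one (unitWeights_eq i)) b
      rw [mk_eq_eval₂ (unitWeights_eq i), RingHom.comp_apply, chartPolynomial_C, hom_eval₂,
        hom_eval₂,
        RingHom.id_apply, hom_eval₂]
      congr 1
      · ext c
        simp only [RingHom.comp_apply, chartInclusion_constHom, hδ]
      · ext1 j
        rw [chartInclusion_affineCoord, hδ', Fin.cons_succ]
    · rw [RingHom.comp_apply, chartPolynomial_X, hδ']
      rfl
  · intro a
    obtain ⟨n, p, hp, rfl⟩ := Away.mk_surjective (grading weights)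
      (X_mem_grading_one (weights_succ i)) a
    exact ⟨_, chartPolynomial_dehomPolynomial i hp⟩

end WeightedCharts

/-! ### The charts of the quartic, and the equations of the locus on them. -/

section QuarticCharts

open HomogeneousLocalization Scheme

attribute [local instance] MvPolynomial.weightedGradedAlgebra

lemma weights_pos (i : Fin 6) : 0 < weights i := by
  fin_cases i <;> simp [weights]

variable (F : MvPolynomial (Fin 6) ℂ)

/-- The part of the quartic where `x_i x_j ≠ 0`. -/
def quarticChart₂ (i j : Fin 5) : (hypersurface weights F).Opens :=
  hypersurfaceι weights F ⁻¹ᵁ Proj.basicOpen (grading weights) (X i.succ * X j.succ)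

instance {σ : Type} (w : σ → ℕ) (G : MvPolynomial σ ℂ) : IsClosedImmersion (hypersurfaceι w G) :=
  inferInstanceAs (IsClosedImmersion (hypersurfaceIdeal w G).subschemeι)

lemma isAffineOpen_quarticChart (i : Fin 5) : IsAffineOpen (quarticChart F i) :=
  IsAffineOpen.preimage (Y := weightedProj weights) (isAffineOpen_X (weights_pos i.succ)) _

lemma quarticChart_inf (i j : Fin 5) : quarticChart F i ⊓ quarticChart F j = quarticChart₂ F i j :=
  (congrArg (hypersurfaceι weights F ⁻¹ᵁ ·)
    (Proj.basicOpen_mul (grading weights) (X i.succ) (X j.succ))).symm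

lemma isAffineOpen_quarticChart_inf (i j : Fin 5) :
    IsAffineOpen (quarticChart F i ⊓ quarticChart F j) := by
  rw [quarticChart_inf]
  exact IsAffineOpen.preimage (Y := weightedProj weights)
    (isAffineOpen_X_mul (X_mem_grading j.succ) (weights_pos i.succ)) _

instance {σ : Type} (w : σ → ℕ) : (weightedProj w).IsSeparated :=
  inferInstanceAs (Proj (grading w)).IsSeparated

instance (i : Fin 5) : QuasiCompact (quarticChart F i).ι := by
  have : (hypersurface weights F).IsSeparated :=
    ⟨by
      rw [← Limits.terminal.comp_from (hypersurfaceι weights F)]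
      infer_instance⟩
  have : IsAffine (quarticChart F i) := isAffineOpen_quarticChart F i
  infer_instance

/-- If the coefficient of `y ^ 2` in the quartic does not vanish, the charts cover it. -/
lemma iSup_quarticChart {c : ℂ} (hc : c ≠ 0) (hF : F ∈ grading weights 4)
    (hF' : F - C c * X 0 ^ 2 ∈ Ideal.span (Set.range fun i : Fin 5 => X i.succ)) :
    ⨆ i, quarticChart F i = ⊤ := by
  rw [eq_top_iff]
  intro x _
  by_contra hx
  simp only [TopologicalSpace.Opens.mem_iSup, not_exists] at hx
  let z : Proj (grading weights) := hypersurfaceι weights F x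
  have hz (i : Fin 5) : X i.succ ∈ z.asHomogeneousIdeal := by
    by_contra h
    exact hx i h
  have hz0 : X 0 ∉ z.asHomogeneousIdeal := by
    intro h0
    have : z ∈ ⨆ i, Proj.basicOpen (grading weights) (X i) := by
      rw [iSup_basicOpen_X]; trivial
    obtain ⟨i, hi⟩ := TopologicalSpace.Opens.mem_iSup.1 this
    refine hi ?_
    refine Fin.cases h0 (fun j => hz j) i
  have := z.isPrime
  -- At a point where all variables of weight one vanish, `F` reduces to `c y²` with `y` non-zero.
  have hzF : F ∉ z.asHomogeneousIdeal := by
    intro h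
    have h1 : F - C c * X 0 ^ 2 ∈ z.asHomogeneousIdeal.toIdeal := by
      refine Ideal.span_le.2 ?_ hF'
      rintro _ ⟨i, rfl⟩
      exact hz i
    have h2 : C c * X 0 ^ 2 ∈ z.asHomogeneousIdeal.toIdeal := by
      have := Ideal.sub_mem _ h h1
      rwa [sub_sub_cancel] at this
    rw [Ideal.unit_mul_mem_iff_mem _ (hc.isUnit.map C)] at h2
    exact hz0 (this.mem_of_pow_mem _ h2)
  -- Where `F` is invertible the hypersurface is empty. The factor `X 0` gives a chart of the form
  -- `X i * g`, on which the ideal is known.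
  let U := hypersurfaceι weights F ⁻¹ᵁ Proj.basicOpen (grading weights) (X 0 * F)
  have hxU : x ∈ U := fun h => (this.mem_or_mem h).elim hz0 hzF
  have h1 : (1 : Away (grading weights) (X 0 * F)) ∈
      RingHom.ker (sectionHom weights F (X 0 * F)) := by
    rw [ker_sectionHom_X_mul weights_pos F 0 hF, mem_awayIdeal, val_one,
      ← Localization.mk_one, algebraMap_dvd_iff]
    exact ⟨1, X 0, by ring⟩
  rw [RingHom.mem_ker, map_one] at h1
  have h3 : (hypersurface weights F).basicOpen (1 : Γ(hypersurface weights F, U)) = U :=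
    basicOpen_of_isUnit _ isUnit_one
  have h4 : U = ⊥ := by
    rw [← h3]
    exact (congrArg (hypersurface weights F).basicOpen h1).trans (by simp)
  rw [h4] at hxU
  exact hxU

variable {F} {Δ : MvPolynomial (Fin 6) ℂ} (hΔ : Δ ∈ grading weights (2 • 1))
  {s : ∀ i, Matrix (Fin 2) (Fin 2) Γ(hypersurface weights F, quarticChart F i)}
  (htr : ∀ i, (s i).trace = 0)
  (hdet : ∀ i, (s i).det = sectionHom weights F (X i.succ)
    (Away.mk (grading weights) (X_mem_grading_one (weights_succ i)) 2 Δ hΔ))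

lemma awayIdeal_mul_eq_span (i j : Fin 5) :
    awayIdeal weights Δ (X i.succ * X j.succ) =
      Ideal.span {awayMap (grading weights) (X_mem_grading j.succ) rfl
        (Away.mk (grading weights) (X_mem_grading_one (weights_succ i)) 2 Δ hΔ)} := by
  rw [awayIdeal_mul (X_mem_grading i.succ) (weights_pos _).ne' (X_mem_grading j.succ) rfl,
    awayIdeal_X (d := 2) (by simpa using hΔ) (X_mem_grading_one (weights_succ i)) hΔ,
    Ideal.map_span, Set.image_singleton]

lemma awayIdeal_mul_eq_span' (i j : Fin 5) :
    awayIdeal weights Δ (X i.succ * X j.succ) =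
      Ideal.span {awayMap (grading weights) (X_mem_grading i.succ) (mul_comm _ _)
        (Away.mk (grading weights) (X_mem_grading_one (weights_succ j)) 2 Δ hΔ)} := by
  rw [awayIdeal_mul (X_mem_grading j.succ) (weights_pos _).ne' (X_mem_grading i.succ)
      (mul_comm _ _),
    awayIdeal_X (d := 2) (by simpa using hΔ) (X_mem_grading_one (weights_succ j)) hΔ,
    Ideal.map_span, Set.image_singleton]

-- On the overlap `Δ / x_i²` and `Δ / x_j²` differ by a unit; here this is seen from both generating
-- the ideal of `Δ` on the chart `x_i x_j ≠ 0`.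
include hdet in
lemma span_restrict_det (i j : Fin 5) :
    Ideal.span {restrict (inf_le_left : quarticChart F i ⊓ quarticChart F j ≤ _) (s i).det} =
      Ideal.span {restrict (inf_le_right : quarticChart F i ⊓ quarticChart F j ≤ _)
        (s j).det} := by
  have hl : quarticChart₂ F i j ≤ quarticChart F i := by
    rw [← quarticChart_inf]; exact inf_le_left
  have hr : quarticChart₂ F i j ≤ quarticChart F j := by
    rw [← quarticChart_inf]; exact inf_le_right
  have h1 := restrict_sectionHom F (X_mem_grading (w := weights) j.succ) rfl
    (Away.mk (grading weights) (X_mem_grading_one (weights_succ i)) 2 Δ hΔ) hl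
  have h2 := restrict_sectionHom F (X_mem_grading (w := weights) i.succ) (mul_comm _ _)
    (Away.mk (grading weights) (X_mem_grading_one (weights_succ j)) 2 Δ hΔ) hr
  have h3 := congrArg (Ideal.map (sectionHom weights F (X i.succ * X j.succ)))
    ((awayIdeal_mul_eq_span hΔ i j).symm.trans (awayIdeal_mul_eq_span' hΔ i j))
  rw [Ideal.map_span, Ideal.map_span, Set.image_singleton, Set.image_singleton] at h3
  have h4 : Ideal.span {restrict hl (s i).det} = Ideal.span {restrict hr (s j).det} := by
    rw [hdet, hdet]
    exact (congrArg (fun a => Ideal.span {a}) h1).trans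
      (h3.trans (congrArg (fun a => Ideal.span {a}) h2.symm))
  have h5 := congrArg (Ideal.map (restrict (quarticChart_inf F i j).le)) h4
  rw [Ideal.map_span, Ideal.map_span, Set.image_singleton, Set.image_singleton] at h5
  have h6 {U V W : (hypersurface weights F).Opens} (h : V ≤ U) (h' : W ≤ V) (a) :
      restrict h' (restrict h a) = restrict (h'.trans h) a :=
    congr(($((hypersurface weights F).presheaf.map_comp (homOfLE h).op (homOfLE h').op)).hom a).symm
  rwa [h6, h6] at h5

include htr hdet in
lemma degeneracyIdeal_quarticChart (i : Fin 5) :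
    (degeneracyIdeal (quarticChart F) s).ideal ⟨_, isAffineOpen_quarticChart F i⟩ =
      Ideal.span {(s i).det} :=
  degeneracyIdeal_ideal (isAffineOpen_quarticChart F) (isAffineOpen_quarticChart_inf F)
    inferInstance htr (span_restrict_det hΔ hdet) i

/-- The morphism from the degeneracy locus to the weighted projective space. -/
def degeneracyMap (s : ∀ i, Matrix (Fin 2) (Fin 2) Γ(hypersurface weights F, quarticChart F i)) :
    degeneracyLocus (quarticChart F) s ⟶ Proj (grading weights) :=
  (degeneracyIdeal (quarticChart F) s).subschemeι ≫ hypersurfaceι weights F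

lemma pullHom_degeneracyMap (i : Fin 5) : pullHom (degeneracyMap s) (X i.succ) =
    ((degeneracyIdeal (quarticChart F) s).subschemeι.app (quarticChart F i)).hom.comp
      (sectionHom weights F (X i.succ)) := by
  ext a
  exact congr(($(Hom.comp_app (degeneracyIdeal (quarticChart F) s).subschemeι
    (hypersurfaceι weights F) (Proj.basicOpen (grading weights) (X i.succ)))).hom
      ((Proj.awayToSection (grading weights) (X i.succ)).hom a))

lemma pullHom_degeneracyMap_surjective (i : Fin 5) :
    Function.Surjective (pullHom (degeneracyMap s) (X i.succ)) := by
  rw [pullHom_degeneracyMap]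
  exact ((degeneracyIdeal (quarticChart F) s).subschemeι_app_surjective
    ⟨_, isAffineOpen_quarticChart F i⟩).comp
    (sectionHom_surjective F (X_mem_grading i.succ) (weights_pos _))

include htr hdet in
lemma ker_pullHom_degeneracyMap (hF : F ∈ grading weights (4 • 1)) (i : Fin 5) :
    RingHom.ker (pullHom (degeneracyMap s) (X i.succ)) =
      Ideal.span {Away.mk (grading weights) (X_mem_grading_one (weights_succ i)) 4 F hF,
        Away.mk (grading weights) (X_mem_grading_one (weights_succ i)) 2 Δ hΔ} := by
  rw [pullHom_degeneracyMap]
  refine (RingHom.comap_ker _ _).symm.trans ?_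
  refine (congrArg (Ideal.comap (sectionHom weights F (X i.succ)))
    ((degeneracyIdeal (quarticChart F) s).ker_subschemeι_app
      ⟨_, isAffineOpen_quarticChart F i⟩)).trans ?_
  rw [degeneracyIdeal_quarticChart hΔ htr hdet, hdet]
  refine Eq.trans (congrArg (Ideal.comap (sectionHom weights F (X i.succ))) (?_ :
    _ = Ideal.map (sectionHom weights F (X i.succ)) (Ideal.span
      {Away.mk (grading weights) (X_mem_grading_one (weights_succ i)) 2 Δ hΔ}))) ?_
  · rw [Ideal.map_span, Set.image_singleton]
    rfl
  rw [Ideal.comap_map_of_surjective _ (sectionHom_surjective F (X_mem_grading i.succ)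
    (weights_pos _)), ← RingHom.ker_eq_comap_bot, ker_sectionHom_X weights_pos,
    awayIdeal_X (d := 4) (by simpa using hF) (X_mem_grading_one (weights_succ i)) hF, sup_comm,
    ← Ideal.span_union, Set.singleton_union]

end QuarticCharts

/-! ### Projection of the degeneracy locus to `ℙ⁴`. -/

section ProjectionOfLocus

open HomogeneousLocalization Scheme

attribute [local instance] MvPolynomial.weightedGradedAlgebra

/-- The elements `f' i` are kept apart from `φ (f i)` because charts and localizations depend on
them as types: `X i.succ` and the renamed `X i` are equal but not interchangeable there. -/
lemma exists_projection_of_eq {σ τ ι : Type} {w : σ → ℕ} {v : τ → ℕ} (φ : grading w →+*ᵍ grading v)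
    (hφ : ∀ c, φ (C c) = C c) {f : ι → MvPolynomial σ ℂ} {f' : ι → MvPolynomial τ ℂ}
    (hE : ∀ i, f' i = φ (f i)) {m : ι → ℕ} (hf : ∀ i, f i ∈ grading w (m i)) (hm : ∀ i, 0 < m i)
    {D : Scheme.{0}} (p : D ⟶ Proj (grading v))
    (hcov : ⨆ i, p ⁻¹ᵁ Proj.basicOpen (grading v) (f' i) = ⊤) :
    ∃ π : D ⟶ Proj (grading w),
      π ≫ Proj.toSpecZero (grading w) ≫
        Spec.map (CommRingCat.ofHom (algebraMap ℂ (grading w 0))) =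
      p ≫ Proj.toSpecZero (grading v) ≫
        Spec.map (CommRingCat.ofHom (algebraMap ℂ (grading v 0))) ∧
      ∀ i, ∃ h : π ⁻¹ᵁ Proj.basicOpen (grading w) (f i) = p ⁻¹ᵁ Proj.basicOpen (grading v) (f' i),
        ∀ b, (D.presheaf.map (homOfLE h.ge).op).hom (pullHom π (f i) b) =
          pullHom p (f' i) (awayMapOfEq φ (hE i) b) := by
  obtain rfl : f' = fun i => φ (f i) := funext hE
  obtain ⟨π, hπ⟩ := exists_projection φ p hf hm hcov
  refine ⟨π, projection_over φ hφ hf hm hπ hcov, fun i =>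
    ⟨projection_preimage φ hf hm hπ hcov i, fun b => ?_⟩⟩
  exact congr(($(projection_appLE φ hf hm hπ i
    (projection_preimage φ hf hm hπ hcov i).ge)).hom b)

variable {F Δ : MvPolynomial (Fin 6) ℂ}
  {s : ∀ i, Matrix (Fin 2) (Fin 2) Γ(hypersurface weights F, quarticChart F i)}

/-- The projection of the degeneracy locus from the point `(1:0:0:0:0:0)` to `ℙ⁴`, and the
coordinate rings of the preimages of the standard charts. -/
theorem exists_degeneracy_projection {c : ℂ} (hc : c ≠ 0) (hF : F ∈ grading weights (4 • 1))
    (hF' : F - C c * X 0 ^ 2 ∈ Ideal.span (Set.range fun i : Fin 5 => X i.succ))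
    (hΔ : Δ ∈ grading weights (2 • 1)) (htr : ∀ i, (s i).trace = 0)
    (hdet : ∀ i, (s i).det = sectionHom weights F (X i.succ)
      (Away.mk (grading weights) (X_mem_grading_one (weights_succ i)) 2 Δ hΔ)) :
    ∃ π : degeneracyLocus (quarticChart F) s ⟶ Proj (grading unitWeights),
      π ≫ Proj.toSpecZero (grading unitWeights) ≫
        Spec.map (CommRingCat.ofHom (algebraMap ℂ (grading unitWeights 0))) =
          degeneracyLocus (quarticChart F) s ↘ specC ∧
      ∀ i, IsAffineOpen (π ⁻¹ᵁ Proj.basicOpen (grading unitWeights) (X i)) ∧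
        ∃ Ψ : Polynomial (Away (grading unitWeights) (X i)) →+*
            Γ(degeneracyLocus (quarticChart F) s, π ⁻¹ᵁ Proj.basicOpen (grading unitWeights) (X i)),
          Function.Surjective Ψ ∧
          RingHom.ker Ψ = Ideal.span {dehomPolynomial i F, dehomPolynomial i Δ} ∧
          ∀ b, Ψ (Polynomial.C b) = pullHom π (X i) b := by
  have hcov : ⨆ i : Fin 5, degeneracyMap s ⁻¹ᵁ Proj.basicOpen (grading weights) (X i.succ) = ⊤ := by
    have h := congrArg ((degeneracyIdeal (quarticChart F) s).subschemeι ⁻¹ᵁ ·)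
      (iSup_quarticChart F hc (by simpa using hF) hF')
    exact (Hom.preimage_iSup (degeneracyIdeal (quarticChart F) s).subschemeι
      (quarticChart F)).symm.trans h
  obtain ⟨π, hπ, h⟩ := exists_projection_of_eq gradedRename
    (fun c => by rw [gradedRename_apply, rename_C]) X_succ_eq X_mem_grading
    (fun i => Nat.one_pos) (degeneracyMap s) hcov
  refine ⟨π, hπ, fun i => ?_⟩
  obtain ⟨h, h'⟩ := h i
  constructor
  · have := IsAffineOpen.preimage (isAffineOpen_quarticChart F i)
      (degeneracyIdeal (quarticChart F) s).subschemeι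
    exact h ▸ this
  · refine ⟨(((degeneracyLocus (quarticChart F) s).presheaf.map (homOfLE h.le).op).hom.comp
      (pullHom (degeneracyMap s) (X i.succ))).comp (chartPolynomial i), ?_, ?_, fun b => ?_⟩
    · exact ((bijective_presheaf_map h.le h.ge).2.comp
        (pullHom_degeneracyMap_surjective i)).comp (chartPolynomial_bijective i).2
    · have h1 : RingHom.ker (((degeneracyLocus (quarticChart F) s).presheaf.map
          (homOfLE h.le).op).hom.comp (pullHom (degeneracyMap s) (X i.succ))) =
          RingHom.ker (pullHom (degeneracyMap s) (X i.succ)) := by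
        ext a
        exact map_eq_zero_iff _ (bijective_presheaf_map h.le h.ge).1
      rw [← RingHom.comap_ker, h1, ker_pullHom_degeneracyMap hΔ htr hdet hF,
        ← chartPolynomial_dehomPolynomial, ← chartPolynomial_dehomPolynomial, ← Set.image_pair,
        ← Ideal.map_span, Ideal.comap_map_of_bijective _ (chartPolynomial_bijective i)]
    · simp only [RingHom.comp_apply, chartPolynomial_C]
      refine (congrArg ((degeneracyLocus (quarticChart F) s).presheaf.map (homOfLE h.le).op).hom
        (h' b)).symm.trans ?_
      refine (congr(($((degeneracyLocus (quarticChart F) s).presheaf.map_comp (homOfLE h.ge).op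
        (homOfLE h.le).op)).hom (pullHom π (X i) b))).symm.trans ?_
      exact congr(($((degeneracyLocus (quarticChart F) s).presheaf.map_id _)).hom
        (pullHom π (X i) b))

end ProjectionOfLocus

/-! ### Morphisms and isomorphisms to a hypersurface, tested on charts. -/

section MorphismsToHypersurfaces

open HomogeneousLocalization Scheme

attribute [local instance] MvPolynomial.weightedGradedAlgebra

lemma isClosedImmersion_of_app_surjective {X Y : Scheme.{0}} {ι : Type} (f : X ⟶ Y)
    (U : ι → Y.affineOpens) (hU : ⨆ i, (U i).1 = ⊤) (haff : ∀ i, IsAffineOpen (f ⁻¹ᵁ (U i).1))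
    (hf : ∀ i, Function.Surjective (f.app (U i).1).hom) : IsClosedImmersion f := by
  rw [IsZariskiLocalAtTarget.iff_of_iSup_eq_top (P := @IsClosedImmersion) _ hU]
  intro i
  have : IsAffine (f ⁻¹ᵁ (U i).1) := haff i
  have : IsAffine (U i).1 := (U i).2
  refine IsClosedImmersion.of_surjective_of_isAffine _ ?_
  rw [morphismRestrict_appTop]
  have h (V : Y.Opens) (hV : V = (U i).1) : Function.Surjective (f.app V).hom := by
    subst hV
    exact hf i
  exact (ConcreteCategory.bijective_of_isIso (X.presheaf.map
    (eqToHom (image_morphismRestrict_preimage f (U i).1 ⊤)).op)).2.comp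
    (h _ (Opens.ι_image_top _))

variable {σ : Type} {w : σ → ℕ} (hw : ∀ i, 0 < w i) (G : MvPolynomial σ ℂ)
  {D : Scheme.{0}} {π : D ⟶ Proj (grading w)}
  (haff : ∀ i, IsAffineOpen (π ⁻¹ᵁ Proj.basicOpen (grading w) (X i)))

include hw haff in
lemma isAffineHom_of_charts : IsAffineHom π := by
  refine isAffineHom_of_forall_exists_isAffineOpen _ fun x => ?_
  have hx : x ∈ ⨆ i, Proj.basicOpen (grading w) (X i) := by rw [iSup_basicOpen_X]; trivial
  obtain ⟨i, hi⟩ := TopologicalSpace.Opens.mem_iSup.1 hx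
  exact ⟨_, hi, isAffineOpen_X (hw i), haff i⟩

lemma ker_ideal_X [QuasiCompact π] (i : σ) : π.ker.ideal ⟨_, isAffineOpen_X (hw i)⟩ =
    (RingHom.ker (pullHom π (X i))).map (Proj.awayToSection (grading w) (X i)).hom := by
  rw [Hom.ker_apply]
  have h : RingHom.ker (pullHom π (X i)) =
      (RingHom.ker (π.app (Proj.basicOpen (grading w) (X i))).hom).comap
        (Proj.awayToSection (grading w) (X i)).hom :=
    (RingHom.comap_ker _ _).symm
  rw [h, Ideal.map_comap_of_surjective _ (awayToSection_bijective _ (X_mem_grading i) (hw i)).2]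

variable [Finite σ]

include hw haff in
lemma exists_lift_hypersurface (hG : ∀ i, awayIdeal w G (X i) ≤ RingHom.ker (pullHom π (X i))) :
    ∃ π' : D ⟶ hypersurface w G, π' ≫ hypersurfaceι w G = π := by
  have := isAffineHom_of_charts hw haff
  have h : (hypersurfaceι w G).ker ≤ π.ker := by
    refine ((hypersurfaceIdeal w G).ker_subschemeι).trans_le ?_
    refine IdealSheafData.le_of_iSup_eq_top (X := Proj (grading w))
      (fun i : σ => ⟨_, isAffineOpen_X (hw i)⟩) iSup_basicOpen_X fun i => ?_
    refine (hypersurfaceIdeal_X hw G i).trans_le ((Ideal.map_mono (hG i)).trans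
      (ker_ideal_X hw i).ge)
  exact ⟨IsClosedImmersion.lift (hypersurfaceι w G) π h, IsClosedImmersion.lift_fac _ _ _⟩

-- Surjectivity on the charts makes `π` a closed immersion, and a closed immersion is determined by
-- its kernel.
include hw haff in
lemma exists_iso_hypersurface (hG : ∀ i, RingHom.ker (pullHom π (X i)) = awayIdeal w G (X i))
    (hsurj : ∀ i, Function.Surjective (pullHom π (X i))) :
    ∃ e : D ≅ hypersurface w G, e.hom ≫ hypersurfaceι w G = π := by
  have h1 : IsClosedImmersion π := by
    refine isClosedImmersion_of_app_surjective π (fun i : σ => ⟨_, isAffineOpen_X (hw i)⟩)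
      iSup_basicOpen_X haff fun i => ?_
    exact Function.Surjective.of_comp (g := (Proj.awayToSection (grading w) (X i)).hom) (hsurj i)
  have h2 : π.ker = (hypersurfaceι w G).ker := by
    refine Eq.trans ?_ ((hypersurfaceIdeal w G).ker_subschemeι).symm
    refine IdealSheafData.ext_of_iSup_eq_top (X := Proj (grading w))
      (fun i : σ => ⟨_, isAffineOpen_X (hw i)⟩) iSup_basicOpen_X fun i => ?_
    exact (ker_ideal_X hw i).trans ((congrArg _ (hG i)).trans (hypersurfaceIdeal_X hw G i).symm)
  obtain ⟨π', hπ'⟩ := exists_lift_hypersurface hw G haff fun i => (hG i).ge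
  have h1' : IsClosedImmersion (Y := weightedProj w) π := h1
  have := IsClosedImmersion.isIso_of_ker_eq (X := weightedProj w) π (hypersurfaceι w G) π' hπ' h2
  exact ⟨asIso π', hπ'⟩

end MorphismsToHypersurfaces

/-! ### Algebra of `B[X]` modulo a quadratic polynomial and a second equation. -/

section PolynomialQuotients

open Polynomial

variable {B Γ : Type} [CommRing B] [CommRing Γ] {Ψ : B[X] →+* Γ} (hΨ : Function.Surjective Ψ)

-- Modulo `X - a` every polynomial equals its value at `a`, so the variable is eliminated and only
-- `f(a)` remains as a relation.
include hΨ in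
lemma surjective_comp_C {f : B[X]} {μ a : B} (hμ : IsUnit μ)
    (hker : RingHom.ker Ψ = Ideal.span {f, Polynomial.C μ * (Polynomial.X - Polynomial.C a)}) :
    Function.Surjective (Ψ.comp Polynomial.C) ∧
      RingHom.ker (Ψ.comp Polynomial.C) = Ideal.span {f.eval a} := by
  have hX : Ψ (Polynomial.X - Polynomial.C a) = 0 := by
    rw [← RingHom.mem_ker, ← Ideal.unit_mul_mem_iff_mem _ (hμ.map Polynomial.C), hker]
    exact Ideal.subset_span (by simp)
  have h (p : B[X]) : Ψ p = Ψ (Polynomial.C (p.eval a)) := by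
    obtain ⟨u, hu⟩ := Polynomial.X_sub_C_dvd_sub_C_eval (a := a) (p := p)
    rw [← sub_eq_zero, ← map_sub, hu, map_mul, hX, zero_mul]
  refine ⟨fun z => ?_, ?_⟩
  · obtain ⟨p, rfl⟩ := hΨ z
    exact ⟨p.eval a, (h p).symm⟩
  · apply le_antisymm
    · intro b hb
      have : Polynomial.C b ∈ RingHom.ker Ψ := hb
      rw [hker, Ideal.mem_span_pair] at this
      obtain ⟨u, v, huv⟩ := this
      have := congrArg (Polynomial.eval a) huv
      simp only [Polynomial.eval_add, Polynomial.eval_mul, Polynomial.eval_C, Polynomial.eval_sub,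
        Polynomial.eval_X, sub_self, mul_zero, add_zero] at this
      exact Ideal.mem_span_singleton'.2 ⟨_, this⟩
    · rw [Ideal.span_singleton_le_iff_mem, RingHom.mem_ker, RingHom.comp_apply, ← h,
        ← RingHom.mem_ker, hker]
      exact Ideal.subset_span (by simp)

variable {c q r ν : B} (hc : IsUnit c) (h2 : IsUnit (2 : B))
  (hker : RingHom.ker Ψ = Ideal.span {Polynomial.C c * Polynomial.X ^ 2 +
    Polynomial.C q * Polynomial.X + Polynomial.C r, Polynomial.C ν})

-- As `c` is a unit, the quadratic relation reduces everything to degree at most one in `X`; as `2c`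
-- is a unit, `2cX + q` may replace `X` in the basis.
include hΨ hc h2 hker in
lemma exists_eq_add_mul (z : Γ) : ∃ b₀ b₁ : B, z = Ψ (Polynomial.C b₀) + Ψ (Polynomial.C b₁) *
    Ψ (Polynomial.C (2 * c) * Polynomial.X + Polynomial.C q) := by
  obtain ⟨d, hd⟩ := hc.exists_right_inv
  obtain ⟨e, he⟩ := h2.exists_right_inv
  obtain ⟨p, rfl⟩ := hΨ z
  have hX2 : Ψ Polynomial.X ^ 2 =
      - (Ψ (Polynomial.C (d * q)) * Ψ Polynomial.X + Ψ (Polynomial.C (d * r))) := by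
    have h : Polynomial.C c * Polynomial.X ^ 2 +
      Polynomial.C q * Polynomial.X + Polynomial.C r ∈ RingHom.ker Ψ := by
      rw [hker]; exact Ideal.subset_span (by simp)
    have h' := congrArg (Ψ (Polynomial.C d) * ·) (RingHom.mem_ker.1 h)
    simp only [map_add, map_mul, map_pow, mul_zero] at h' ⊢
    have hd' : Ψ (Polynomial.C c) * Ψ (Polynomial.C d) = 1 := by
      rw [← map_mul, ← map_mul, hd, map_one, map_one]
    linear_combination h' - Ψ Polynomial.X ^ 2 * hd'
  have key : ∀ p : B[X], ∃ a b : B, Ψ p = Ψ (Polynomial.C a) +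
      Ψ (Polynomial.C b) * Ψ Polynomial.X := by
    intro p
    induction p using Polynomial.induction_on' with
    | add p q hp hq =>
      obtain ⟨a, b, h⟩ := hp
      obtain ⟨a', b', h'⟩ := hq
      exact ⟨a + a', b + b', by simp only [map_add, h, h']; ring⟩
    | monomial n a =>
      induction n with
      | zero => exact ⟨a, 0, by simp⟩
      | succ n ih =>
        obtain ⟨a', b', h⟩ := ih
        refine ⟨- (b' * (d * r)), a' - b' * (d * q), ?_⟩
        rw [← Polynomial.monomial_mul_X, map_mul, h]
        simp only [map_mul, map_neg, map_sub] at hX2 ⊢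
        linear_combination Ψ (Polynomial.C b') * hX2
  obtain ⟨a, b, h⟩ := key p
  have h1 : b * e * d * (2 * c) = b := by linear_combination b * 2 * e * hd + b * he
  refine ⟨a - b * e * d * q, b * e * d, ?_⟩
  rw [h]
  nth_rw 1 [← h1]
  simp only [map_add, map_mul, map_sub]
  ring

-- Modulo `ν` the relation is a multiple of a quadratic polynomial with unit leading coefficient,
-- while its own degree is at most one, so it vanishes.
include hc h2 hker in
lemma mem_span_of_add_mul_eq_zero {b₀ b₁ : B} (h : Ψ (Polynomial.C b₀) + Ψ (Polynomial.C b₁) *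
      Ψ (Polynomial.C (2 * c) * Polynomial.X + Polynomial.C q) = 0) :
    b₀ ∈ Ideal.span {ν} ∧ b₁ ∈ Ideal.span {ν} := by
  -- If `ν` is a unit there is nothing to prove; otherwise the quotient is non-trivial, as the
  -- degree arguments require.
  rcases subsingleton_or_nontrivial (B ⧸ Ideal.span {ν}) with hs | hs
  · rw [Ideal.Quotient.subsingleton_iff.1 hs]
    exact ⟨trivial, trivial⟩
  rw [← map_mul, ← map_add, ← RingHom.mem_ker, hker, Ideal.mem_span_pair] at h
  obtain ⟨u, v, huv⟩ := h
  let κ := Ideal.Quotient.mk (Ideal.span {ν})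
  have hν : κ ν = 0 := Ideal.Quotient.eq_zero_iff_mem.2 (Ideal.subset_span rfl)
  obtain ⟨d, hd⟩ := (hc.map κ).exists_right_inv
  have h1 := congrArg (Polynomial.map κ) huv
  simp only [Polynomial.map_add, Polynomial.map_mul, Polynomial.map_C, Polynomial.map_pow,
    Polynomial.map_X, hν, map_zero, mul_zero, add_zero] at h1
  let m : (B ⧸ Ideal.span {ν})[X] := Polynomial.X ^ 2 + (Polynomial.C (d * κ q) * Polynomial.X +
    Polynomial.C (d * κ r))
  have hm : m.Monic := Polynomial.monic_X_pow_add (Polynomial.degree_linear_le.trans_lt (by decide))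
  have hmdeg : m.degree = 2 := by
    rw [Polynomial.degree_add_eq_left_of_degree_lt, Polynomial.degree_X_pow]
    · rfl
    · rw [Polynomial.degree_X_pow]
      exact Polynomial.degree_linear_le.trans_lt (by decide)
  have hC : Polynomial.C (κ c) * Polynomial.C d = 1 := by rw [← map_mul, hd, map_one]
  have hdvd : m ∣ Polynomial.C (κ b₁ * κ (2 * c)) * Polynomial.X +
      Polynomial.C (κ b₀ + κ b₁ * κ q) := by
    refine ⟨Polynomial.map κ u * Polynomial.C (κ c), ?_⟩
    simp only [m, map_mul, map_add] at h1 ⊢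
    linear_combination -h1 - Polynomial.map κ u * (Polynomial.C (κ q) * Polynomial.X +
      Polynomial.C (κ r)) * hC
  have h0 : Polynomial.C (κ b₁ * κ (2 * c)) * Polynomial.X +
      Polynomial.C (κ b₀ + κ b₁ * κ q) = 0 := by
    refine ((Polynomial.modByMonic_eq_self_iff hm).2 ?_).symm.trans
      ((Polynomial.modByMonic_eq_zero_iff_dvd hm).2 hdvd)
    rw [hmdeg]
    exact Polynomial.degree_linear_le.trans_lt (by decide)
  have e1 := congrArg (Polynomial.coeff · 1) h0
  have e0 := congrArg (Polynomial.coeff · 0) h0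
  simp only [Polynomial.coeff_add, Polynomial.coeff_C_mul, Polynomial.coeff_X_one, mul_one,
    Polynomial.coeff_C_succ, Polynomial.coeff_X_zero, mul_zero, zero_add, Polynomial.coeff_C_zero,
    add_zero, Polynomial.coeff_zero] at e1 e0
  have hb₁ : κ b₁ = 0 := ((h2.mul hc).map κ).mul_left_eq_zero.1 e1
  rw [hb₁, zero_mul, add_zero] at e0
  exact ⟨Ideal.Quotient.eq_zero_iff_mem.1 e0, Ideal.Quotient.eq_zero_iff_mem.1 hb₁⟩

include hΨ hc h2 hker in
/-- A quadratic extension of a ring in which two is invertible is generated by the square root of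
the discriminant. -/
lemma exists_sqrt_discriminant {W : Type} [CommRing W] {α : W →+* Γ} {σ : B →+* W}
    (hσ : Function.Surjective σ) (hkerσ : RingHom.ker σ = Ideal.span {ν})
    (hcomp : ∀ b, Ψ (Polynomial.C b) = α (σ b)) :
    ∃ t : Γ, t ^ 2 = α (σ (q ^ 2 - 4 * c * r)) ∧
      ∀ z : Γ, ∃! p : W × W, z = α p.1 + α p.2 * t := by
  refine ⟨Ψ (Polynomial.C (2 * c) * Polynomial.X + Polynomial.C q), ?_, fun z => ?_⟩
  · rw [← hcomp, ← map_pow, ← sub_eq_zero, ← map_sub, ← RingHom.mem_ker, hker,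
      Ideal.mem_span_pair]
    -- Completing the square: `(2cX + q)² - (q² - 4cr) = 4c (cX² + qX + r)`.
    refine ⟨4 * Polynomial.C c, 0, ?_⟩
    simp only [map_sub, map_mul, map_pow, map_ofNat]
    ring
  · obtain ⟨b₀, b₁, hb⟩ := exists_eq_add_mul hΨ hc h2 hker z
    refine ⟨(σ b₀, σ b₁), by simpa only [← hcomp] using hb, ?_⟩
    rintro ⟨z₀, z₁⟩ hz
    obtain ⟨a₀, rfl⟩ := hσ z₀
    obtain ⟨a₁, rfl⟩ := hσ z₁
    simp only [← hcomp] at hz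
    have h0 := mem_span_of_add_mul_eq_zero hc h2 hker (b₀ := a₀ - b₀) (b₁ := a₁ - b₁) (by
      rw [map_sub, map_sub, map_sub, map_sub]
      linear_combination hb - hz)
    rw [← hkerσ, RingHom.mem_ker, RingHom.mem_ker, map_sub, map_sub,
      sub_eq_zero, sub_eq_zero] at h0
    exact Prod.ext h0.1 h0.2

end PolynomialQuotients

/-! ### The two shapes of the locus: a quartic or a double cover of a quadric. -/

section CasesOfLoci

open HomogeneousLocalization Scheme

attribute [local instance] MvPolynomial.weightedGradedAlgebra

variable {F : MvPolynomial (Fin 6) ℂ}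
  {s : ∀ i, Matrix (Fin 2) (Fin 2) Γ(hypersurface weights F, quarticChart F i)}

lemma unitWeights_pos (i : Fin 5) : 0 < unitWeights i := Nat.one_pos

lemma awayIdeal_unitWeights {d : ℕ} {G : MvPolynomial (Fin 5) ℂ} (hG : G ∈ grading unitWeights d)
    (i : Fin 5) : awayIdeal unitWeights G (X i) = Ideal.span {dehom i G} := by
  rw [awayIdeal_X hG (X_mem_grading_one (unitWeights_eq i)) (by simpa using hG), mk_eq_dehom]

lemma C_mem_grading {σ : Type} {w : σ → ℕ} (c : ℂ) : C c ∈ grading w 0 :=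
  isWeightedHomogeneous_C w c

lemma dehom_C (i : Fin 5) (c : ℂ) : dehom i (C c) = constHom unitWeights (X i) c := eval₂_C _ _ _

lemma quartic_mem_grading {c : ℂ} {q r : MvPolynomial (Fin 5) ℂ} (hq : q ∈ grading unitWeights 2)
    (hr : r ∈ grading unitWeights 4)
    (hF : F = C c * X 0 ^ 2 + rename Fin.succ q * X 0 + rename Fin.succ r) :
    F ∈ grading weights (4 • 1) := by
  rw [hF]
  refine Submodule.add_mem _ (Submodule.add_mem _ ?_ ?_) (rename_mem_grading hr)
  · exact SetLike.mul_mem_graded (i := 0) (j := 4) (C_mem_grading c)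
      (SetLike.pow_mem_graded 2 (X_mem_grading 0))
  · exact SetLike.mul_mem_graded (rename_mem_grading hq) (X_mem_grading 0)

lemma dehomPolynomial_quartic (i : Fin 5) {c : ℂ} {q r : MvPolynomial (Fin 5) ℂ}
    (hF : F = C c * X 0 ^ 2 + rename Fin.succ q * X 0 + rename Fin.succ r) :
    dehomPolynomial i F = Polynomial.C (constHom unitWeights (X i) c) * Polynomial.X ^ 2 +
      Polynomial.C (dehom i q) * Polynomial.X + Polynomial.C (dehom i r) := by
  rw [hF, map_add, map_add, map_mul, map_mul, map_pow, dehomPolynomial_rename,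
    dehomPolynomial_rename]
  exact congrArg₂ (· + ·) (congrArg₂ (· + ·) (congrArg₂ (· * ·) (dehomPolynomial_C i c)
    (congrArg (· ^ 2) (dehomPolynomial_X_zero i))) (congrArg (_ * ·)
      (dehomPolynomial_X_zero i))) rfl

lemma quartic_sub_mem (c : ℂ) {q r : MvPolynomial (Fin 5) ℂ} (hq : q ∈ grading unitWeights 2)
    (hr : r ∈ grading unitWeights 4)
    (hF : F = C c * X 0 ^ 2 + rename Fin.succ q * X 0 + rename Fin.succ r) :
    F - C c * X 0 ^ 2 ∈
      Ideal.span (Set.range fun i : Fin 5 => (X i.succ : MvPolynomial (Fin 6) ℂ)) := by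
  have key {n : ℕ} {p : MvPolynomial (Fin 5) ℂ} (hp : p ∈ grading unitWeights n) (hn : 0 < n) :
      rename Fin.succ p ∈
        Ideal.span (Set.range fun i : Fin 5 => (X i.succ : MvPolynomial (Fin 6) ℂ)) := by
    have h : p ∈ Ideal.span (X '' (Set.univ : Set (Fin 5))) := by
      rw [mem_ideal_span_X_image]
      intro m hm
      by_contra! h
      have h0 : m = 0 := Finsupp.ext fun i => h i trivial
      have := hp (mem_support_iff.1 hm)
      rw [h0, map_zero] at this
      exact hn.ne this
    have h' := Ideal.mem_map_of_mem (rename (R := ℂ) (Fin.succ : Fin 5 → Fin 6)) h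
    rw [Ideal.map_span] at h'
    refine Ideal.span_mono ?_ h'
    rintro _ ⟨_, ⟨i, -, rfl⟩, rfl⟩
    exact ⟨i, (rename_X _ _).symm⟩
  rw [hF, add_assoc, add_sub_cancel_left]
  exact Ideal.add_mem _ (Ideal.mul_mem_right _ _ (key hq (by lia))) (key hr (by lia))

/-- The case of a determinant in which the variable of weight two occurs. -/
theorem degeneracyLocus_iso_quartic {c : ℂ} (hc : c ≠ 0) {q r N : MvPolynomial (Fin 5) ℂ}
    (hq : q ∈ grading unitWeights 2) (hr : r ∈ grading unitWeights 4)
    (hF : F = C c * X 0 ^ 2 + rename Fin.succ q * X 0 + rename Fin.succ r)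
    {μ : ℂ} (hμ : μ ≠ 0) (hN : N ∈ grading unitWeights 2)
    (hΔ : C μ * (X 0 - rename Fin.succ N) ∈ grading weights (2 • 1)) (htr : ∀ i, (s i).trace = 0)
    (hdet : ∀ i, (s i).det = sectionHom weights F (X i.succ)
      (Away.mk (grading weights) (X_mem_grading_one (weights_succ i)) 2 _ hΔ)) :
    ∃ e : degeneracyLocus (quarticChart F) s ≅
      hypersurface unitWeights (C c * N ^ 2 + q * N + r), e.hom.IsOver specC := by
  have hG : C c * N ^ 2 + q * N + r ∈ grading unitWeights 4 := by
    refine Submodule.add_mem _ (Submodule.add_mem _ ?_ ?_) hr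
    · exact SetLike.mul_mem_graded (i := 0) (j := 4) (C_mem_grading c)
        (SetLike.pow_mem_graded 2 hN)
    · exact SetLike.mul_mem_graded hq hN
  have hF4 : F ∈ grading weights (4 • 1) := quartic_mem_grading hq hr hF
  obtain ⟨π, hπ, h⟩ := exists_degeneracy_projection hc hF4 (quartic_sub_mem c hq hr hF) hΔ htr hdet
  have key (i : Fin 5) : Function.Surjective (pullHom π (X i)) ∧ RingHom.ker (pullHom π (X i)) =
      awayIdeal unitWeights (C c * N ^ 2 + q * N + r) (X i) := by
    obtain ⟨-, Ψ, h1, h2, h3⟩ := h i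
    have h4 := surjective_comp_C h1 (f := dehomPolynomial i F) (μ := constHom unitWeights (X i) μ)
      (a := dehom i N) (hμ.isUnit.map _) (by
        rw [h2, map_mul, map_sub, dehomPolynomial_C, dehomPolynomial_X_zero,
          dehomPolynomial_rename])
    have h5 : Ψ.comp Polynomial.C = pullHom π (X i) := RingHom.ext h3
    rw [h5] at h4
    refine ⟨h4.1, h4.2.trans ?_⟩
    rw [awayIdeal_unitWeights hG, hF]
    refine congrArg (fun a => Ideal.span {a}) ?_
    rw [dehomPolynomial_quartic i rfl]
    simp only [map_add, map_mul, map_pow, Polynomial.eval_add, Polynomial.eval_mul,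
      Polynomial.eval_pow, Polynomial.eval_C, Polynomial.eval_X, dehom_C]
  obtain ⟨e, he⟩ := exists_iso_hypersurface unitWeights_pos _ (fun i => (h i).1)
    (fun i => (key i).2) fun i => (key i).1
  refine ⟨e, ⟨?_⟩⟩
  exact (Category.assoc ..).symm.trans ((congrArg (fun f : _ ⟶ weightedProj unitWeights =>
    f ≫ (weightedProj unitWeights ↘ specC)) he).trans hπ)

/-- This passes from polynomials to a chart of the quadric the fact that `R` is a non-zero-divisor
modulo `Q`, so that the branch locus is a Cartier divisor. -/
lemma mem_awayIdeal_of_mul_mem {Q R : MvPolynomial (Fin 5) ℂ} (hQR : ∀ u, Q ∣ R * u → Q ∣ u)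
    {d : ℕ} (hR : R ∈ grading unitWeights d) {i : Fin 5} {b : Away (grading unitWeights) (X i)}
    (h : dehom i R * b ∈ awayIdeal unitWeights Q (X i)) : b ∈ awayIdeal unitWeights Q (X i) := by
  obtain ⟨n, u, hu, rfl⟩ := Away.mk_surjective (grading unitWeights)
    (X_mem_grading_one (unitWeights_eq i)) b
  rw [← mk_eq_dehom i (n := d) (by simpa using hR), mem_awayIdeal, val_mul, Away.val_mk,
    Away.val_mk, Localization.mk_mul, algebraMap_dvd_iff] at h
  obtain ⟨k, hk⟩ := h
  rw [mk_mem_awayIdeal]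
  exact ⟨k, hQR _ (by rwa [mul_left_comm] at hk)⟩

/-- The case of a determinant in which the variable of weight two does not occur. -/
theorem exists_doubleCover {c : ℂ} (hc : c ≠ 0) {q r Q R : MvPolynomial (Fin 5) ℂ}
    (hq : q ∈ grading unitWeights 2) (hr : r ∈ grading unitWeights 4)
    (hF : F = C c * X 0 ^ 2 + rename Fin.succ q * X 0 + rename Fin.succ r)
    (hQ : Q ∈ grading unitWeights 2) (hR : R = q ^ 2 - C (4 * c) * r)
    (hQR : ∀ u, Q ∣ R * u → Q ∣ u)
    (hΔ : rename Fin.succ Q ∈ grading weights (2 • 1)) (htr : ∀ i, (s i).trace = 0)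
    (hdet : ∀ i, (s i).det = sectionHom weights F (X i.succ)
      (Away.mk (grading weights) (X_mem_grading_one (weights_succ i)) 2 _ hΔ)) :
    ∃ π : degeneracyLocus (quarticChart F) s ⟶ hypersurface unitWeights Q, π.IsOver specC ∧
      IsDoubleCoverRamifiedAlong π
        ((hypersurfaceIdeal unitWeights R).comap (hypersurfaceι unitWeights Q)) := by
  have hR4 : R ∈ grading unitWeights 4 := by
    rw [hR]
    exact Submodule.sub_mem _ (SetLike.pow_mem_graded 2 hq)
      (SetLike.mul_mem_graded (i := 0) (j := 4) (C_mem_grading _) hr)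
  have hF4 : F ∈ grading weights (4 • 1) := quartic_mem_grading hq hr hF
  obtain ⟨π₀, hπ₀, h⟩ :=
    exists_degeneracy_projection hc hF4 (quartic_sub_mem c hq hr hF) hΔ htr hdet
  have hker (i : Fin 5) : awayIdeal unitWeights Q (X i) ≤ RingHom.ker (pullHom π₀ (X i)) := by
    obtain ⟨-, Ψ, h1, h2, h3⟩ := h i
    rw [awayIdeal_unitWeights hQ, Ideal.span_singleton_le_iff_mem, RingHom.mem_ker, ← h3,
      ← dehomPolynomial_rename, ← RingHom.mem_ker, h2]
    exact Ideal.subset_span (by simp)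
  obtain ⟨π, hπ⟩ := exists_lift_hypersurface unitWeights_pos Q (fun i => (h i).1) hker
  have haff := isAffineHom_of_charts unitWeights_pos fun i => (h i).1
  subst hπ
  refine ⟨π, ⟨?_⟩, ?_, fun x => ?_⟩
  · exact (Category.assoc ..).symm.trans hπ₀
  · have : IsAffineHom (π ≫ hypersurfaceι unitWeights Q) := haff
    exact IsAffineHom.of_comp π (hypersurfaceι unitWeights Q)
  · have hx : hypersurfaceι unitWeights Q x ∈
        ⨆ i, Proj.basicOpen (grading unitWeights) (X i) := by
      rw [iSup_basicOpen_X]; trivial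
    obtain ⟨i, hi⟩ := TopologicalSpace.Opens.mem_iSup.1 hx
    obtain ⟨-, Ψ, h1, h2, h3⟩ := h i
    have hU : IsAffineOpen (hypersurfaceι unitWeights Q ⁻¹ᵁ
        Proj.basicOpen (grading unitWeights) (X i)) :=
      IsAffineOpen.preimage (Y := weightedProj unitWeights) (isAffineOpen_X (unitWeights_pos i)) _
    have hsurj := sectionHom_surjective (w := unitWeights) Q (X_mem_grading i) (unitWeights_pos i)
    have hker' := ker_sectionHom_X unitWeights_pos Q i
    have hcomp (b : Away (grading unitWeights) (X i)) : Ψ (Polynomial.C b) =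
        (π.app (hypersurfaceι unitWeights Q ⁻¹ᵁ Proj.basicOpen (grading unitWeights) (X i))).hom
          (sectionHom unitWeights Q (X i) b) :=
      (h3 b).trans congr(($(Hom.comp_app π (hypersurfaceι unitWeights Q)
        (Proj.basicOpen (grading unitWeights) (X i)))).hom
        ((Proj.awayToSection (grading unitWeights) (X i)).hom b))
    have hc' : IsUnit (constHom unitWeights (X i) c) := hc.isUnit.map _
    have h2' : IsUnit (2 : Away (grading unitWeights) (X i)) := by
      have := (two_ne_zero (α := ℂ)).isUnit.map (constHom unitWeights (X i))
      rwa [map_ofNat] at this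
    rw [dehomPolynomial_quartic i hF, dehomPolynomial_rename] at h2
    rw [awayIdeal_unitWeights hQ] at hker'
    obtain ⟨t, ht, ht'⟩ := exists_sqrt_discriminant h1 hc' h2' h2 hsurj hker' hcomp
    have hR' : dehom i R = dehom i q ^ 2 - 4 * constHom unitWeights (X i) c * dehom i r := by
      simp only [hR, map_sub, map_mul, map_pow, dehom_C, map_ofNat]
    rw [← hR'] at ht
    rw [← awayIdeal_unitWeights hQ] at hker'
    -- The local equation of the branch divisor is the dehomogenized discriminant, and `t` is `2cy +
    -- q` on this chart.
    refine ⟨⟨_, hU⟩, hi, sectionHom unitWeights Q (X i) (dehom i R), ?_, t, ?_, ht, ht'⟩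
    · rw [mem_nonZeroDivisors_iff_right]
      intro z hz
      obtain ⟨b, rfl⟩ := hsurj z
      rw [← map_mul, ← RingHom.mem_ker, hker', mul_comm] at hz
      rw [← RingHom.mem_ker, hker']
      exact mem_awayIdeal_of_mul_mem hQR hR4 hz
    · refine (ideal_comap_appLE (Y := weightedProj unitWeights) (hypersurfaceι unitWeights Q)
        (hypersurfaceIdeal unitWeights R) ⟨_, isAffineOpen_X (unitWeights_pos i)⟩
        ⟨_, hU⟩ le_rfl).trans ?_
      refine (congrArg (Ideal.map _) (hypersurfaceIdeal_X unitWeights_pos R i)).trans ?_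
      rw [chartIdeal, awayIdeal_unitWeights hR4, Ideal.map_span, Set.image_singleton]
      refine (Ideal.map_span _ _).trans ?_
      refine congrArg Ideal.span ((Set.image_singleton ..).trans ?_)
      refine congrArg singleton ?_
      exact congr(($(Hom.appLE_eq_app (hypersurfaceι unitWeights Q))).hom _)

end CasesOfLoci

/-! ### Expansion in powers of `y`, and the consequences of smoothness. -/

section WeightedPolynomials

attribute [local instance] MvPolynomial.weightedGradedAlgebra

lemma weight_cons (m : Fin 5 →₀ ℕ) (k : ℕ) :
    Finsupp.weight weights (m.cons k) = 2 * k + Finsupp.weight unitWeights m := by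
  rw [Finsupp.weight_apply, Finsupp.weight_apply, Finsupp.sum_cons']
  · rw [mul_comm]
    congr 1
    refine Finsupp.sum_congr fun j _ => ?_
    exact congrArg (m j • ·) (weights_succ j)
  · simp

/-- The coefficient of `y ^ k` in a polynomial in six variables, where `y` is the first one. -/
def yCoeff (P : MvPolynomial (Fin 6) ℂ) (k : ℕ) : MvPolynomial (Fin 5) ℂ :=
  (finSuccEquiv ℂ 5 P).coeff k

lemma finSuccEquiv_rename (p : MvPolynomial (Fin 5) ℂ) :
    finSuccEquiv ℂ 5 (rename Fin.succ p) = Polynomial.C p := by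
  induction p using MvPolynomial.induction_on with
  | C a => rw [rename_C]; simp [finSuccEquiv_apply]
  | add p q hp hq => simp only [map_add, hp, hq]
  | mul_X p i hp => rw [map_mul, map_mul, hp, rename_X, finSuccEquiv_X_succ, map_mul]

variable {P : MvPolynomial (Fin 6) ℂ} {d : ℕ}

lemma yCoeff_mem (hP : P ∈ grading weights d) {k n : ℕ} (h : 2 * k + n = d) :
    yCoeff P k ∈ grading unitWeights n := by
  intro m hm
  rw [yCoeff, finSuccEquiv_coeff_coeff] at hm
  have := hP hm
  rw [weight_cons] at this
  lia

lemma yCoeff_eq_zero (hP : P ∈ grading weights d) {k : ℕ} (h : d < 2 * k) : yCoeff P k = 0 := by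
  ext m
  by_contra hm
  rw [yCoeff, finSuccEquiv_coeff_coeff] at hm
  have := hP hm
  rw [weight_cons] at this
  lia

lemma eq_of_weight_lt_six (hP : P ∈ grading weights d) (hd : d < 6) :
    P = rename Fin.succ (yCoeff P 2) * X 0 ^ 2 + rename Fin.succ (yCoeff P 1) * X 0 +
      rename Fin.succ (yCoeff P 0) := by
  refine (finSuccEquiv ℂ 5).injective ?_
  simp only [map_add, map_mul, map_pow, finSuccEquiv_rename, finSuccEquiv_X_zero]
  ext1 k
  match k with
  | 0 => simp [yCoeff]
  | 1 => simp [yCoeff]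
  | 2 => simp [yCoeff]
  | k + 3 =>
    have := yCoeff_eq_zero hP (k := k + 3) (by lia)
    rw [yCoeff] at this
    rw [this]
    simp

lemma eq_C_of_mem_grading_zero {p : MvPolynomial (Fin 5) ℂ} (hp : p ∈ grading unitWeights 0) :
    p = C (coeff 0 p) := by
  rw [← totalDegree_eq_zero_iff_eq_C]
  exact Nat.le_zero.1 (IsHomogeneous.totalDegree_le (φ := p) hp)

lemma eq_rename_of_weight_lt_two (hP : P ∈ grading weights d) (hd : d < 2) :
    P = rename Fin.succ (yCoeff P 0) := by
  conv_lhs => rw [eq_of_weight_lt_six hP (by lia), yCoeff_eq_zero hP (k := 2) (by lia),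
    yCoeff_eq_zero hP (k := 1) (by lia)]
  simp

lemma eq_of_weight_two (hP : P ∈ grading weights 2) :
    P = C (coeff 0 (yCoeff P 1)) * X 0 + rename Fin.succ (yCoeff P 0) := by
  conv_lhs => rw [eq_of_weight_lt_six hP (by lia), yCoeff_eq_zero hP (k := 2) (by lia),
    eq_C_of_mem_grading_zero (yCoeff_mem hP (k := 1) (n := 0) rfl)]
  simp

lemma eq_of_weight_four (hP : P ∈ grading weights 4) :
    P = C (coeff 0 (yCoeff P 2)) * X 0 ^ 2 + rename Fin.succ (yCoeff P 1) * X 0 +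
      rename Fin.succ (yCoeff P 0) := by
  conv_lhs => rw [eq_of_weight_lt_six hP (by lia),
    eq_C_of_mem_grading_zero (yCoeff_mem hP (k := 2) (n := 0) rfl)]
  simp

lemma eval_zero_of_mem_grading {p : MvPolynomial (Fin 5) ℂ} {n : ℕ}
    (hp : p ∈ grading unitWeights n) (hn : n ≠ 0) : eval 0 p = 0 := by
  rw [eval_zero, constantCoeff_eq]
  by_contra h
  have := hp h
  rw [map_zero] at this
  exact hn this.symm

variable {F : MvPolynomial (Fin 6) ℂ} (hsmooth : IsSmoothEquation F) {c : ℂ}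
  {q r : MvPolynomial (Fin 5) ℂ}
  (hF : F = C c * X 0 ^ 2 + rename Fin.succ q * X 0 + rename Fin.succ r)

lemma eval_cons_rename (p : MvPolynomial (Fin 5) ℂ) (y : ℂ) (x : Fin 5 → ℂ) :
    eval (Fin.cons y x : Fin 6 → ℂ) (rename Fin.succ p) = eval x p := by
  rw [eval_rename]
  congr 1

include hF in
lemma eval_quartic (y : ℂ) (x : Fin 5 → ℂ) : eval (Fin.cons y x : Fin 6 → ℂ) F =
    c * y ^ 2 + eval x q * y + eval x r := by
  rw [hF]
  simp only [map_add, map_mul, map_pow, eval_C, eval_X, Fin.cons_zero]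
  rw [eval_cons_rename, eval_cons_rename]

-- If `c = 0`, then `F` and all its partial derivatives vanish at `(1,0,0,0,0,0)`, because `q` and
-- `r` have no terms of degree less than two.
include hsmooth hF in
lemma leading_coeff_ne_zero (hq : q ∈ grading unitWeights 2) (hr : r ∈ grading unitWeights 4) :
    c ≠ 0 := by
  rintro rfl
  have hd {p : MvPolynomial (Fin 5) ℂ} {n : ℕ} (hp : p ∈ grading unitWeights n) (hn : 1 < n)
      (i : Fin 6) : eval (Fin.cons 1 0 : Fin 6 → ℂ) (pderiv i (rename Fin.succ p)) = 0 := by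
    refine Fin.cases ?_ (fun j => ?_) i
    · rw [pderiv_eq_zero_of_notMem_vars, map_zero]
      intro h
      obtain ⟨j, -, hj⟩ := Finset.mem_image.1 (vars_rename _ _ h)
      exact Fin.succ_ne_zero j hj
    · rw [pderiv_rename (Fin.succ_injective 5), eval_cons_rename]
      exact eval_zero_of_mem_grading (n := n - 1) (IsHomogeneous.pderiv hp) (by lia)
  obtain ⟨i, hi⟩ := hsmooth (Fin.cons 1 0) (fun h => one_ne_zero (congrFun h 0)) (by
    rw [eval_quartic hF, eval_zero_of_mem_grading hq (by lia), eval_zero_of_mem_grading hr (by lia)]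
    simp)
  refine hi ?_
  rw [hF]
  simp only [map_add, zero_mul, map_zero, zero_add, pderiv_mul, map_mul]
  rw [hd hq (by lia), hd hr (by lia), eval_cons_rename, eval_zero_of_mem_grading hq (by lia)]
  simp

-- If the discriminant vanished, `4cF` would be the square of `L = 2cy + q`, and `F` would be
-- singular wherever `L = 0`.
include hsmooth hF in
lemma discriminant_ne_zero (hc : c ≠ 0) : q ^ 2 - C (4 * c) * r ≠ 0 := by
  intro h0
  let L : MvPolynomial (Fin 6) ℂ := C (2 * c) * X 0 + rename Fin.succ q
  have hL : C (4 * c) * F = L ^ 2 := by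
    have := congrArg (rename (R := ℂ) (Fin.succ : Fin 5 → Fin 6)) h0
    rw [map_sub, map_mul, map_pow, rename_C, map_zero] at this
    have e1 : (C (4 * c) : MvPolynomial (Fin 6) ℂ) = 4 * C c := by rw [map_mul, map_ofNat]
    have e2 : (C (2 * c) : MvPolynomial (Fin 6) ℂ) = 2 * C c := by rw [map_mul, map_ofNat]
    rw [e1] at this ⊢
    simp only [L]
    rw [e2, hF]
    linear_combination -this
  -- Any non-zero `x` would do: solving `L = 0` for `y` gives a zero of `L` away from the origin.
  let x : Fin 5 → ℂ := Pi.single 0 1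
  let z : Fin 6 → ℂ := Fin.cons (-(eval x q) / (2 * c)) x
  have hz : eval z L = 0 := by
    simp only [L, map_add, map_mul, eval_C, eval_X]
    rw [eval_cons_rename]
    change 2 * c * (-(eval x q) / (2 * c)) + _ = 0
    field_simp
    ring
  obtain ⟨i, hi⟩ := hsmooth z (fun h => by
    have : (1 : ℂ) = 0 := by
      simpa [z, x] using congrFun h (Fin.succ 0)
    exact one_ne_zero this) (by
      have := congrArg (eval z) hL
      rw [map_mul, map_pow, hz, eval_C] at this
      simpa [hc] using this)
  have := congrArg (fun p => eval z (pderiv i p)) hL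
  simp only [pderiv_mul, pderiv_C, zero_mul, zero_add, map_mul, pow_two, map_add, hz, eval_C,
    mul_zero, add_zero] at this
  simp [hc] at this
  exact hi this

end WeightedPolynomials

/-! ### Division by the quartic: `ℂ[x,y]/F` as a free module with basis `1, y`. -/

section Remainders

attribute [local instance] MvPolynomial.weightedGradedAlgebra

variable {F : MvPolynomial (Fin 6) ℂ} {c : ℂ} (hc : c ≠ 0) {q r : MvPolynomial (Fin 5) ℂ}
  (hF : F = C c * X 0 ^ 2 + rename Fin.succ q * X 0 + rename Fin.succ r)

include hc hF in
lemma exists_remainder (p : MvPolynomial (Fin 6) ℂ) : ∃ A B : MvPolynomial (Fin 5) ℂ,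
    F ∣ p - (rename Fin.succ A + rename Fin.succ B * X 0) := by
  induction p using MvPolynomial.induction_on with
  | C a => exact ⟨C a, 0, by simp⟩
  | add p p' hp hp' =>
    obtain ⟨A, B, h⟩ := hp
    obtain ⟨A', B', h'⟩ := hp'
    refine ⟨A + A', B + B', (dvd_add h h').trans (dvd_of_eq ?_)⟩
    simp only [map_add]
    ring
  | mul_X p i hp =>
    obtain ⟨A, B, h, hh⟩ := hp
    refine Fin.cases ?_ (fun j => ?_) i
    · refine ⟨-(C c⁻¹ * B * r), A - C c⁻¹ * B * q, h * X 0 + C c⁻¹ * rename Fin.succ B, ?_⟩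
      have h1 : (C c⁻¹ * C c : MvPolynomial (Fin 6) ℂ) = 1 := by
        rw [← C_mul, inv_mul_cancel₀ hc, C_1]
      simp only [map_neg, map_sub, map_mul, rename_C]
      rw [eq_add_of_sub_eq hh, mul_add F, ← mul_assoc F h, ← mul_assoc F (C c⁻¹)]
      nth_rw 3 [hF]
      linear_combination -rename Fin.succ B * X 0 ^ 2 * h1
    · refine ⟨A * X j, B * X j, h * X j.succ, ?_⟩
      simp only [map_mul, rename_X]
      linear_combination X j.succ * hh

include hc hF in
lemma eq_zero_of_dvd_linear {A B : MvPolynomial (Fin 5) ℂ}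
    (h : F ∣ rename Fin.succ A + rename Fin.succ B * X 0) : A = 0 ∧ B = 0 := by
  have h1 := map_dvd (finSuccEquiv ℂ 5) h
  have hcC : finSuccEquiv ℂ 5 (C c) = Polynomial.C (C c) := by
    rw [← finSuccEquiv_rename, rename_C]
  rw [hF] at h1
  simp only [map_add, map_mul, map_pow, finSuccEquiv_rename, finSuccEquiv_X_zero] at h1
  rw [hcC] at h1
  have h2 : Polynomial.C A + Polynomial.C B * Polynomial.X = 0 := by
    refine Polynomial.eq_zero_of_dvd_of_degree_lt h1 ?_
    rw [Polynomial.degree_quadratic (C_ne_zero.2 hc), add_comm]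
    exact Polynomial.degree_linear_le.trans_lt (by decide)
  have e0 := congrArg (Polynomial.coeff · 0) h2
  have e1 := congrArg (Polynomial.coeff · 1) h2
  simp at e0 e1
  exact ⟨e0, e1⟩

-- `X i.succ` is prime and does not divide `F`, whose value at `(1,0,0,0,0,0)` is `c ≠ 0`.
include hc hF in
lemma dvd_of_dvd_X_mul {i : Fin 5} {p : MvPolynomial (Fin 6) ℂ} (hq : q ∈ grading unitWeights 2)
    (hr : r ∈ grading unitWeights 4) (h : F ∣ X i.succ * p) : F ∣ p := by
  obtain ⟨g, hg⟩ := h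
  have hX : Prime (X i.succ : MvPolynomial (Fin 6) ℂ) := X_prime
  have hXF : ¬ X i.succ ∣ F := by
    rintro ⟨h, hh⟩
    have := congrArg (eval (Fin.cons 1 0 : Fin 6 → ℂ)) hh
    rw [eval_quartic hF, eval_zero_of_mem_grading hq (by lia),
      eval_zero_of_mem_grading hr (by lia), map_mul, eval_X, Fin.cons_succ] at this
    simp [hc] at this
  obtain ⟨g', rfl⟩ := (hX.dvd_or_dvd (Dvd.intro _ hg)).resolve_left hXF
  exact ⟨g', mul_left_cancel₀ hX.ne_zero (by rw [hg]; ring)⟩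

include hc hF in
lemma dvd_of_dvd_X_pow_mul {i : Fin 5} {p : MvPolynomial (Fin 6) ℂ}
    (hq : q ∈ grading unitWeights 2) (hr : r ∈ grading unitWeights 4) {n : ℕ}
    (h : F ∣ X i.succ ^ n * p) : F ∣ p := by
  induction n with
  | zero => simpa using h
  | succ n ih => exact ih (dvd_of_dvd_X_mul hc hF hq hr (by rwa [pow_succ', mul_assoc] at h))

/-- A Hartogs-type statement: the fractions `A_i / x_i^k` all agree, and by unique factorization one
with denominators both `x_0^k` and `x_1^k` is a polynomial. -/
lemma exists_eq_X_pow_mul {A : Fin 5 → MvPolynomial (Fin 5) ℂ} {k : ℕ}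
    (h : ∀ i j, X i ^ k * A j = X j ^ k * A i) : ∃ g, ∀ i, A i = X i ^ k * g := by
  have h0 : (X 0 : MvPolynomial (Fin 5) ℂ) ^ k ∣ A 0 := by
    refine (X_prime (R := ℂ) (i := (0 : Fin 5))).pow_dvd_of_dvd_mul_left k (a := X 1 ^ k)
      (fun h' => ?_)
      ⟨A 1, (h 0 1).symm⟩
    have := (X_prime (R := ℂ) (i := (0 : Fin 5))).dvd_of_dvd_pow h'
    rw [X_dvd_X] at this
    simp at this
  obtain ⟨g, hg⟩ := h0
  refine ⟨g, fun i => mul_left_cancel₀ (pow_ne_zero k (X_ne_zero (R := ℂ) (0 : Fin 5))) ?_⟩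
  rw [h, hg]
  ring

include hc hF in
/-- Compatible fractions modulo the quartic come from one polynomial. -/
lemma exists_global_numerator (hq : q ∈ grading unitWeights 2) (hr : r ∈ grading unitWeights 4)
    {d k : ℕ} {p : Fin 5 → MvPolynomial (Fin 6) ℂ} (hp : ∀ i, p i ∈ grading weights (k + d))
    (h : ∀ i j, F ∣ X i.succ ^ k * p j - X j.succ ^ k * p i) :
    ∃ P ∈ grading weights d, ∀ i, F ∣ p i - X i.succ ^ k * P := by
  have hF4 : F ∈ grading weights 4 := by simpa using quartic_mem_grading hq hr hF
  choose A B hAB using fun i => exists_remainder hc hF (p i)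
  have hAB' (i j : Fin 5) :
      X i ^ k * A j - X j ^ k * A i = 0 ∧ X i ^ k * B j - X j ^ k * B i = 0 := by
    refine eq_zero_of_dvd_linear hc hF ?_
    have := dvd_sub (h i j) (dvd_sub ((hAB j).mul_left (X i.succ ^ k))
      ((hAB i).mul_left (X j.succ ^ k)))
    refine this.trans (dvd_of_eq ?_)
    simp only [map_sub, map_mul, map_pow, rename_X]
    ring
  obtain ⟨g, hg⟩ := exists_eq_X_pow_mul fun i j => sub_eq_zero.1 (hAB' i j).1
  obtain ⟨g', hg'⟩ := exists_eq_X_pow_mul fun i j => sub_eq_zero.1 (hAB' i j).2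
  -- The coefficients of `1` and `y` in the remainders glue separately. Nothing makes `P`
  -- homogeneous, so its component of weight `d` is taken.
  let P := rename Fin.succ g + rename Fin.succ g' * X 0
  refine ⟨_, (DirectSum.decompose (grading weights) P d).2, fun i => ?_⟩
  obtain ⟨u, hu⟩ := hAB i
  have h1 : p i = X i.succ ^ k * P + F * u := by
    simp only [P]
    rw [← hu, hg, hg', map_mul, map_mul, map_pow, rename_X]
    ring
  have h2 : X i.succ ^ k ∈ grading weights k := by
    have := SetLike.pow_mem_graded k (X_mem_grading_one (weights_succ i))
    simpa using this
  have h3 := congrArg (fun z => (DirectSum.decompose (grading weights) z (k + d)).1) h1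
  simp only [DirectSum.decompose_add, DirectSum.add_apply, Submodule.coe_add] at h3
  rw [DirectSum.decompose_of_mem_same _ (hp i),
    DirectSum.coe_decompose_mul_add_of_left_mem (𝒜 := grading weights) h2] at h3
  rw [h3, add_sub_cancel_left]
  by_cases h4 : 4 ≤ k + d
  · rw [DirectSum.coe_decompose_mul_of_left_mem_of_le (𝒜 := grading weights) hF4 h4]
    exact dvd_mul_right _ _
  · rw [DirectSum.coe_decompose_mul_of_left_mem_of_not_le (𝒜 := grading weights) hF4 h4]
    exact dvd_zero _

lemma eq_zero_of_dvd_of_weight_lt {P : MvPolynomial (Fin 6) ℂ} (hF4 : F ∈ grading weights 4) {d : ℕ}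
    (hP : P ∈ grading weights d) (hd : d < 4) (h : F ∣ P) : P = 0 := by
  obtain ⟨u, rfl⟩ := h
  rw [← DirectSum.decompose_of_mem_same _ hP,
    DirectSum.coe_decompose_mul_of_left_mem_of_not_le (𝒜 := grading weights) hF4 (by lia)]

end Remainders

/-! ### Fractions on the quartic and their comparison on overlaps. -/

section GlobalSections

open HomogeneousLocalization Scheme

attribute [local instance] MvPolynomial.weightedGradedAlgebra

variable {F : MvPolynomial (Fin 6) ℂ}

lemma mem_grading_smul_one {σ : Type} {w : σ → ℕ} {P : MvPolynomial σ ℂ} {d : ℕ}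
    (hP : P ∈ grading w d) : P ∈ grading w (d • 1) := by
  simpa using hP

variable (F) in
/-- The function `P / x_i ^ d` on a chart of the quartic, where `P` is homogeneous of weight `d`. -/
def fraction (d : ℕ) (i : Fin 5) :
    grading weights d →ₗ[ℂ] Γ(hypersurface weights F, quarticChart F i) where
  toFun P := sectionHom weights F (X i.succ) (Away.mk (grading weights)
    (X_mem_grading_one (weights_succ i)) d P.1 (mem_grading_smul_one P.2))
  map_add' P Q := by
    refine (congrArg (sectionHom weights F (X i.succ)) ?_).trans (map_add _ _ _)
    ext
    simp only [val_add, Away.val_mk, Localization.add_mk_self, Submodule.coe_add]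
  map_smul' c P := by
    refine Eq.trans ?_ (Algebra.smul_def c _).symm
    refine Eq.trans ?_ (congrArg (· * _) (algebraMap_sectionHom F
      (X_mem_grading_one (weights_succ i)) one_pos c)).symm
    refine (congrArg (sectionHom weights F (X i.succ)) ?_).trans (map_mul _ _ _)
    ext
    rw [val_mul, Away.val_mk, Away.val_mk, val_constHom, ← Localization.mk_one_eq_algebraMap,
      Localization.mk_mul, one_mul, Submodule.coe_smul, smul_eq_C_mul]

lemma transition_eq (i j : Fin 5) : transition F i j = restrict inf_le_right
    (fraction F 1 j ⟨X i.succ, X_mem_grading_one (weights_succ i)⟩) := rfl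

lemma restrict_restrict {Y : Scheme.{0}} [Y.Over specC] {U V W : Y.Opens} (h : V ≤ U) (h' : W ≤ V)
    (a) : restrict h' (restrict h a) = restrict (h'.trans h) a :=
  congr(($(Y.presheaf.map_comp (homOfLE h).op (homOfLE h').op)).hom a).symm

lemma quarticChart₂_le_left (i j : Fin 5) : quarticChart₂ F i j ≤ quarticChart F i := by
  rw [← quarticChart_inf]; exact inf_le_left

lemma quarticChart₂_le_right (i j : Fin 5) : quarticChart₂ F i j ≤ quarticChart F j := by
  rw [← quarticChart_inf]; exact inf_le_right

lemma restrict_fraction_left (i j : Fin 5) (d : ℕ) (P : grading weights d) :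
    ∃ a : Away (grading weights) (X i.succ * X j.succ),
      restrict (quarticChart₂_le_left i j) (fraction F d i P) =
        sectionHom weights F (X i.succ * X j.succ) a ∧
      a.val * algebraMap _ _ (X i.succ : MvPolynomial (Fin 6) ℂ) ^ d = algebraMap _ _ P.1 := by
  refine ⟨_, restrict_sectionHom F (X_mem_grading (w := weights) j.succ) rfl _ _, ?_⟩
  rw [awayMap_mk, Away.val_mk, ← map_pow, ← Localization.mk_one_eq_algebraMap,
    ← Localization.mk_one_eq_algebraMap, Localization.mk_mul, Localization.mk_eq_mk_iff,
    Localization.r_iff_exists]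
  exact ⟨1, by simp only [Submonoid.coe_mul, OneMemClass.coe_one]; ring⟩

lemma restrict_fraction_right (i j : Fin 5) (d : ℕ) (P : grading weights d) :
    ∃ a : Away (grading weights) (X i.succ * X j.succ),
      restrict (quarticChart₂_le_right i j) (fraction F d j P) =
        sectionHom weights F (X i.succ * X j.succ) a ∧
      a.val * algebraMap _ _ (X j.succ : MvPolynomial (Fin 6) ℂ) ^ d = algebraMap _ _ P.1 := by
  refine ⟨_, restrict_sectionHom F (X_mem_grading (w := weights) i.succ) (mul_comm _ _) _ _, ?_⟩
  rw [awayMap_mk, Away.val_mk, ← map_pow, ← Localization.mk_one_eq_algebraMap,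
    ← Localization.mk_one_eq_algebraMap, Localization.mk_mul, Localization.mk_eq_mk_iff,
    Localization.r_iff_exists]
  exact ⟨1, by simp only [Submonoid.coe_mul, OneMemClass.coe_one]; ring⟩

lemma map_pow_mul_eq_iff {A B : Type*} [CommRing A] [CommRing B] (θ : A →+* B) (t a b : A)
    (e m : ℕ) : θ t ^ e * θ b = θ t ^ m * θ a ↔ t ^ e * b - t ^ m * a ∈ RingHom.ker θ := by
  rw [RingHom.mem_ker, map_sub, map_mul, map_mul, map_pow, map_pow, sub_eq_zero]

/-- Here `t` stands for `x_i / x_j`, `v` for `x_j`, hence `tv` for `x_i`, while `a` and `b` are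
fractions with denominators `x_i^n` and `x_j^n`. -/
lemma cocycle_mul_denominators {A : Type*} [CommRing A] (t a b v : A) (n d e : ℕ) :
    (t ^ e * b - t ^ (d + e) * a) * (v ^ (d + e) * (t * v * v) ^ n) =
      ((t * v) ^ n * (v ^ d * (b * v ^ n)) - v ^ n * ((t * v) ^ d * (a * (t * v) ^ n))) *
        (t * v) ^ e := by
  simp only [mul_pow, pow_add]
  ring

variable {c : ℂ} (hc : c ≠ 0) {q r : MvPolynomial (Fin 5) ℂ}
  (hF : F = C c * X 0 ^ 2 + rename Fin.succ q * X 0 + rename Fin.succ r)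
  (hq : q ∈ grading unitWeights 2) (hr : r ∈ grading unitWeights 4)

include hc hF hq hr in
/-- The condition for two fractions to define the same section on an intersection of charts. -/
lemma transition_mul_fraction_iff (i j : Fin 5) {n d e m : ℕ} (hm : m = d + e)
    (P Q : grading weights n) :
    transition F i j ^ e * restrict inf_le_right (fraction F n j Q) =
        transition F i j ^ m * restrict inf_le_left (fraction F n i P) ↔
      F ∣ X i.succ ^ n * (X j.succ ^ d * Q.1) - X j.succ ^ n * (X i.succ ^ d * P.1) := by
  have hinj : Function.Injective (restrict (quarticChart_inf F i j).ge) :=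
    (bijective_presheaf_map (quarticChart_inf F i j).ge (quarticChart_inf F i j).le).1
  rw [← hinj.eq_iff, transition_eq]
  simp only [map_mul, map_pow, restrict_restrict]
  obtain ⟨t, ht, ht'⟩ := restrict_fraction_right (F := F) i j 1
    ⟨X i.succ, X_mem_grading_one (weights_succ i)⟩
  obtain ⟨b, hb, hb'⟩ := restrict_fraction_right (F := F) i j n Q
  obtain ⟨a, ha, ha'⟩ := restrict_fraction_left (F := F) i j n P
  refine Iff.trans (Eq.congr (congrArg₂ (fun x y => x ^ e * y) ht hb)
    (congrArg₂ (fun x y => x ^ m * y) ht ha)) ?_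
  refine (map_pow_mul_eq_iff _ t a b e m).trans ((SetLike.ext_iff.1
    (ker_sectionHom_X_mul weights_pos F i.succ (X_mem_grading j.succ)) _).trans ?_)
  rw [mem_awayIdeal, val_sub,
    val_mul, val_mul, val_pow, val_pow]
  let α : MvPolynomial (Fin 6) ℂ →+* Localization.Away
    (X i.succ * X j.succ : MvPolynomial (Fin 6) ℂ) := algebraMap _ _
  have hu : IsUnit (α (X i.succ) * α (X j.succ)) := by
    rw [← map_mul]
    exact IsLocalization.Away.algebraMap_isUnit _
  have hui := isUnit_of_mul_isUnit_left hu
  have huj := isUnit_of_mul_isUnit_right hu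
  change α F ∣ _ ↔ _
  change t.val * α (X j.succ) ^ 1 = α (X i.succ) at ht'
  change b.val * α (X j.succ) ^ n = α Q.1 at hb'
  change a.val * α (X i.succ) ^ n = α P.1 at ha'
  have key : (t.val ^ e * b.val - t.val ^ m * a.val) * (α (X j.succ) ^ m *
      (α (X i.succ) * α (X j.succ)) ^ n) = α (X i.succ ^ n * (X j.succ ^ d * Q.1) -
        X j.succ ^ n * (X i.succ ^ d * P.1)) * α (X i.succ) ^ e := by
    rw [map_sub]
    simp only [map_mul, map_pow]
    rw [pow_one] at ht'
    rw [← hb', ← ha', hm, ← ht']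
    exact cocycle_mul_denominators _ _ _ _ _ _ _
  -- The factors introduced to clear denominators are units on the overlap, so they do not affect
  -- divisibility by `F`.
  rw [← ((huj.pow m).mul (hu.pow n)).dvd_mul_right, key, (hui.pow e).dvd_mul_right,
    ← Localization.mk_one_eq_algebraMap (X i.succ ^ n * _ - _), algebraMap_dvd_iff]
  constructor
  · rintro ⟨N, hN⟩
    rw [mul_pow, mul_assoc] at hN
    exact dvd_of_dvd_X_pow_mul hc hF hq hr (dvd_of_dvd_X_pow_mul hc hF hq hr hN)
  · exact fun h => ⟨0, by simpa using h⟩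

end GlobalSections

/-! ### Sections of `𝒪(d)` on the quartic. -/

section SectionsOfLineBundles

open HomogeneousLocalization Scheme

attribute [local instance] MvPolynomial.weightedGradedAlgebra

variable {F : MvPolynomial (Fin 6) ℂ}

lemma fraction_mul {d e n : ℕ} (h : d + e = n) (i : Fin 5) (P : grading weights d)
    (Q : grading weights e) {R : grading weights n} (hR : R.1 = P.1 * Q.1) :
    fraction F d i P * fraction F e i Q = fraction F n i R := by
  refine (map_mul _ _ _).symm.trans (congrArg (sectionHom weights F (X i.succ)) ?_)
  ext
  rw [val_mul, Away.val_mk, Away.val_mk, Away.val_mk, Localization.mk_mul, hR]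
  congr 1
  ext1
  rw [← h]
  exact (pow_add _ _ _).symm

lemma fraction_X_pow_mul {d : ℕ} (k : ℕ) (i : Fin 5) (P : grading weights d) {Q}
    (hQ : Q.1 = X i.succ ^ k * P.1) : fraction F (k + d) i Q = fraction F d i P := by
  refine congrArg (sectionHom weights F (X i.succ)) ?_
  ext
  rw [Away.val_mk, Away.val_mk, Localization.mk_eq_mk_iff, Localization.r_iff_exists, hQ]
  exact ⟨1, by ring⟩

lemma exists_eq_fraction (i : Fin 5) (f : Γ(hypersurface weights F, quarticChart F i)) :
    ∃ (n : ℕ) (P : grading weights n), f = fraction F n i P := by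
  obtain ⟨a, rfl⟩ := sectionHom_surjective F (X_mem_grading_one (weights_succ i)) one_pos f
  obtain ⟨n, P, hP, rfl⟩ := Away.mk_surjective (grading weights)
    (X_mem_grading_one (weights_succ i)) a
  exact ⟨n, ⟨P, by simpa using hP⟩, rfl⟩

lemma exists_eq_fraction_of_le (f : ∀ i, Γ(hypersurface weights F, quarticChart F i)) (d : ℕ) :
    ∃ (k : ℕ) (P : Fin 5 → grading weights (k + d)), ∀ i, f i = fraction F (k + d) i (P i) := by
  choose n P hP using fun i => exists_eq_fraction i (f i)
  -- The sum of the exponents bounds each of them, which gives the same exponent on all charts;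
  -- adding `d` leaves room for a numerator of the form `x_i^k P`.
  refine ⟨∑ i, n i, ?_⟩
  have (i : Fin 5) : ∃ Q : grading weights (∑ i, n i + d), f i = fraction F _ i Q := by
    obtain ⟨k, hk⟩ := Nat.exists_eq_add_of_le' (Finset.single_le_sum (f := n)
      (fun _ _ => Nat.zero_le _) (Finset.mem_univ i))
    have h1 : X i.succ ^ (k + d) * (P i).1 ∈ grading weights (∑ i, n i + d) := by
      have := SetLike.mul_mem_graded (SetLike.pow_mem_graded (k + d)
        (X_mem_grading_one (weights_succ i))) (P i).2
      rw [smul_eq_mul, mul_one] at this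
      rwa [hk, add_right_comm]
    have h2 : k + d + n i = ∑ i, n i + d := by lia
    revert h1
    rw [← h2]
    exact fun h1 => ⟨⟨_, h1⟩, (hP i).trans (fraction_X_pow_mul _ _ _ rfl).symm⟩
  choose Q hQ using this
  exact ⟨Q, hQ⟩

variable {c : ℂ} (hc : c ≠ 0) {q r : MvPolynomial (Fin 5) ℂ}
  (hF : F = C c * X 0 ^ 2 + rename Fin.succ q * X 0 + rename Fin.succ r)
  (hq : q ∈ grading unitWeights 2) (hr : r ∈ grading unitWeights 4)

include hc hF hq hr in
lemma fraction_eq_zero_iff {d : ℕ} (i : Fin 5) (P : grading weights d) :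
    fraction F d i P = 0 ↔ F ∣ P.1 := by
  refine (RingHom.mem_ker (f := sectionHom weights F (X i.succ))).symm.trans ((SetLike.ext_iff.1
    (ker_sectionHom_X weights_pos F i.succ) _).trans ?_)
  rw [mk_mem_awayIdeal]
  constructor
  · rintro ⟨N, hN⟩
    exact dvd_of_dvd_X_pow_mul hc hF hq hr hN
  · exact fun h => ⟨0, by simpa using h⟩

-- A non-zero multiple of `F` has no component of weight less than four, so in these weights the
-- polynomial is unique.
include hc hF hq hr in
lemma fraction_injective {d : ℕ} (hd : d < 4) (i : Fin 5) :
    Function.Injective (fraction F d i) := by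
  rw [injective_iff_map_eq_zero]
  intro P hP
  have hF4 : F ∈ grading weights 4 := by simpa using quartic_mem_grading hq hr hF
  exact Subtype.ext (eq_zero_of_dvd_of_weight_lt hF4 P.2 hd
    ((fraction_eq_zero_iff hc hF hq hr i P).1 hP))

include hc hF hq hr in
/-- The sections of `𝒪(d)` on the quartic are given by polynomials of weight `d`. -/
lemma transition_mul_eq_iff {d e m : ℕ} (hm : m = d + e)
    (f : ∀ i, Γ(hypersurface weights F, quarticChart F i)) :
    (∀ i j, transition F i j ^ e * restrict inf_le_right (f j) =
        transition F i j ^ m * restrict inf_le_left (f i)) ↔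
      ∃ P : grading weights d, ∀ i, f i = fraction F d i P := by
  constructor
  · intro h
    obtain ⟨k, p, hp⟩ := exists_eq_fraction_of_le f d
    obtain ⟨P, hP, h1⟩ := exists_global_numerator hc hF hq hr (fun i => (p i).2) (fun i j => by
      have h2 := h i j
      rw [hp, hp, transition_mul_fraction_iff hc hF hq hr i j hm] at h2
      refine dvd_of_dvd_X_pow_mul hc hF hq hr (i := i) (n := d)
        (dvd_of_dvd_X_pow_mul hc hF hq hr (i := j) (n := d) (h2.trans (dvd_of_eq ?_)))
      ring)
    refine ⟨⟨P, hP⟩, fun i => ?_⟩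
    have h3 : X i.succ ^ k * P ∈ grading weights (k + d) := by
      have := SetLike.mul_mem_graded (SetLike.pow_mem_graded k
        (X_mem_grading_one (weights_succ i))) hP
      simpa using this
    rw [hp, ← fraction_X_pow_mul (Q := ⟨_, h3⟩) k i ⟨P, hP⟩ rfl, ← sub_eq_zero, ← map_sub,
      fraction_eq_zero_iff hc hF hq hr]
    exact h1 i
  · rintro ⟨P, hP⟩ i j
    rw [hP, hP, transition_mul_fraction_iff hc hF hq hr i j hm]
    exact (dvd_zero F).trans (dvd_of_eq (by ring))

end SectionsOfLineBundles

/-! ### Sections of `𝔰𝔩(E)(1)` as matrices of polynomials. -/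

section Sections

attribute [local instance] MvPolynomial.weightedGradedAlgebra

variable {F : MvPolynomial (Fin 6) ℂ} {c : ℂ} (hc : c ≠ 0) {q r : MvPolynomial (Fin 5) ℂ}
  (hF : F = C c * X 0 ^ 2 + rename Fin.succ q * X 0 + rename Fin.succ r)
  (hq : q ∈ grading unitWeights 2) (hr : r ∈ grading unitWeights 4)
  {a : Fin 2 → ℕ} {d d' : ℕ} (hd : 1 + a 0 = d + a 1) (hd' : 1 + a 1 = d' + a 0)

/-- For diagonal transition matrices the cocycle condition splits into entries: the entry `(k, l)`
is a section of `𝒪(1 + a k - a l)`, stated without subtraction. -/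
lemma mem_quarticSections_iff {s} : s ∈ quarticSections F a ↔ (∀ i, (s i).trace = 0) ∧
    ∀ k l i j, transition F i j ^ a l * restrict inf_le_right (s j k l) =
      transition F i j ^ (1 + a k) * restrict inf_le_left (s i k l) := by
  refine and_congr_right fun _ => ?_
  constructor
  · intro h k l i j
    have := congrFun (congrFun (h i j) k) l
    rw [Matrix.mul_diagonal, Matrix.smul_apply, Matrix.diagonal_mul] at this
    rw [mul_comm, pow_add, pow_one, mul_assoc]
    exact this
  · intro h i j
    ext k l
    have := h k l i j
    rw [Matrix.mul_diagonal, Matrix.smul_apply, Matrix.diagonal_mul]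
    rw [mul_comm, pow_add, pow_one, mul_assoc] at this
    exact this

/-- The traceless matrix with first row `(x, y)` and lower left entry `z`. -/
def tracelessMatrix (A : Type) [CommRing A] [Algebra ℂ A] :
    (A × A × A) →ₗ[ℂ] Matrix (Fin 2) (Fin 2) A where
  toFun m := !![m.1, m.2.1; m.2.2, -m.1]
  map_add' m n := by
    ext k l
    fin_cases k <;> fin_cases l <;> simp [add_comm]
  map_smul' c m := by
    ext k l
    fin_cases k <;> fin_cases l <;> simp

variable (F) in
/-- The family of traceless matrices whose entries are given by polynomials. -/
def matrixOfPolynomials (d d' : ℕ) :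
    (grading weights 1 × grading weights d × grading weights d') →ₗ[ℂ]
      ∀ i, Matrix (Fin 2) (Fin 2) Γ(hypersurface weights F, quarticChart F i) :=
  LinearMap.pi fun i => tracelessMatrix _ ∘ₗ
    (fraction F 1 i).prodMap ((fraction F d i).prodMap (fraction F d' i))

include hc hF hq hr hd hd' in
lemma range_matrixOfPolynomials :
    LinearMap.range (matrixOfPolynomials F d d') = quarticSections F a := by
  have h0 : 1 + a 0 = 1 + a 0 := rfl
  ext s
  rw [mem_quarticSections_iff]
  constructor
  · rintro ⟨m, rfl⟩
    refine ⟨fun i => ?_, ?_⟩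
    · rw [Matrix.trace_fin_two]
      exact add_neg_cancel _
    · intro k l
      fin_cases k <;> fin_cases l
      · exact (transition_mul_eq_iff hc hF hq hr rfl _).2 ⟨m.1, fun i => rfl⟩
      · exact (transition_mul_eq_iff hc hF hq hr hd _).2 ⟨m.2.1, fun i => rfl⟩
      · exact (transition_mul_eq_iff hc hF hq hr hd' _).2 ⟨m.2.2, fun i => rfl⟩
      · exact (transition_mul_eq_iff hc hF hq hr rfl _).2 ⟨-m.1, fun i => (map_neg _ _).symm⟩
  · rintro ⟨htr, h⟩
    obtain ⟨A, hA⟩ := (transition_mul_eq_iff hc hF hq hr rfl _).1 (h 0 0)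
    obtain ⟨B, hB⟩ := (transition_mul_eq_iff hc hF hq hr hd _).1 (h 0 1)
    obtain ⟨B', hB'⟩ := (transition_mul_eq_iff hc hF hq hr hd' _).1 (h 1 0)
    refine ⟨(A, B, B'), funext fun i => ?_⟩
    have htr := htr i
    rw [Matrix.trace_fin_two] at htr
    rw [Matrix.eta_fin_two (s i), hB, hB', eq_neg_of_add_eq_zero_right htr, hA]
    rfl

include hc hF hq hr hd hd' in
/-- The sections of `𝔰𝔩(E)(1)` on the quartic, for `E` a direct sum of two line bundles, are given
by matrices of polynomials. -/
lemma exists_equiv_quarticSections (h4 : d < 4) (h4' : d' < 4) :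
    ∃ T : (grading weights 1 × grading weights d × grading weights d') ≃ₗ[ℂ] quarticSections F a,
      ∀ m, (T m).1 = matrixOfPolynomials F d d' m := by
  have hinj : Function.Injective (matrixOfPolynomials F d d') := by
    intro m n h
    have h := congrFun h 0
    have h1 := congrFun (congrFun h 0) 0
    have h2 := congrFun (congrFun h 0) 1
    have h3 := congrFun (congrFun h 1) 0
    exact Prod.ext (fraction_injective hc hF hq hr (by lia) 0 h1)
      (Prod.ext (fraction_injective hc hF hq hr h4 0 h2) (fraction_injective hc hF hq hr h4' 0 h3))
  exact ⟨(LinearEquiv.ofInjective _ hinj).trans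
    (LinearEquiv.ofEq _ _ (range_matrixOfPolynomials hc hF hq hr hd hd')), fun m => rfl⟩

lemma trace_matrixOfPolynomials (m) (i : Fin 5) :
    (matrixOfPolynomials F d d' m i).trace = 0 := by
  rw [Matrix.trace_fin_two]
  exact add_neg_cancel _

lemma det_matrixOfPolynomials (hdd : d + d' = 2) (m) (i : Fin 5) {D : grading weights 2}
    (hD : D.1 = -(m.1.1 ^ 2 + m.2.1.1 * m.2.2.1)) :
    (matrixOfPolynomials F d d' m i).det = fraction F 2 i D := by
  rw [Matrix.det_fin_two]
  obtain ⟨A, B, B'⟩ := m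
  have h1 : A.1 * A.1 ∈ grading weights 2 := SetLike.mul_mem_graded A.2 A.2
  have h2 : B.1 * B'.1 ∈ grading weights 2 := hdd ▸ SetLike.mul_mem_graded B.2 B'.2
  change fraction F 1 i A * -fraction F 1 i A - fraction F d i B * fraction F d' i B' = _
  rw [mul_neg, fraction_mul (n := 2) rfl i A A (R := ⟨_, h1⟩) rfl,
    fraction_mul hdd i B B' (R := ⟨_, h2⟩) rfl, ← map_neg, ← map_sub]
  refine congrArg _ (Subtype.ext ?_)
  rw [hD]
  change -(A.1 * A.1) - B.1 * B'.1 = _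
  ring

end Sections

/-! ### Polynomial functions and general elements. -/

section GeneralElements

/-- The polynomial functions on a vector space. -/
abbrev polynomialFunctions (V : Type*) [AddCommGroup V] [Module ℂ V] : Subalgebra ℂ (V → ℂ) :=
  Algebra.adjoin ℂ {f : V → ℂ | ∃ φ : V →ₗ[ℂ] ℂ, f = φ}

lemma linear_mem_polynomialFunctions {V : Type*} [AddCommGroup V] [Module ℂ V] (φ : V →ₗ[ℂ] ℂ) :
    (φ : V → ℂ) ∈ polynomialFunctions V :=
  Algebra.subset_adjoin ⟨φ, rfl⟩

/-- This allows the open condition to be written on the space of polynomial matrices; `m₀` witnesses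
that the open set is non-empty. -/
lemma forGeneral_of_equiv {V M : Type*} [AddCommGroup V] [Module ℂ V] [AddCommGroup M]
    [Module ℂ M] (T : M ≃ₗ[ℂ] V) {P : V → Prop} {f : M → ℂ} (hf : f ∈ polynomialFunctions M)
    {m₀ : M} (h₀ : f m₀ ≠ 0) (h : ∀ m, f m ≠ 0 → P (T m)) : ForGeneral P := by
  refine ⟨fun v => f (T.symm v), ?_, fun h' => h₀ ?_, fun v hv => ?_⟩
  · clear h₀ h
    induction hf using Algebra.adjoin_induction with
    | mem f hf =>
      obtain ⟨φ, rfl⟩ := hf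
      exact Algebra.subset_adjoin ⟨φ ∘ₗ T.symm.toLinearMap, rfl⟩
    | algebraMap c => exact Subalgebra.algebraMap_mem _ c
    | add f g _ _ hf hg => exact Subalgebra.add_mem _ hf hg
    | mul f g _ _ hf hg => exact Subalgebra.mul_mem _ hf hg
  · simpa using congrFun h' (T m₀)
  · simpa using h _ hv

end GeneralElements

/-! ### Avoiding common factors with a given polynomial. -/

section CommonFactors

/-- If `p` vanished at most at the origin, the Nullstellensatz would put every variable in the prime
ideal `(p)`, making `p` associated to both `X 0` and `X 1`. -/
lemma exists_ne_zero_eval_eq_zero {p : MvPolynomial (Fin 5) ℂ} (hp : Irreducible p) :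
    ∃ z : Fin 5 → ℂ, z ≠ 0 ∧ eval z p = 0 := by
  by_contra! h
  have : (Ideal.span {p}).IsPrime := (Ideal.span_singleton_prime hp.ne_zero).2 hp.prime
  have key (i : Fin 5) : Associated p (X i) := by
    refine hp.associated_of_dvd (X_prime (R := ℂ) (i := i)).irreducible ?_
    rw [← Ideal.mem_span_singleton,
      ← MvPolynomial.IsPrime.vanishingIdeal_zeroLocus (K := ℂ) (Ideal.span {p})]
    intro z hz
    have h0 := hz p (Ideal.mem_span_singleton_self p)
    have : z = 0 := by
      by_contra hz0
      exact h z hz0 (by simpa [aeval_eq_eval] using h0)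
    simp [this]
  have h01 : (X 0 : MvPolynomial (Fin 5) ℂ) ∣ X 1 := ((key 0).symm.trans (key 1)).dvd
  rw [X_dvd_X] at h01
  simp at h01

/-- A polynomial that does not vanish at suitable points has no factor in common with a given
polynomial. -/
lemma exists_finset_isRelPrime {R : MvPolynomial (Fin 5) ℂ} (hR : R ≠ 0) :
    ∃ S : Finset (Fin 5 → ℂ), (∀ z ∈ S, z ≠ 0) ∧
      ∀ Q, (∀ z ∈ S, eval z Q ≠ 0) → Q ≠ 0 ∧ IsRelPrime Q R := by
  classical
  have h1 (p : MvPolynomial (Fin 5) ℂ) :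
      ∃ z : Fin 5 → ℂ, z ≠ 0 ∧ (Irreducible p → eval z p = 0) := by
    by_cases hp : Irreducible p
    · obtain ⟨z, hz, h⟩ := exists_ne_zero_eval_eq_zero hp
      exact ⟨z, hz, fun _ => h⟩
    · exact ⟨1, one_ne_zero, fun h => absurd h hp⟩
  choose z hz hzp using h1
  -- One non-zero zero is chosen on each irreducible factor of `R`. The point `1` ensures `Q ≠ 0`
  -- even when `R` has no factors.
  refine ⟨insert 1 ((UniqueFactorizationMonoid.factors R).toFinset.image z), ?_, ?_⟩
  · intro x hx
    rw [Finset.mem_insert, Finset.mem_image] at hx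
    rcases hx with rfl | ⟨p, -, rfl⟩
    · exact one_ne_zero
    · exact hz p
  · intro Q hQ
    have hQ0 : Q ≠ 0 := by
      rintro rfl
      exact hQ 1 (Finset.mem_insert_self _ _) (map_zero _)
    refine ⟨hQ0, WfDvdMonoid.isRelPrime_of_no_irreducible_factors (fun h => hQ0 h.1) ?_⟩
    intro p hp hpQ hpR
    obtain ⟨p', hp', hpp'⟩ := UniqueFactorizationMonoid.exists_mem_factors_of_dvd hR hp hpR
    obtain ⟨u, rfl⟩ := hpp'.symm.dvd.trans hpQ
    refine hQ (z p') (Finset.mem_insert_of_mem (Finset.mem_image_of_mem _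
      (Multiset.mem_toFinset.2 hp'))) ?_
    rw [map_mul, hzp p' (UniqueFactorizationMonoid.irreducible_of_factor _ hp'), zero_mul]

/-- Finitely many non-zero points can be avoided by one hyperplane; the square of its equation will
show that the open condition on `Q` is satisfiable. -/
lemma exists_linear_eval_ne_zero {S : Finset (Fin 5 → ℂ)} (hS : ∀ z ∈ S, z ≠ 0) :
    ∃ l ∈ grading unitWeights 1, ∀ z ∈ S, eval z l ≠ 0 := by
  obtain ⟨φ, hφ⟩ := Module.exists_dual_forall_apply_ne_zero (K := ℂ) (fun z : S => z.1)
    fun z => hS z.1 z.2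
  refine ⟨∑ i, φ (Pi.single i 1) • X i, Submodule.sum_mem _ fun i _ =>
    Submodule.smul_mem _ _ (isWeightedHomogeneous_X ℂ unitWeights i), fun z hz => ?_⟩
  have h := hφ ⟨z, hz⟩
  rw [LinearMap.pi_apply_eq_sum_univ φ z] at h
  simp only [map_sum, smul_eval, eval_X]
  convert h using 2 with i
  simp only [smul_eq_mul, mul_comm]
  congr 2 with j
  simp [Pi.single_apply, eq_comm]

end CommonFactors

/-! ### General sections for `E = 𝒪 ⊕ 𝒪`. -/

section TrivialBundle

attribute [local instance] MvPolynomial.weightedGradedAlgebra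

/-- Evaluation of a homogeneous polynomial at a point, as a linear functional. -/
def evalAt (d : ℕ) (x : Fin 6 → ℂ) : grading weights d →ₗ[ℂ] ℂ :=
  (aeval x).toLinearMap ∘ₗ (grading weights d).subtype

lemma evalAt_eq {d : ℕ} (x : Fin 6 → ℂ) {P : grading weights d} {p : MvPolynomial (Fin 6) ℂ}
    (h : P.1 = p) : evalAt d x P = eval x p := by
  rw [← aeval_eq_eval, ← h]
  rfl

lemma evalAt_rename {d : ℕ} (y : ℂ) (x : Fin 5 → ℂ) {P : grading weights d}
    {p : MvPolynomial (Fin 5) ℂ} (h : P.1 = rename Fin.succ p) :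
    evalAt d (Fin.cons y x) P = eval x p := by
  rw [evalAt_eq _ h, eval_cons_rename]

variable {F : MvPolynomial (Fin 6) ℂ}

/-- For `E = 𝒪 ⊕ 𝒪`, the degeneracy locus of a general section is a double cover of a quadric. -/
theorem forGeneral_doubleCover {c : ℂ} (hc : c ≠ 0) {q r R : MvPolynomial (Fin 5) ℂ}
    (hq : q ∈ grading unitWeights 2) (hr : r ∈ grading unitWeights 4)
    (hF : F = C c * X 0 ^ 2 + rename Fin.succ q * X 0 + rename Fin.succ r)
    (hR : R = q ^ 2 - C (4 * c) * r) (hR0 : R ≠ 0) :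
    ForGeneral (fun s : quarticSections F ![0, 0] => ∃ Q : MvPolynomial (Fin 5) ℂ, Q ≠ 0 ∧
      Q.IsHomogeneous 2 ∧ ∃ π : degeneracyLocus (quarticChart F) s.1 ⟶ hypersurface unitWeights Q,
        π.IsOver specC ∧ IsDoubleCoverRamifiedAlong π
          ((hypersurfaceIdeal unitWeights R).comap (hypersurfaceι unitWeights Q))) := by
  obtain ⟨T, hT⟩ := exists_equiv_quarticSections (a := ![0, 0]) (d := 1) (d' := 1) hc hF hq hr rfl
    rfl (by lia) (by lia)
  obtain ⟨S, hS, hSQ⟩ := exists_finset_isRelPrime hR0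
  obtain ⟨l, hl, hlS⟩ := exists_linear_eval_ne_zero hS
  let M := grading weights 1 × grading weights 1 × grading weights 1
  let x (z : Fin 5 → ℂ) : Fin 6 → ℂ := Fin.cons 0 z
  let A (z : Fin 5 → ℂ) : M →ₗ[ℂ] ℂ := evalAt 1 (x z) ∘ₗ LinearMap.fst _ _ _
  let B (z : Fin 5 → ℂ) : M →ₗ[ℂ] ℂ :=
    evalAt 1 (x z) ∘ₗ LinearMap.fst _ _ _ ∘ₗ LinearMap.snd _ _ _
  let B' (z : Fin 5 → ℂ) : M →ₗ[ℂ] ℂ :=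
    evalAt 1 (x z) ∘ₗ LinearMap.snd _ _ _ ∘ₗ LinearMap.snd _ _ _
  -- Up to sign this is the product of the values of the determinant at the points of `S`.
  let f : M → ℂ := ∏ z ∈ S, ((A z : M → ℂ) ^ 2 + (B z : M → ℂ) * (B' z : M → ℂ))
  have hf : f ∈ polynomialFunctions M := Subalgebra.prod_mem _ fun z _ =>
    Subalgebra.add_mem _ (Subalgebra.pow_mem _ (linear_mem_polynomialFunctions _) _)
      (Subalgebra.mul_mem _ (linear_mem_polynomialFunctions _) (linear_mem_polynomialFunctions _))
  have hfm (m : M) : f m = ∏ z ∈ S, (A z m ^ 2 + B z m * B' z m) := by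
    simp only [f, Finset.prod_apply]
    rfl
  -- The witness is the diagonal matrix with entries `l, -l`, whose determinant is `-l²`.
  refine forGeneral_of_equiv T (m₀ := (⟨_, rename_mem_grading hl⟩, 0, 0)) hf ?_ ?_
  · rw [hfm, Finset.prod_ne_zero_iff]
    intro z hz
    have h1 : A z (⟨_, rename_mem_grading hl⟩, 0, 0) = eval z l := evalAt_rename _ _ rfl
    have h2 : B z (⟨_, rename_mem_grading hl⟩, 0, 0) = 0 := map_zero (evalAt 1 (x z))
    rw [h1, h2]
    simpa using hlS z hz
  · intro m hm
    obtain ⟨a, b, b'⟩ := m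
    have ha := eq_rename_of_weight_lt_two a.2 one_lt_two
    have hb := eq_rename_of_weight_lt_two b.2 one_lt_two
    have hb' := eq_rename_of_weight_lt_two b'.2 one_lt_two
    set p := yCoeff a.1 0
    set p₁ := yCoeff b.1 0
    set p₂ := yCoeff b'.1 0
    have hQ : -(p ^ 2 + p₁ * p₂) ∈ grading unitWeights 2 :=
      Submodule.neg_mem _ (Submodule.add_mem _
        (SetLike.pow_mem_graded 2 (yCoeff_mem a.2 (n := 1) rfl))
        (SetLike.mul_mem_graded (yCoeff_mem b.2 (n := 1) rfl) (yCoeff_mem b'.2 (n := 1) rfl)))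
    obtain ⟨hQ0, hQR⟩ := hSQ (-(p ^ 2 + p₁ * p₂)) (fun z hz => by
      rw [hfm, Finset.prod_ne_zero_iff] at hm
      have h1 : A z (a, b, b') = eval z p := evalAt_rename _ _ ha
      have h2 : B z (a, b, b') = eval z p₁ := evalAt_rename _ _ hb
      have h3 : B' z (a, b, b') = eval z p₂ := evalAt_rename _ _ hb'
      have := hm z hz
      rw [h1, h2, h3] at this
      simpa [add_comm] using neg_ne_zero.2 this)
    have hΔ : rename Fin.succ (-(p ^ 2 + p₁ * p₂)) ∈ grading weights (2 • 1) :=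
      mem_grading_smul_one (rename_mem_grading hQ)
    refine ⟨_, hQ0, hQ, exists_doubleCover hc hq hr hF hQ hR
      (fun u hu => hQR.dvd_of_dvd_mul_left hu) hΔ (fun i => ?_) (fun i => ?_)⟩
    · rw [hT]
      exact trace_matrixOfPolynomials _ _
    · rw [hT]
      refine det_matrixOfPolynomials (D := ⟨_, rename_mem_grading hQ⟩) rfl _ i ?_
      change _ = -(a.1 ^ 2 + b.1 * b'.1)
      rw [ha, hb, hb']
      simp only [map_neg, map_add, map_mul, map_pow]

end TrivialBundle

/-! ### General sections for `E = 𝒪 ⊕ 𝒪(1)`. -/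

section TwistedBundle

attribute [local instance] MvPolynomial.weightedGradedAlgebra

variable {F : MvPolynomial (Fin 6) ℂ}

lemma discriminant_mem {c : ℂ} {q r : MvPolynomial (Fin 5) ℂ} (hq : q ∈ grading unitWeights 2)
    (hr : r ∈ grading unitWeights 4) : q ^ 2 - C (4 * c) * r ∈ grading unitWeights 4 :=
  Submodule.sub_mem _ (SetLike.pow_mem_graded 2 hq)
    (SetLike.mul_mem_graded (i := 0) (j := 4) (C_mem_grading _) hr)

lemma exists_quadratic_ne_zero {c : ℂ} (hc : c ≠ 0) (u v : ℂ) :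
    ∃ t : ℂ, c * t ^ 2 + u * t + v ≠ 0 := by
  by_contra! h
  have h0 := h 0
  have h1 := h 1
  have h2 := h (-1)
  exact hc (by linear_combination (h1 + h2) / 2 - h0)

/-- For `E = 𝒪 ⊕ 𝒪(1)`, the degeneracy locus of a general section is a quartic in `ℙ⁴`. -/
theorem forGeneral_quartic {c : ℂ} (hc : c ≠ 0) {q r : MvPolynomial (Fin 5) ℂ}
    (hq : q ∈ grading unitWeights 2) (hr : r ∈ grading unitWeights 4)
    (hF : F = C c * X 0 ^ 2 + rename Fin.succ q * X 0 + rename Fin.succ r) :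
    ForGeneral (fun s : quarticSections F ![0, 1] => ∃ G : MvPolynomial (Fin 5) ℂ,
      G ≠ 0 ∧ G.IsHomogeneous 4 ∧
        ∃ e : degeneracyLocus (quarticChart F) s.1 ≅ hypersurface unitWeights G,
          e.hom.IsOver specC) := by
  obtain ⟨T, hT⟩ := exists_equiv_quarticSections (a := ![0, 1]) (d := 0) (d' := 2) hc hF hq hr rfl
    rfl (by lia) (by lia)
  let M := grading weights 1 × grading weights 0 × grading weights 2
  let z : Fin 5 → ℂ := Pi.single 0 1
  let x : Fin 6 → ℂ := Fin.cons 0 z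
  let A : M →ₗ[ℂ] ℂ := evalAt 1 x ∘ₗ LinearMap.fst _ _ _
  let B : M →ₗ[ℂ] ℂ := evalAt 0 x ∘ₗ LinearMap.fst _ _ _ ∘ₗ LinearMap.snd _ _ _
  let B' : M →ₗ[ℂ] ℂ := evalAt 2 x ∘ₗ LinearMap.snd _ _ _ ∘ₗ LinearMap.snd _ _ _
  -- Evaluation at `(1,0,0,0,0,0)` extracts the coefficient of `y` in the entry of weight two.
  let Λ : M →ₗ[ℂ] ℂ := evalAt 2 (Fin.cons 1 0) ∘ₗ LinearMap.snd _ _ _ ∘ₗ LinearMap.snd _ _ _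
  let D : M → ℂ := (A : M → ℂ) ^ 2 + (B : M → ℂ) * (B' : M → ℂ)
  let m : M → ℂ := (B : M → ℂ) * (Λ : M → ℂ)
  -- Where `m ≠ 0` the determinant vanishes for `y = N`, with `N(z) = -D / m`. The second factor is
  -- `m²` times the value at `z` of the quartic `c N² + q N + r`, so `f ≠ 0` gives both `m ≠ 0` and
  -- a non-zero quartic.
  let f : M → ℂ := m * (c • D ^ 2 - eval z q • (m * D) + eval z r • m ^ 2)
  have hD : D ∈ polynomialFunctions M :=
    Subalgebra.add_mem _ (Subalgebra.pow_mem _ (linear_mem_polynomialFunctions _) _)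
      (Subalgebra.mul_mem _ (linear_mem_polynomialFunctions _) (linear_mem_polynomialFunctions _))
  have hm : m ∈ polynomialFunctions M :=
    Subalgebra.mul_mem _ (linear_mem_polynomialFunctions _) (linear_mem_polynomialFunctions _)
  have hf : f ∈ polynomialFunctions M := Subalgebra.mul_mem _ hm (Subalgebra.add_mem _
    (Subalgebra.sub_mem _ (Subalgebra.smul_mem _ (Subalgebra.pow_mem _ hD _) _)
      (Subalgebra.smul_mem _ (Subalgebra.mul_mem _ hm hD) _))
    (Subalgebra.smul_mem _ (Subalgebra.pow_mem _ hm _) _))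
  have hfn (n : M) : f n = B n * Λ n * (c * (A n ^ 2 + B n * B' n) ^ 2 -
    eval z q * (B n * Λ n * (A n ^ 2 + B n * B' n)) + eval z r * (B n * Λ n) ^ 2) := rfl
  obtain ⟨t, ht⟩ := exists_quadratic_ne_zero hc (-eval z q) (eval z r)
  have h1 : (1 : MvPolynomial (Fin 6) ℂ) ∈ grading weights 0 :=
    SetLike.one_mem_graded (grading weights)
  have h2 : X 0 + C t * X (Fin.succ 0) ^ 2 ∈ grading weights 2 :=
    Submodule.add_mem _ (X_mem_grading (w := weights) 0) (SetLike.mul_mem_graded (i := 0) (j := 2)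
      (C_mem_grading t) (SetLike.pow_mem_graded 2
        (X_mem_grading_one (weights_succ 0))))
  -- For diagonal entries zero and off-diagonal entries `1` and `y + t x_1²`, one has `m = 1` and `D
  -- = t`, so `f` takes the value `c t² - q(z) t + r(z)`, non-zero by the choice of `t`.
  refine forGeneral_of_equiv T (m₀ := (0, ⟨_, h1⟩, ⟨_, h2⟩)) hf ?_ ?_
  · rw [hfn]
    have e1 : A (0, ⟨_, h1⟩, ⟨_, h2⟩) = 0 := map_zero (evalAt 1 x)
    have e2 : B (0, ⟨_, h1⟩, ⟨_, h2⟩) = 1 := (evalAt_eq x rfl).trans (map_one _)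
    have e3 : B' (0, ⟨_, h1⟩, ⟨_, h2⟩) = t := (evalAt_eq x
      (p := X 0 + C t * X (Fin.succ 0) ^ 2) rfl).trans (by
      simp only [map_add, map_mul, map_pow, eval_C, eval_X]
      simp [x, z])
    have e4 : Λ (0, ⟨_, h1⟩, ⟨_, h2⟩) = 1 := (evalAt_eq _
      (p := X 0 + C t * X (Fin.succ 0) ^ 2) rfl).trans (by
      simp only [map_add, map_mul, map_pow, eval_C, eval_X]
      simp)
    rw [e1, e2, e3, e4]
    convert ht using 1
    ring
  · intro n hn
    rw [hfn] at hn
    obtain ⟨a, b, b'⟩ := n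
    have ha := eq_rename_of_weight_lt_two a.2 one_lt_two
    have hb := eq_rename_of_weight_lt_two b.2 two_pos
    have hb' := eq_of_weight_two b'.2
    have hbC := eq_C_of_mem_grading_zero (yCoeff_mem b.2 (k := 0) (n := 0) rfl)
    rw [hbC, rename_C] at hb
    have hp := yCoeff_mem a.2 (k := 0) (n := 1) rfl
    have hp' := yCoeff_mem b'.2 (k := 0) (n := 2) rfl
    set p := yCoeff a.1 0
    set p' := yCoeff b'.1 0
    set β := coeff 0 (yCoeff b.1 0)
    set l := coeff 0 (yCoeff b'.1 1)
    have e1 : A (a, b, b') = eval z p := evalAt_rename _ _ ha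
    have e2 : B (a, b, b') = β := (evalAt_eq x hb).trans (eval_C _)
    have e3 : B' (a, b, b') = eval z p' := (evalAt_eq x hb').trans (by
      rw [map_add, eval_cons_rename, map_mul, eval_X]
      simp [x])
    have e4 : Λ (a, b, b') = l := (evalAt_eq _ hb').trans (by
      rw [map_add, eval_cons_rename, map_mul, eval_X, eval_C,
        eval_zero_of_mem_grading hp' two_ne_zero]
      simp)
    rw [e1, e2, e3, e4] at hn
    have hμ : β * l ≠ 0 := left_ne_zero_of_mul hn
    have hP : p ^ 2 + C β * p' ∈ grading unitWeights 2 :=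
      Submodule.add_mem _ (SetLike.pow_mem_graded 2 hp)
        (SetLike.mul_mem_graded (i := 0) (j := 2) (C_mem_grading β) hp')
    -- Solving `-(p² + β (l y + p')) = 0` for `y` gives `y = N`.
    let N := C (-(β * l))⁻¹ * (p ^ 2 + C β * p')
    have hN : N ∈ grading unitWeights 2 :=
      SetLike.mul_mem_graded (i := 0) (j := 2) (C_mem_grading _) hP
    have hΔ : C (-(β * l)) * (X 0 - rename Fin.succ N) ∈ grading weights 2 :=
      SetLike.mul_mem_graded (i := 0) (j := 2) (C_mem_grading _)
        (Submodule.sub_mem _ (X_mem_grading (w := weights) 0) (rename_mem_grading hN))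
    have hG : C c * N ^ 2 + q * N + r ∈ grading unitWeights 4 :=
      Submodule.add_mem _ (Submodule.add_mem _ (SetLike.mul_mem_graded (i := 0) (j := 4)
        (C_mem_grading c) (SetLike.pow_mem_graded 2 hN)) (SetLike.mul_mem_graded hq hN)) hr
    refine ⟨_, fun h => right_ne_zero_of_mul hn ?_, hG, degeneracyLocus_iso_quartic hc hq hr hF
      (neg_ne_zero.2 hμ) hN (mem_grading_smul_one hΔ) (fun i => ?_) (fun i => ?_)⟩
    · have h3 := congrArg (eval z) h
      have h4 : -(β * l) * eval z N = eval z p ^ 2 + β * eval z p' := by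
        simp only [N, map_mul, map_add, map_pow, eval_C]
        rw [mul_inv_cancel_left₀ (neg_ne_zero.2 hμ)]
      simp only [map_mul, map_add, map_pow, eval_C, map_zero] at h3
      rw [← h4]
      linear_combination (β * l) ^ 2 * h3
    · rw [hT]
      exact trace_matrixOfPolynomials _ _
    · rw [hT]
      refine det_matrixOfPolynomials (D := ⟨_, hΔ⟩) rfl _ i ?_
      change _ = -(a.1 ^ 2 + b.1 * b'.1)
      have h5 : (C (-(β * l)) * C (-(β * l))⁻¹ : MvPolynomial (Fin 6) ℂ) = 1 := by
        rw [← C_mul, mul_inv_cancel₀ (neg_ne_zero.2 hμ), C_1]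
      simp only [N]
      rw [ha, hb, hb']
      simp only [map_add, map_mul, map_pow, rename_C]
      rw [mul_sub, ← mul_assoc, h5, map_neg, map_mul]
      ring

end TwistedBundle

end NilpotentLocus

end

/-! ### Conclusion for a smooth quartic. -/

theorem mainTheorem8 (F : MvPolynomial (Fin 6) ℂ)
    (hF : MvPolynomial.IsWeightedHomogeneous NilpotentLocus.weights F 4)
    (hsmooth : NilpotentLocus.IsSmoothEquation F) :
    NilpotentLocus.ForGeneral (fun s : NilpotentLocus.quarticSections F ![0, 0] =>
      ∃ Q R : MvPolynomial (Fin 5) ℂ,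
        Q ≠ 0 ∧ Q.IsHomogeneous 2 ∧ R ≠ 0 ∧ R.IsHomogeneous 4 ∧
        ∃ π : NilpotentLocus.degeneracyLocus (NilpotentLocus.quarticChart F) s.1 ⟶
            NilpotentLocus.hypersurface NilpotentLocus.unitWeights Q,
          π.IsOver NilpotentLocus.specC ∧
          NilpotentLocus.IsDoubleCoverRamifiedAlong π
            ((NilpotentLocus.hypersurfaceIdeal NilpotentLocus.unitWeights R).comap
              (NilpotentLocus.hypersurfaceι NilpotentLocus.unitWeights Q))) ∧
    NilpotentLocus.ForGeneral (fun s : NilpotentLocus.quarticSections F ![0, 1] =>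
      ∃ G : MvPolynomial (Fin 5) ℂ,
        G ≠ 0 ∧ G.IsHomogeneous 4 ∧
        ∃ e : NilpotentLocus.degeneracyLocus (NilpotentLocus.quarticChart F) s.1 ≅
            NilpotentLocus.hypersurface NilpotentLocus.unitWeights G,
          e.hom.IsOver NilpotentLocus.specC) := by
  have hF' := NilpotentLocus.eq_of_weight_four hF
  have hq := NilpotentLocus.yCoeff_mem hF (k := 1) (n := 2) rfl
  have hr := NilpotentLocus.yCoeff_mem hF (k := 0) (n := 4) rfl
  have hc := NilpotentLocus.leading_coeff_ne_zero hsmooth hF' hq hr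
  have hR0 := NilpotentLocus.discriminant_ne_zero hsmooth hF' hc
  refine ⟨?_, NilpotentLocus.forGeneral_quartic hc hq hr hF'⟩
  obtain ⟨f, hf, hf0, h⟩ := NilpotentLocus.forGeneral_doubleCover hc hq hr hF' rfl hR0
  refine ⟨f, hf, hf0, fun s hs => ?_⟩
  obtain ⟨Q, hQ0, hQ, hπ⟩ := h s hs
  -- The branch quartic is the discriminant of `F` with respect to `y`; it does not depend on the
  -- section.
  exact ⟨Q, _, hQ0, hQ, hR0, NilpotentLocus.discriminant_mem hq hr, hπ⟩
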